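/- **Setting.** Let $S$ be a finite set or $S=\mathbb Z^d$, and let $p(x,y)$ be an irreducible symmetric transition probability on $S$ with $p(x,x)=0$; if $S=\mathbb Z^d$, assume moreover that $p$ is translation invariant and of finite range. Let $m>0$. The symmetric inclusion process SIP$(m)$ is the Markov process on $\mathbb N^S$ with generator $$Lf(\eta)=\sum_{x,y\in S}p(x,y)\,2\eta_x(m+2\eta_y)\bigl(f(\eta^{x,y})-f(\eta)\bigr),$$ where $\eta^{x,y}$ is obtained from $\eta$ by moving one particle from $x$ to $y$. From a finite configuration its semigroup is $e^{tL}$; from an infinite configuration $\eta$ its law $S_t(\eta,\cdot)$ at time $t$ is the weak limit, as the finite set $\Lambda$ increases to $S$, of the laws at time $t$ of the process started from the particles of $\eta$ in $\Lambda$. For a measure $\nu$ on $\mathbb N^S$ put $\nu S(t)=\int \nu(d\eta)\,S_t(\eta,\cdot)$. For a finite configuration $\xi$ (i.e. $|\xi|=\sum_x\xi_x<\infty$) and $\eta\in\mathbb N^S$ let $$D(\xi,\eta)=\prod_{x}d(\xi_x,\eta_x),\qquad d(k,l)=\frac{l!}{(l-k)!}\,\frac{\Gamma(m/2)}{\Gamma(m/2+k)}\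 \text{ if }k\le l,\qquad d(k,l)=0\ \text{ if }k>l .$$ Let $\mathcal P_f$ be the set of probability measures $\mu$ on $\mathbb N^S$ with $\sup_{|\xi|=n}\int D(\xi,\eta)\,\mu(d\eta)<\infty$ for all $n\in\mathbb N$, and put $K_\mu(x_1,\dots,x_n)=\int D\bigl(\sum_{i=1}^n\delta_{x_i},\eta\bigr)\mu(d\eta)$. Let $p_t(x,y)=\sum_{n\ge0}\frac{(2mt)^n}{n!}e^{-2mt}p^{(n)}(x,y)$, where $p^{(n)}$ is the $n$-step transition probability. Consider the assumptions * (A1) $\lim_{t\to\infty}\sup_{x,y\in S}\sum_{u\in S}p_t(x,u)p_t(y,u)=0$, i.e. two independent walkers with transition probabilities $p_t$ started at $x,y$ are at the same site at time $t$ with probability tending to $0$ uniformly in $x,y$; * (A2) two particles of SIP$(m)$ started at $x,y$ are at the same site at time $t$ with probability tending to $0$ as $t\to\infty$, uniformly in $x,y\in S$. **Statement.** (a) Assume (A2). For all $n$ and $x_1,\dots,x_n\in S$, the probability that at time $t$ at least two of the particles of SIP$(m)$ started from $\sum_{i=1}^n\delta_{x_i}$ are at the same site tends to $0$ as $t\to\infty$.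 (b) Assume (A1) and (A2). Let $\nu\in\mathcal P_f$ be a product measure, let $t_k\to\infty$, and let $\mu$ be a probability measure on $\mathbb N^S$ such that $\mu=\lim_{k}\nu S(t_k)$ in the sense that $\int D(\xi,\eta)\,(\nu S(t_k))(d\eta)\to\int D(\xi,\eta)\,\mu(d\eta)$ for every finite configuration $\xi$. Then $\mu\in\mathcal P_f$; $\mu$ is invariant, i.e. $\mu S(t)=\mu$ for all $t\ge0$; and for all $n$ and all $x_1,\dots,x_n\in S$ $$K_\mu(x_1,\dots,x_n)\ \ge\ \prod_{i=1}^nK_\mu(x_i).$$ -/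

import Mathlib

open MeasureTheory Filter Topology
open scoped BigOperators BoundedContinuousFunction ENNReal

namespace SIP

noncomputable section

variable {S : Type*}

/-! ### The underlying random walk -/

open Classical in
/-- The `n`-step transition probabilities `p^{(n)}(x, y)`. -/
def stepProb (p : S → S → ℝ) : ℕ → S → S → ℝ
  | 0, x, y => if x = y then 1 else 0
  | n + 1, x, y => ∑' z, p x z * stepProb p n z y

/-- `p` is an irreducible symmetric transition probability on `S` without self-loops. -/
structure IsSymmetricWalk (p : S → S → ℝ) : Prop where
  nonneg : ∀ x y, 0 ≤ p x y
  sum_one : ∀ x, HasSum (p x) 1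
  symm : ∀ x y, p x y = p y x
  loopless : ∀ x, p x x = 0
  irreducible : ∀ x y, ∃ n, 0 < stepProb p n x y

/-- Either `S` is finite, or `S` is (a copy of) the lattice `ℤ^d` and `p` is translation invariant
and of finite range. -/
def FiniteOrLattice (p : S → S → ℝ) : Prop :=
  Finite S ∨
    ∃ (d : ℕ) (e : S ≃ (Fin d → ℤ)),
      (∃ π : (Fin d → ℤ) → ℝ, ∀ x y, p x y = π (e y - e x)) ∧
      ∃ R : ℝ, 0 < R ∧ ∀ x y, R < ‖e x - e y‖ → p x y = 0

/-- Transition probabilities of the continuous-time random walk jumping at rate `2m`. -/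
def walkProb (p : S → S → ℝ) (m t : ℝ) (x y : S) : ℝ :=
  ∑' n : ℕ, (2 * m * t) ^ n / (n.factorial : ℝ) * Real.exp (-(2 * m * t)) * stepProb p n x y

/-- The probability that two independent walkers started at `x` and `y` are at the same site at
time `t`. -/
def walkMeetProb (p : S → S → ℝ) (m t : ℝ) (x y : S) : ℝ :=
  ∑' u, walkProb p m t x u * walkProb p m t y u

/-! ### The inclusion process with finitely many particles -/

/-- The configuration `ξ^{x,y}`: one particle is moved from `x` to `y`. -/
def move (ξ : S →₀ ℕ) (x y : S) : S →₀ ℕ :=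
  ξ - Finsupp.single x 1 + Finsupp.single y 1

/-- The generator of the symmetric inclusion process on functions of finite configurations,
`L F (ξ) = ∑_{x,y} p(x,y) 2 ξ_x (m + 2 ξ_y) (F(ξ^{x,y}) - F(ξ))`
(the terms with `ξ_x = 0` vanish and are left out). -/
def generator (p : S → S → ℝ) (m : ℝ) (F : (S →₀ ℕ) → ℝ) (ξ : S →₀ ℕ) : ℝ :=
  ∑ x ∈ ξ.support, ∑' y,
    p x y * (2 * (ξ x : ℝ)) * (m + 2 * (ξ y : ℝ)) * (F (move ξ x y) - F ξ)

/-- The semigroup `exp (t L)` of the process with finitely many particles: for bounded `F` this is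
the expectation of `F(ξ_t)` for the process started from `ξ`. The number of particles is conserved,
and `L` is a bounded operator on the bounded functions of configurations with a given number of
particles, so that the exponential series converges absolutely. -/
def finSemigroup (p : S → S → ℝ) (m t : ℝ) (F : (S →₀ ℕ) → ℝ) (ξ : S →₀ ℕ) : ℝ :=
  ∑' k : ℕ, t ^ k / (k.factorial : ℝ) * ((generator p m)^[k] F) ξ

/-- The configuration `∑ i, δ_{x_i}`. -/
def particles {n : ℕ} (x : Fin n → S) : S →₀ ℕ :=
  ∑ i, Finsupp.single (x i) 1

/-- The probability that, at time `t`, at least two particles of the inclusion process started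
from `ξ` are at the same site. -/
def collisionProb (p : S → S → ℝ) (m t : ℝ) (ξ : S →₀ ℕ) : ℝ :=
  finSemigroup p m t ({ζ : S →₀ ℕ | ∃ z, 2 ≤ ζ z}.indicator 1) ξ

/-- Assumption (A1): two independent walkers are eventually at distinct sites, uniformly in their
starting points. -/
def AssumptionA1 (p : S → S → ℝ) (m : ℝ) : Prop :=
  Tendsto (fun t : ℝ => ⨆ z : S × S, walkMeetProb p m t z.1 z.2) atTop (𝓝 0)

/-- Assumption (A2): two particles of the inclusion process are eventually at distinct sites,
uniformly in their starting points. -/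
def AssumptionA2 (p : S → S → ℝ) (m : ℝ) : Prop :=
  Tendsto (fun t : ℝ => ⨆ z : S × S, collisionProb p m t (particles ![z.1, z.2])) atTop (𝓝 0)

/-! ### The inclusion process on `ℕ^S` -/

/-- The restriction of a configuration to a finite set of sites. -/
def restrict (Λ : Finset S) (η : S → ℕ) : S →₀ ℕ :=
  Finsupp.indicator Λ fun x _ => η x

/-- `ρ` is the law at time `t` of the inclusion process started from `η`: the weak limit, as the
finite set `Λ` increases to `S`, of the laws at time `t` of the process started from the particles
of `η` in `Λ`. -/
def IsLawAt (p : S → S → ℝ) (m t : ℝ) (η : S → ℕ) (ρ : Measure (S → ℕ)) : Prop :=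
  IsProbabilityMeasure ρ ∧
    ∀ f : (S → ℕ) →ᵇ ℝ,
      Tendsto (fun Λ : Finset S => finSemigroup p m t (fun ξ => f ξ) (restrict Λ η)) atTop
        (𝓝 (∫ ζ, f ζ ∂ρ))

open Classical in
/-- The transition kernel `S_t(η, ·)` of the inclusion process on `ℕ^S`. On configurations from
which the process cannot be started (no limiting law) it is the zero measure. -/
def kernel (p : S → S → ℝ) (m t : ℝ) (η : S → ℕ) : Measure (S → ℕ) :=
  if h : ∃ ρ, IsLawAt p m t η ρ then h.choose else 0

/-- The measure `ν S(t) = ∫ ν(dη) S_t(η, ·)`. -/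
def evolve (p : S → S → ℝ) (m t : ℝ) (ν : Measure (S → ℕ)) : Measure (S → ℕ) :=
  ν.bind (kernel p m t)

/-- `μ` is an invariant measure of the inclusion process. -/
def IsInvariant (p : S → S → ℝ) (m : ℝ) (μ : Measure (S → ℕ)) : Prop :=
  ∀ t : ℝ, 0 ≤ t → evolve p m t μ = μ

/-! ### Duality functions and duality moments -/

/-- `d(k, l) = l! / (l - k)! * Γ(m/2) / Γ(m/2 + k)` for `k ≤ l`, and `0` for `k > l`. -/
def dualSite (m : ℝ) (k l : ℕ) : ℝ :=
  (l.descFactorial k : ℝ) * (Real.Gamma (m / 2) / Real.Gamma (m / 2 + k))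

/-- The duality function `D(ξ, η) = ∏_x d(ξ_x, η_x)`. -/
def dual (m : ℝ) (ξ : S →₀ ℕ) (η : S → ℕ) : ℝ :=
  ∏ x ∈ ξ.support, dualSite m (ξ x) (η x)

/-- `∫ D(ξ, η) μ(dη)`, as an element of `[0, ∞]`. -/
def dualMoment (m : ℝ) (μ : Measure (S → ℕ)) (ξ : S →₀ ℕ) : ℝ≥0∞ :=
  ∫⁻ η, ENNReal.ofReal (dual m ξ η) ∂μ

/-- The class of probability measures with uniformly finite duality moments:
`sup_{|ξ| = n} ∫ D(ξ, η) μ(dη) < ∞` for all `n`. -/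
def UniformlyFiniteMoments (m : ℝ) (μ : Measure (S → ℕ)) : Prop :=
  IsProbabilityMeasure μ ∧
    ∀ n : ℕ, (⨆ (ξ : S →₀ ℕ) (_ : ξ.degree = n), dualMoment m μ ξ) < ∞

/-- The duality moment function `K_μ(x_1, …, x_n) = ∫ D(∑ i, δ_{x_i}, η) μ(dη)`. -/
def dualityMomentFunction (m : ℝ) (μ : Measure (S → ℕ)) {n : ℕ} (x : Fin n → S) : ℝ :=
  ∫ η, dual m (particles x) η ∂μ

end

end SIP

namespace SIP

noncomputable section

variable {S : Type*}

/-! ### Expectations with respect to probability mass functions -/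

section Mean

variable {α β : Type*}

/-- The expectation of a `[0, ∞]`-valued function. -/
def lmean (κ : PMF α) (G : α → ℝ≥0∞) : ℝ≥0∞ := ∑' a, κ a * G a

/-- The expectation of a bounded real function. -/
def mean (κ : PMF α) (F : α → ℝ) : ℝ := ∑' a, (κ a).toReal * F a

theorem lmean_pure (a : α) (G : α → ℝ≥0∞) : lmean (PMF.pure a) G = G a := by
  unfold lmean
  rw [tsum_eq_single a]
  · simp
  · intro b hb
    simp [hb]

theorem lmean_bind (κ : PMF α) (f : α → PMF β) (G : β → ℝ≥0∞) :
    lmean (κ.bind f) G = lmean κ fun a => lmean (f a) G := by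
  unfold lmean
  simp_rw [PMF.bind_apply, ← ENNReal.tsum_mul_right, ← ENNReal.tsum_mul_left]
  rw [ENNReal.tsum_comm]
  simp_rw [mul_assoc]

theorem lmean_map (κ : PMF α) (f : α → β) (G : β → ℝ≥0∞) :
    lmean (κ.map f) G = lmean κ fun a => G (f a) := by
  rw [← PMF.bind_pure_comp, lmean_bind]
  simp [lmean_pure]

theorem lmean_const (κ : PMF α) (c : ℝ≥0∞) : lmean κ (fun _ => c) = c := by
  unfold lmean
  rw [ENNReal.tsum_mul_right, κ.tsum_coe, one_mul]

theorem lmean_mono {κ : PMF α} {G H : α → ℝ≥0∞} (h : ∀ a ∈ κ.support, G a ≤ H a) :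
    lmean κ G ≤ lmean κ H := by
  refine ENNReal.tsum_le_tsum fun a => ?_
  by_cases ha : a ∈ κ.support
  · gcongr
    exact h a ha
  · rw [PMF.mem_support_iff, not_not] at ha
    simp [ha]

theorem lmean_congr {κ : PMF α} {G H : α → ℝ≥0∞} (h : ∀ a ∈ κ.support, G a = H a) :
    lmean κ G = lmean κ H :=
  le_antisymm (lmean_mono fun a ha => (h a ha).le) (lmean_mono fun a ha => (h a ha).ge)

theorem lmean_add (κ : PMF α) (G H : α → ℝ≥0∞) :
    lmean κ (fun a => G a + H a) = lmean κ G + lmean κ H := by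
  unfold lmean
  simp_rw [mul_add]
  exact ENNReal.tsum_add

theorem lmean_const_mul (κ : PMF α) (c : ℝ≥0∞) (G : α → ℝ≥0∞) :
    lmean κ (fun a => c * G a) = c * lmean κ G := by
  unfold lmean
  rw [← ENNReal.tsum_mul_left]
  exact tsum_congr fun a => by ring

theorem lmean_tsum {ι : Type*} (κ : PMF α) (G : ι → α → ℝ≥0∞) :
    lmean κ (fun a => ∑' i, G i a) = ∑' i, lmean κ (G i) := by
  unfold lmean
  simp_rw [← ENNReal.tsum_mul_left]
  exact ENNReal.tsum_comm

theorem lmean_sum {ι : Type*} (κ : PMF α) (s : Finset ι) (G : ι → α → ℝ≥0∞) :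
    lmean κ (fun a => ∑ i ∈ s, G i a) = ∑ i ∈ s, lmean κ (G i) := by
  unfold lmean
  simp_rw [Finset.mul_sum]
  exact Summable.tsum_finsetSum fun _ _ => ENNReal.summable

theorem lmean_comm (κ : PMF α) (κ' : PMF β) (G : α → β → ℝ≥0∞) :
    lmean κ (fun a => lmean κ' (G a)) = lmean κ' fun b => lmean κ fun a => G a b := by
  unfold lmean
  simp_rw [← ENNReal.tsum_mul_left]
  rw [ENNReal.tsum_comm]
  exact tsum_congr fun b => tsum_congr fun a => by ring

theorem pmf_summable (κ : PMF α) : Summable fun a => (κ a).toReal :=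
  ENNReal.summable_toReal κ.tsum_coe_ne_top

theorem pmf_tsum_toReal (κ : PMF α) : ∑' a, (κ a).toReal = 1 := by
  rw [← ENNReal.tsum_toReal_eq κ.apply_ne_top, κ.tsum_coe, ENNReal.toReal_one]

theorem mean_summable (κ : PMF α) {F : α → ℝ} {C : ℝ} (hF : ∀ a, |F a| ≤ C) :
    Summable fun a => (κ a).toReal * F a := by
  refine Summable.of_norm_bounded ((pmf_summable κ).mul_right C) fun a => ?_
  rw [Real.norm_eq_abs, abs_mul, abs_of_nonneg ENNReal.toReal_nonneg]
  exact mul_le_mul_of_nonneg_left (hF a) ENNReal.toReal_nonneg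

theorem mean_pure (a : α) (F : α → ℝ) : mean (PMF.pure a) F = F a := by
  unfold mean
  rw [tsum_eq_single a]
  · simp
  · intro b hb
    simp [hb]

theorem mean_const (κ : PMF α) (c : ℝ) : mean κ (fun _ => c) = c := by
  unfold mean
  rw [tsum_mul_right, pmf_tsum_toReal, one_mul]

theorem mean_add (κ : PMF α) {F G : α → ℝ} {C C' : ℝ} (hF : ∀ a, |F a| ≤ C)
    (hG : ∀ a, |G a| ≤ C') : mean κ (fun a => F a + G a) = mean κ F + mean κ G := by
  unfold mean
  simp_rw [mul_add]
  exact (mean_summable κ hF).tsum_add (mean_summable κ hG)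

theorem mean_const_mul (κ : PMF α) (c : ℝ) (F : α → ℝ) :
    mean κ (fun a => c * F a) = c * mean κ F := by
  unfold mean
  rw [← tsum_mul_left]
  exact tsum_congr fun a => by ring

theorem mean_sub (κ : PMF α) {F G : α → ℝ} {C C' : ℝ} (hF : ∀ a, |F a| ≤ C)
    (hG : ∀ a, |G a| ≤ C') : mean κ (fun a => F a - G a) = mean κ F - mean κ G := by
  unfold mean
  simp_rw [mul_sub]
  exact (mean_summable κ hF).tsum_sub (mean_summable κ hG)

theorem mean_congr {κ : PMF α} {F G : α → ℝ} (h : ∀ a ∈ κ.support, F a = G a) :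
    mean κ F = mean κ G := by
  refine tsum_congr fun a => ?_
  by_cases ha : a ∈ κ.support
  · rw [h a ha]
  · rw [PMF.mem_support_iff, not_not] at ha
    simp [ha]

theorem mean_nonneg {κ : PMF α} {F : α → ℝ} (h : ∀ a ∈ κ.support, 0 ≤ F a) : 0 ≤ mean κ F := by
  refine tsum_nonneg fun a => ?_
  by_cases ha : a ∈ κ.support
  · exact mul_nonneg ENNReal.toReal_nonneg (h a ha)
  · rw [PMF.mem_support_iff, not_not] at ha
    simp [ha]

theorem mean_mono {κ : PMF α} {F G : α → ℝ} {C C' : ℝ} (hF : ∀ a, |F a| ≤ C)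
    (hG : ∀ a, |G a| ≤ C') (h : ∀ a ∈ κ.support, F a ≤ G a) : mean κ F ≤ mean κ G := by
  have := mean_nonneg (κ := κ) (F := fun a => G a - F a) fun a ha => sub_nonneg.2 (h a ha)
  rw [mean_sub κ hG hF] at this
  linarith

theorem abs_mean_le (κ : PMF α) {F : α → ℝ} {C : ℝ} (hF : ∀ a, |F a| ≤ C) : |mean κ F| ≤ C := by
  have hC : ∀ a : α, |C| ≤ |C| := fun _ => le_rfl
  have h0 : ∀ a : α, |-C| ≤ |C| := fun _ => by rw [abs_neg]
  rw [abs_le]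
  constructor
  · have := mean_mono (κ := κ) h0 hF fun a _ => (abs_le.1 (hF a)).1
    rwa [mean_const] at this
  · have := mean_mono (κ := κ) hF hC fun a _ => (abs_le.1 (hF a)).2
    rwa [mean_const] at this

theorem ofReal_mean (κ : PMF α) {F : α → ℝ} {C : ℝ} (h0 : ∀ a, 0 ≤ F a) (hF : ∀ a, |F a| ≤ C) :
    ENNReal.ofReal (mean κ F) = lmean κ fun a => ENNReal.ofReal (F a) := by
  unfold mean lmean
  rw [ENNReal.ofReal_tsum_of_nonneg (fun a => mul_nonneg ENNReal.toReal_nonneg (h0 a))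
    (mean_summable κ hF)]
  refine tsum_congr fun a => ?_
  rw [ENNReal.ofReal_mul ENNReal.toReal_nonneg, ENNReal.ofReal_toReal (κ.apply_ne_top a)]

theorem mean_eq_toReal_lmean (κ : PMF α) {F : α → ℝ} {C : ℝ} (h0 : ∀ a, 0 ≤ F a)
    (hF : ∀ a, |F a| ≤ C) : mean κ F = (lmean κ fun a => ENNReal.ofReal (F a)).toReal := by
  rw [← ofReal_mean κ h0 hF, ENNReal.toReal_ofReal (mean_nonneg fun a _ => h0 a)]

theorem mean_bind (κ : PMF α) (f : α → PMF β) {F : β → ℝ} {C : ℝ} (hF : ∀ b, |F b| ≤ C) :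
    mean (κ.bind f) F = mean κ fun a => mean (f a) F := by
  have hshift : ∀ κ' : PMF β, mean κ' F = mean κ' (fun b => F b + C) - C := fun κ' => by
    rw [mean_add κ' hF (C' := |C|) fun _ => le_rfl, mean_const]
    ring
  have h0 : ∀ b, 0 ≤ F b + C := fun b => by linarith [(abs_le.1 (hF b)).1]
  have hb : ∀ b, |F b + C| ≤ C + C := fun b => by
    rw [abs_of_nonneg (h0 b)]
    linarith [(abs_le.1 (hF b)).2]
  have hm : ∀ a, |mean (f a) (fun b => F b + C)| ≤ C + C := fun a => abs_mean_le _ hb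
  have hm0 : ∀ a, 0 ≤ mean (f a) (fun b => F b + C) := fun a => mean_nonneg fun b _ => h0 b
  have key : mean (κ.bind f) (fun b => F b + C)
      = mean κ fun a => mean (f a) (fun b => F b + C) := by
    rw [mean_eq_toReal_lmean _ h0 hb, lmean_bind, mean_eq_toReal_lmean _ hm0 hm]
    simp_rw [ofReal_mean _ h0 hb]
  rw [hshift, key, funext fun a => hshift (f a), mean_sub κ hm (C' := |C|) fun _ => le_rfl,
    mean_const]

theorem mean_map (κ : PMF α) (f : α → β) {F : β → ℝ} {C : ℝ} (hF : ∀ b, |F b| ≤ C) :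
    mean (κ.map f) F = mean κ fun a => F (f a) := by
  rw [← PMF.bind_pure_comp, mean_bind _ _ hF]
  simp [mean_pure]

open Classical in
theorem mean_indicator_singleton (κ : PMF α) (a : α) :
    (mean κ fun b => if b = a then 1 else 0) = (κ a).toReal := by
  unfold mean
  rw [tsum_eq_single a]
  · simp
  · intro b hb
    simp [hb]

theorem pmf_ext_mean {κ κ' : PMF α}
    (h : ∀ F : α → ℝ, (∀ a, 0 ≤ F a) → (∀ a, |F a| ≤ 1) → mean κ F = mean κ' F) : κ = κ' := by
  classical
  ext a
  have := h (fun b => if b = a then 1 else 0) (fun b => by split_ifs <;> norm_num)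
    fun b => by split_ifs <;> simp
  rw [mean_indicator_singleton, mean_indicator_singleton] at this
  exact (ENNReal.toReal_eq_toReal_iff' (κ.apply_ne_top a) (κ'.apply_ne_top a)).1 this

end Mean

/-! ### Poisson mixtures of Markov chains -/

section Poisson

variable {α : Type*}

/-- The weights of the Poisson distribution. -/
def poissonWeight (u : ℝ) (k : ℕ) : ℝ := Real.exp (-u) * (u ^ k / (k.factorial : ℝ))

theorem hasSum_exp_series (u : ℝ) :
    HasSum (fun k : ℕ => u ^ k / (k.factorial : ℝ)) (Real.exp u) := by
  rw [Real.exp_eq_exp_ℝ]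
  exact NormedSpace.expSeries_div_hasSum_exp u

theorem hasSum_poissonWeight (u : ℝ) : HasSum (poissonWeight u) 1 := by
  have := (hasSum_exp_series u).mul_left (Real.exp (-u))
  rwa [← Real.exp_add, neg_add_cancel, Real.exp_zero] at this

theorem poissonWeight_nonneg {u : ℝ} (hu : 0 ≤ u) (k : ℕ) : 0 ≤ poissonWeight u k := by
  unfold poissonWeight
  positivity

/-- The Poisson distribution as a probability mass function. -/
def poisson (u : NNReal) : PMF ℕ :=
  ⟨fun k => ENNReal.ofReal (poissonWeight u k), by
    have h := ENNReal.ofReal_tsum_of_nonneg (poissonWeight_nonneg u.coe_nonneg)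
      (hasSum_poissonWeight (u : ℝ)).summable
    rw [(hasSum_poissonWeight (u : ℝ)).tsum_eq, ENNReal.ofReal_one] at h
    rw [h]
    exact ENNReal.summable.hasSum⟩

theorem poisson_apply_toReal (u : NNReal) (k : ℕ) : (poisson u k).toReal = poissonWeight u k :=
  ENNReal.toReal_ofReal (poissonWeight_nonneg u.2 k)

theorem abs_poissonWeight_sub_le {u : ℝ} (hu : 0 < u) (v : ℝ) {ε : ℝ} (hε : 0 < ε) (k : ℕ) :
    |poissonWeight v k - poissonWeight u k| ≤
      ε / 2 * poissonWeight u k + (2 * ε)⁻¹ *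
        (Real.exp (u - 2 * v) * ((v ^ 2 / u) ^ k / (k.factorial : ℝ)) - 2 * poissonWeight v k
          + poissonWeight u k) := by
  set a := poissonWeight u k with ha
  set b := poissonWeight v k with hb
  have ha0 : 0 < a := by
    rw [ha]
    unfold poissonWeight
    positivity
  have hq : Real.exp (u - 2 * v) * ((v ^ 2 / u) ^ k / (k.factorial : ℝ)) * a = b ^ 2 := by
    have h1 : Real.exp (u - 2 * v) * Real.exp (-u) = Real.exp (-v) ^ 2 := by
      rw [← Real.exp_add, pow_two, ← Real.exp_add]
      congr 1
      ring
    have h2 : (v ^ 2 / u) ^ k / (k.factorial : ℝ) * (u ^ k / (k.factorial : ℝ))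
        = (v ^ k / (k.factorial : ℝ)) ^ 2 := by
      rw [div_pow]
      field_simp
      ring
    rw [ha, hb]
    unfold poissonWeight
    calc _ = (Real.exp (u - 2 * v) * Real.exp (-u)) *
          ((v ^ 2 / u) ^ k / (k.factorial : ℝ) * (u ^ k / (k.factorial : ℝ))) := by ring
      _ = _ := by rw [h1, h2]; ring
  set q := Real.exp (u - 2 * v) * ((v ^ 2 / u) ^ k / (k.factorial : ℝ)) with hqdef
  have hsq : (b - a) ^ 2 = (q - 2 * b + a) * a := by
    linear_combination -hq
  have h3 : 0 ≤ q - 2 * b + a := by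
    by_contra hcon
    push Not at hcon
    nlinarith [sq_nonneg (b - a), mul_neg_of_neg_of_pos hcon ha0]
  set r := q - 2 * b + a with hr
  refine abs_le_of_sq_le_sq ?_ (by positivity)
  have h4 : 0 ≤ (ε / 2 * a - (2 * ε)⁻¹ * r) ^ 2 := sq_nonneg _
  have h5 : (ε / 2 * a) * ((2 * ε)⁻¹ * r) = a * r / 4 := by
    field_simp
    ring
  nlinarith

theorem abs_tsum_poissonWeight_sub_le {u : ℝ} (hu : 0 < u) {v : ℝ} (hv : 0 ≤ v) {ε : ℝ}
    (hε : 0 < ε) {a : ℕ → ℝ} {C : ℝ} (ha : ∀ k, |a k| ≤ C) :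
    |∑' k, poissonWeight v k * a k - ∑' k, poissonWeight u k * a k| ≤
      C * (ε / 2 + (2 * ε)⁻¹ * (Real.exp ((u - v) ^ 2 / u) - 1)) := by
  have hC : 0 ≤ C := (abs_nonneg _).trans (ha 0)
  have hs : ∀ w : ℝ, 0 ≤ w → Summable fun k => poissonWeight w k * a k := fun w hw => by
    refine Summable.of_norm_bounded ((hasSum_poissonWeight w).summable.mul_right C) fun k => ?_
    rw [Real.norm_eq_abs, abs_mul, abs_of_nonneg (poissonWeight_nonneg hw k)]
    exact mul_le_mul_of_nonneg_left (ha k) (poissonWeight_nonneg hw k)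
  have hbound : HasSum (fun k => C * (ε / 2 * poissonWeight u k + (2 * ε)⁻¹ *
        (Real.exp (u - 2 * v) * ((v ^ 2 / u) ^ k / (k.factorial : ℝ)) - 2 * poissonWeight v k
          + poissonWeight u k)))
      (C * (ε / 2 + (2 * ε)⁻¹ * (Real.exp ((u - v) ^ 2 / u) - 1))) := by
    have h1 := (hasSum_exp_series (v ^ 2 / u)).mul_left (Real.exp (u - 2 * v))
    have h2 : Real.exp (u - 2 * v) * Real.exp (v ^ 2 / u) = Real.exp ((u - v) ^ 2 / u) := by
      rw [← Real.exp_add]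
      congr 1
      field_simp
      ring
    rw [h2] at h1
    have h3 := ((((h1.sub ((hasSum_poissonWeight v).mul_left 2)).add
      (hasSum_poissonWeight u)).mul_left (2 * ε)⁻¹).add
      ((hasSum_poissonWeight u).mul_left (ε / 2))).mul_left C
    have h4 : C * ((2 * ε)⁻¹ * (Real.exp ((u - v) ^ 2 / u) - 2 * 1 + 1) + ε / 2 * 1)
        = C * (ε / 2 + (2 * ε)⁻¹ * (Real.exp ((u - v) ^ 2 / u) - 1)) := by ring
    rw [h4] at h3
    refine h3.congr_fun fun k => ?_
    ring
  rw [← (hs v hv).tsum_sub (hs u hu.le), ← hbound.tsum_eq, ← Real.norm_eq_abs]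
  refine tsum_of_norm_bounded hbound.summable.hasSum fun k => ?_
  rw [← sub_mul, Real.norm_eq_abs, abs_mul, mul_comm]
  exact mul_le_mul (ha k) (abs_poissonWeight_sub_le hu v hε k) (abs_nonneg _) hC

theorem tendsto_tsum_poissonWeight_sub {a : ℕ → ℝ} {C : ℝ} (ha : ∀ k, |a k| ≤ C) {s : ℝ}
    (hs : 0 ≤ s) :
    Tendsto (fun u : ℝ => ∑' k, poissonWeight (u + s) k * a k - ∑' k, poissonWeight u k * a k)
      atTop (𝓝 0) := by
  have hC : 0 ≤ C := (abs_nonneg _).trans (ha 0)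
  rw [Metric.tendsto_atTop']
  intro δ hδ
  set ε := δ / (C + 1) with hεdef
  have hε : 0 < ε := by positivity
  have hlim : Tendsto (fun u : ℝ => ε / 2 + (2 * ε)⁻¹ * (Real.exp ((u - (u + s)) ^ 2 / u) - 1))
      atTop (𝓝 (ε / 2 + (2 * ε)⁻¹ * (Real.exp 0 - 1))) := by
    refine tendsto_const_nhds.add (Tendsto.const_mul _ (Tendsto.sub_const ?_ 1))
    refine (Real.continuous_exp.tendsto 0).comp ?_
    have : Tendsto (fun u : ℝ => s ^ 2 / u) atTop (𝓝 0) :=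
      tendsto_const_nhds.div_atTop tendsto_id
    refine this.congr fun u => ?_
    congr 1
    ring
  rw [Real.exp_zero, sub_self, mul_zero, add_zero] at hlim
  have hev := (hlim.eventually (gt_mem_nhds (half_lt_self hε))).and (eventually_gt_atTop 0)
  obtain ⟨N, hN⟩ := eventually_atTop.1 hev
  refine ⟨N, fun u hu => ?_⟩
  obtain ⟨h1, h2⟩ := hN u hu.le
  rw [dist_zero_right, Real.norm_eq_abs]
  refine (abs_tsum_poissonWeight_sub_le h2 (by positivity) hε ha).trans_lt ?_
  calc _ ≤ C * ε := mul_le_mul_of_nonneg_left h1.le hC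
    _ < (C + 1) * ε := by nlinarith
    _ = δ := by rw [hεdef]; field_simp

/-- The `k`-step transition probabilities of a Markov chain. -/
def chain (κ : α → PMF α) : ℕ → α → PMF α
  | 0, a => PMF.pure a
  | k + 1, a => (κ a).bind (chain κ k)

/-- The continuous-time chain with jump chain `κ`, after a Poisson number of steps. -/
def poissonChain (κ : α → PMF α) (u : NNReal) (a : α) : PMF α :=
  (poisson u).bind fun k => chain κ k a

theorem mean_poissonChain (κ : α → PMF α) (u : NNReal) (a : α) {F : α → ℝ} {C : ℝ}
    (hF : ∀ b, |F b| ≤ C) :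
    mean (poissonChain κ u a) F = ∑' k, poissonWeight u k * mean (chain κ k a) F := by
  unfold poissonChain
  rw [mean_bind _ _ hF]
  exact tsum_congr fun k => by rw [poisson_apply_toReal]

theorem chain_support {κ : α → PMF α} {P : α → Prop} (h : ∀ a, P a → ∀ b ∈ (κ a).support, P b)
    (k : ℕ) {a b : α} (ha : P a) (hb : b ∈ (chain κ k a).support) : P b := by
  induction k generalizing a with
  | zero =>
    rw [chain, PMF.mem_support_pure_iff] at hb
    rwa [hb]
  | succ k ih =>
    rw [chain, PMF.mem_support_bind_iff] at hb
    obtain ⟨c, hc, hb⟩ := hb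
    exact ih (h a ha c hc) hb

theorem poissonChain_support {κ : α → PMF α} {P : α → Prop}
    (h : ∀ a, P a → ∀ b ∈ (κ a).support, P b) (u : NNReal) {a b : α} (ha : P a)
    (hb : b ∈ (poissonChain κ u a).support) : P b := by
  rw [poissonChain, PMF.mem_support_bind_iff] at hb
  obtain ⟨k, -, hb⟩ := hb
  exact chain_support h k ha hb

/-- The Banach algebra of bounded functions. -/
def Bdd (α : Type*) : Type _ := lp (fun _ : α => ℝ) ∞

namespace Bdd

instance : NormedCommRing (Bdd α) := inferInstanceAs (NormedCommRing (lp (fun _ : α => ℝ) ∞))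

instance : NormedAlgebra ℝ (Bdd α) := inferInstanceAs (NormedAlgebra ℝ (lp (fun _ : α => ℝ) ∞))

instance : CompleteSpace (Bdd α) := inferInstanceAs (CompleteSpace (lp (fun _ : α => ℝ) ∞))

/-- The underlying function of an element of the Banach algebra. -/
def toFun (F : Bdd α) : α → ℝ := Subtype.val F

instance : CoeFun (Bdd α) fun _ => α → ℝ := ⟨toFun⟩

@[ext]
theorem ext {F G : Bdd α} (h : ∀ a, F a = G a) : F = G := Subtype.ext (funext h)

theorem abs_apply_le (F : Bdd α) (a : α) : |F a| ≤ ‖F‖ :=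
  lp.norm_apply_le_norm (E := fun _ : α => ℝ) ENNReal.top_ne_zero F a

theorem norm_le {F : Bdd α} {C : ℝ} (hC : 0 ≤ C) (h : ∀ a, |F a| ≤ C) : ‖F‖ ≤ C :=
  lp.norm_le_of_forall_le (E := fun _ : α => ℝ) hC h

theorem add_apply (F G : Bdd α) (a : α) : (F + G) a = F a + G a := rfl

theorem sub_apply (F G : Bdd α) (a : α) : (F - G) a = F a - G a := rfl

theorem mul_apply (F G : Bdd α) (a : α) : (F * G) a = F a * G a := rfl

/-- A bounded function as an element of the Banach algebra. -/
def mk (F : α → ℝ) (C : ℝ) (hF : ∀ a, |F a| ≤ C) : Bdd α :=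
  ⟨F, memℓp_infty ⟨C, by rintro _ ⟨a, rfl⟩; exact hF a⟩⟩

/-- Evaluation at a point. -/
def eval (a : α) : Bdd α →L[ℝ] ℝ :=
  LinearMap.mkContinuous
    { toFun := fun F => F a
      map_add' := fun _ _ => rfl
      map_smul' := fun _ _ => rfl } 1 fun F => by
    rw [one_mul]
    exact F.abs_apply_le a

theorem eval_apply (a : α) (F : Bdd α) : eval a F = F a := rfl

/-- Precomposition with a map, as an operator on bounded functions. -/
def comp (c : α → α) : Bdd α →L[ℝ] Bdd α :=
  LinearMap.mkContinuous
    { toFun := fun F => mk (fun a => F (c a)) ‖F‖ fun a => F.abs_apply_le _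
      map_add' := fun F G => by ext a; rfl
      map_smul' := fun r F => by ext a; rfl } 1 fun F => by
    rw [one_mul]
    exact norm_le (norm_nonneg F) fun a => F.abs_apply_le (c a)

theorem comp_apply (c : α → α) (F : Bdd α) (a : α) : comp c F a = F (c a) := rfl

end Bdd

theorem exp_zero_smul {A : Type*} [NormedRing A] [NormedAlgebra ℝ A] (x : A) :
    NormedSpace.exp ((0 : ℝ) • x) = 1 := by
  rw [zero_smul, NormedSpace.exp_zero]

section BanachAlgebra

variable {A : Type*} [NormedRing A] [NormedAlgebra ℝ A] [CompleteSpace A]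

theorem exp_add_smul (x : A) (s t : ℝ) :
    NormedSpace.exp ((s + t) • x) = NormedSpace.exp (s • x) * NormedSpace.exp (t • x) := by
  let _ : NormedAlgebra ℚ A := NormedAlgebra.restrictScalars ℚ ℝ _
  rw [add_smul, NormedSpace.exp_add_of_commute]
  exact ((Commute.refl x).smul_left s).smul_right t

theorem exp_smul_smul_sub_one (x : A) (r t : ℝ) :
    NormedSpace.exp (t • r • (x - 1)) = Real.exp (-(r * t)) • NormedSpace.exp ((r * t) • x) := by
  let _ : NormedAlgebra ℚ A := NormedAlgebra.restrictScalars ℚ ℝ _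
  have hsplit : t • r • (x - 1) = (r * t) • x + (-(r * t)) • 1 := by
    rw [smul_smul, smul_sub, mul_comm t r, neg_smul, sub_eq_add_neg]
  have hcomm : Commute ((r * t) • x) ((-(r * t)) • (1 : A)) := (Commute.one_right _).smul_right _
  have hone : NormedSpace.exp ((-(r * t)) • (1 : A)) = Real.exp (-(r * t)) • 1 := by
    rw [← Algebra.algebraMap_eq_smul_one, ← Algebra.algebraMap_eq_smul_one, Real.exp_eq_exp_ℝ]
    exact (NormedSpace.algebraMap_exp_comm _).symm
  rw [hsplit, NormedSpace.exp_add_of_commute hcomm, hone, mul_smul_comm, mul_one]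

theorem hasSum_exp_smul (x : A) (t : ℝ) :
    HasSum (fun k : ℕ => (t ^ k / (k.factorial : ℝ)) • x ^ k) (NormedSpace.exp (t • x)) := by
  have h := NormedSpace.exp_series_hasSum_exp' (𝕂 := ℝ) (t • x)
  refine h.congr_fun fun k => ?_
  rw [smul_pow, smul_smul, div_eq_inv_mul]

end BanachAlgebra

theorem exp_apply_eq_tsum (A : Bdd α →L[ℝ] Bdd α) (t : ℝ) (F : Bdd α) (a : α) :
    NormedSpace.exp (t • A) F a = ∑' k : ℕ, t ^ k / (k.factorial : ℝ) * (A ^ k) F a :=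
  (((hasSum_exp_smul A t).mapL (ContinuousLinearMap.apply ℝ (Bdd α) F)).mapL
    (Bdd.eval a)).tsum_eq.symm

/-- The transition operator of a Markov chain on bounded functions. -/
def meanOp (κ : α → PMF α) : Bdd α →L[ℝ] Bdd α :=
  LinearMap.mkContinuous
    { toFun := fun F => Bdd.mk (fun a => mean (κ a) F) ‖F‖ fun a => abs_mean_le _ F.abs_apply_le
      map_add' := fun F G => by
        ext a
        exact mean_add (κ a) F.abs_apply_le G.abs_apply_le
      map_smul' := fun r F => by
        ext a
        exact mean_const_mul (κ a) r F } 1 fun F => by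
    rw [one_mul]
    exact Bdd.norm_le (norm_nonneg F) fun a => abs_mean_le _ F.abs_apply_le

theorem meanOp_apply (κ : α → PMF α) (F : Bdd α) (a : α) : meanOp κ F a = mean (κ a) F := rfl

theorem meanOp_pow_apply (κ : α → PMF α) (k : ℕ) (F : Bdd α) (a : α) :
    (meanOp κ ^ k) F a = mean (chain κ k a) F := by
  induction k generalizing a with
  | zero =>
    rw [chain, mean_pure, pow_zero]
    rfl
  | succ k ih =>
    rw [pow_succ', mul_apply_eq_comp, meanOp_apply, chain, mean_bind _ _ F.abs_apply_le]
    congr 1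
    funext b
    exact ih b

/-- The generator of the continuous-time chain jumping at rate `r`. -/
def rateOp (r : ℝ) (κ : α → PMF α) : Bdd α →L[ℝ] Bdd α := r • (meanOp κ - 1)

theorem rateOp_apply (r : ℝ) (κ : α → PMF α) (F : Bdd α) (a : α) :
    rateOp r κ F a = r * (mean (κ a) F - F a) := rfl

theorem exp_rateOp_apply {r : ℝ} (hr : 0 ≤ r) (κ : α → PMF α) {t : ℝ} (ht : 0 ≤ t) (F : Bdd α)
    (a : α) :
    NormedSpace.exp (t • rateOp r κ) F a = mean (poissonChain κ (r * t).toNNReal a) F := by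
  rw [rateOp, exp_smul_smul_sub_one, mean_poissonChain κ _ a F.abs_apply_le,
    Real.coe_toNNReal _ (mul_nonneg hr ht)]
  change Real.exp (-(r * t)) * NormedSpace.exp ((r * t) • meanOp κ) F a = _
  rw [exp_apply_eq_tsum, ← tsum_mul_left]
  refine tsum_congr fun k => ?_
  rw [meanOp_pow_apply]
  unfold poissonWeight
  rw [mul_assoc]

theorem tendsto_mean_poissonChain_sub (κ : α → PMF α) {F : α → ℝ} {C : ℝ} (hF : ∀ b, |F b| ≤ C)
    (a : α) {r : ℝ} (hr : 0 < r) {s : ℝ} (hs : 0 ≤ s) :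
    Tendsto (fun t : ℝ => mean (poissonChain κ (r * (t + s)).toNNReal a) F
      - mean (poissonChain κ (r * t).toNNReal a) F) atTop (𝓝 0) := by
  have h := (tendsto_tsum_poissonWeight_sub (a := fun k => mean (chain κ k a) F)
    (fun k => abs_mean_le _ hF) (mul_nonneg hr.le hs)).comp (tendsto_id.const_mul_atTop hr)
  refine h.congr' ?_
  filter_upwards [eventually_ge_atTop 0] with t ht
  rw [mean_poissonChain _ _ _ hF, mean_poissonChain _ _ _ hF, Real.coe_toNNReal _ (by positivity),
    Real.coe_toNNReal _ (by positivity), mul_add]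
  rfl

end Poisson

/-! ### The jump chain of the inclusion process with finitely many particles -/

theorem hasSum_option {α M : Type*} [AddCommMonoid M] [TopologicalSpace M] [ContinuousAdd M]
    {f : Option α → M} {s : M} (h : HasSum (fun a => f (some a)) s) :
    HasSum f (f none + s) := by
  classical
  have h1 : HasSum (fun o : Option α => if o = none then f none else 0) (f none) :=
    hasSum_ite_eq none (f none)
  have h2 : HasSum (fun o : Option α => if o = none then 0 else f o) s := by
    rw [← (Option.some_injective α).hasSum_iff]
    · simpa [Function.comp_def] using h
    · intro o ho
      cases o with
      | none => simp
      | some a => exact absurd ⟨a, rfl⟩ ho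
  refine (h1.add h2).congr_fun fun o => ?_
  split_ifs with ho
  · simp [ho]
  · simp

/-- The rate at which a particle jumps from `x` to `y`. -/
def jumpRate (p : S → S → ℝ) (m : ℝ) (ξ : S →₀ ℕ) (z : S × S) : ℝ :=
  p z.1 z.2 * (2 * (ξ z.1 : ℝ)) * (m + 2 * (ξ z.2 : ℝ))

/-- An upper bound for the total jump rate with at most `N` particles. -/
def rateBound (m : ℝ) (N : ℕ) : ℝ := 2 * N * (m + 2 * N) + 1

theorem rateBound_pos {m : ℝ} (hm : 0 < m) (N : ℕ) : 0 < rateBound m N := by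
  unfold rateBound
  positivity

section Rates

variable {p : S → S → ℝ} {m : ℝ}

theorem IsSymmetricWalk.summable_pair (hp : IsSymmetricWalk p) (ξ : S →₀ ℕ) {c : S × S → ℝ}
    {C : ℝ} (hc : ∀ z, |c z| ≤ C) : Summable fun z : S × S => p z.1 z.2 * (ξ z.1 : ℝ) * c z := by
  rcases isEmpty_or_nonempty S with hS | hS
  · exact summable_empty
  obtain ⟨x₀⟩ := hS
  have hC : 0 ≤ C := (abs_nonneg _).trans (hc (x₀, x₀))
  have hdom : Summable fun z : S × S => p z.1 z.2 * (ξ z.1 : ℝ) * C := by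
    have h1 : ∀ x : S, Summable fun y => p x y * (ξ x : ℝ) * C := fun x =>
      ((hp.sum_one x).summable.mul_right (ξ x : ℝ)).mul_right C
    have h2 : Summable fun x : S => ∑' y, p x y * (ξ x : ℝ) * C := by
      refine summable_of_hasFiniteSupport (ξ.support.finite_toSet.subset fun x hx => ?_)
      rw [Finset.mem_coe, Finsupp.mem_support_iff]
      intro h0
      exact hx (by simp [h0])
    refine (summable_prod_of_nonneg fun z => ?_).2 ⟨h1, h2⟩
    exact mul_nonneg (mul_nonneg (hp.nonneg z.1 z.2) (Nat.cast_nonneg _)) hC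
  refine Summable.of_norm_bounded hdom fun z => ?_
  have := hp.nonneg z.1 z.2
  rw [Real.norm_eq_abs, abs_mul, abs_of_nonneg (by positivity)]
  exact mul_le_mul_of_nonneg_left (hc z) (by positivity)

theorem IsSymmetricWalk.tsum_pair (hp : IsSymmetricWalk p) (ξ : S →₀ ℕ) {c : S × S → ℝ}
    {C : ℝ} (hc : ∀ z, |c z| ≤ C) : ∑' z : S × S, p z.1 z.2 * (ξ z.1 : ℝ) * c z
      = ∑ x ∈ ξ.support, ∑' y, p x y * (ξ x : ℝ) * c (x, y) := by
  rw [(hp.summable_pair ξ hc).tsum_prod, tsum_eq_sum (s := ξ.support)]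
  intro x hx
  rw [Finsupp.notMem_support_iff] at hx
  simp [hx]

theorem abs_jumpFactor_le (hm : 0 < m) (ξ : S →₀ ℕ) (y : S) :
    |2 * (m + 2 * (ξ y : ℝ))| ≤ 2 * (m + 2 * (ξ.degree : ℝ)) := by
  have h : (ξ y : ℝ) ≤ (ξ.degree : ℝ) := by exact_mod_cast Finsupp.le_degree y ξ
  rw [abs_of_nonneg (by positivity)]
  linarith

theorem jumpRate_nonneg (hm : 0 < m) (hp : IsSymmetricWalk p) (ξ : S →₀ ℕ) (z : S × S) :
    0 ≤ jumpRate p m ξ z := by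
  have := hp.nonneg z.1 z.2
  unfold jumpRate
  positivity

theorem summable_jumpRate_mul (hm : 0 < m) (hp : IsSymmetricWalk p) (ξ : S →₀ ℕ)
    {c : S × S → ℝ} {C : ℝ} (hc : ∀ z, |c z| ≤ C) :
    Summable fun z => jumpRate p m ξ z * c z := by
  have h := hp.summable_pair ξ (c := fun z => 2 * (m + 2 * (ξ z.2 : ℝ)) * c z)
    (C := 2 * (m + 2 * (ξ.degree : ℝ)) * C) fun z => by
      rw [abs_mul]
      exact mul_le_mul (abs_jumpFactor_le hm ξ z.2) (hc z) (abs_nonneg _) (by positivity)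
  refine h.congr fun z => ?_
  unfold jumpRate
  ring

theorem summable_jumpRate (hm : 0 < m) (hp : IsSymmetricWalk p) (ξ : S →₀ ℕ) :
    Summable (jumpRate p m ξ) := by
  simpa using summable_jumpRate_mul hm hp ξ (c := fun _ => 1) (C := 1) (by simp)

theorem generator_eq_tsum (hm : 0 < m) (hp : IsSymmetricWalk p) (ξ : S →₀ ℕ)
    {F : (S →₀ ℕ) → ℝ} {C : ℝ} (hF : ∀ ζ, |F ζ| ≤ C) :
    generator p m F ξ = ∑' z, jumpRate p m ξ z * (F (move ξ z.1 z.2) - F ξ) := by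
  have h := hp.tsum_pair ξ
    (c := fun z => 2 * (m + 2 * (ξ z.2 : ℝ)) * (F (move ξ z.1 z.2) - F ξ))
    (C := 2 * (m + 2 * (ξ.degree : ℝ)) * (C + C)) fun z => by
      rw [abs_mul]
      exact mul_le_mul (abs_jumpFactor_le hm ξ z.2)
        ((abs_sub _ _).trans (add_le_add (hF _) (hF _))) (abs_nonneg _) (by positivity)
  unfold generator jumpRate
  refine Eq.trans ?_ ((h.symm).trans ?_)
  · refine Finset.sum_congr rfl fun x _ => tsum_congr fun y => ?_
    ring
  · refine tsum_congr fun z => ?_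
    ring

theorem tsum_jumpRate_le (hm : 0 < m) (hp : IsSymmetricWalk p) (ξ : S →₀ ℕ) {N : ℕ}
    (hN : ξ.degree ≤ N) : ∑' z, jumpRate p m ξ z ≤ rateBound m N := by
  have hb : ∀ z : S × S, |2 * (m + 2 * (N : ℝ))| ≤ 2 * (m + 2 * (N : ℝ)) := fun z => by
    rw [abs_of_nonneg (by positivity)]
  have hN' : (ξ.degree : ℝ) ≤ N := by exact_mod_cast hN
  have h1 : ∑' z, jumpRate p m ξ z
      ≤ ∑' z : S × S, p z.1 z.2 * (ξ z.1 : ℝ) * (2 * (m + 2 * (N : ℝ))) := by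
    refine (summable_jumpRate hm hp ξ).tsum_le_tsum (fun z => ?_) (hp.summable_pair ξ hb)
    have h2 : (ξ z.2 : ℝ) ≤ (ξ.degree : ℝ) := by exact_mod_cast Finsupp.le_degree z.2 ξ
    have h3 := hp.nonneg z.1 z.2
    unfold jumpRate
    calc _ = p z.1 z.2 * (ξ z.1 : ℝ) * (2 * (m + 2 * (ξ z.2 : ℝ))) := by ring
      _ ≤ _ := by gcongr; exact (Finsupp.le_degree _ _).trans hN
  refine h1.trans ?_
  rw [hp.tsum_pair ξ hb]
  have h4 : ∀ x, ∑' y, p x y * (ξ x : ℝ) * (2 * (m + 2 * (N : ℝ)))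
      = (ξ x : ℝ) * (2 * (m + 2 * (N : ℝ))) := fun x => by
    rw [tsum_mul_right, tsum_mul_right, (hp.sum_one x).tsum_eq, one_mul]
  simp_rw [h4]
  rw [← Finset.sum_mul, ← Nat.cast_sum, ← Finsupp.degree_apply]
  unfold rateBound
  have : (ξ.degree : ℝ) * (2 * (m + 2 * (N : ℝ))) ≤ N * (2 * (m + 2 * (N : ℝ))) := by gcongr
  linarith

/-- The probabilities of the possible jumps in one step of the uniformized chain; `none` stands
for no jump. -/
def stepWeight (p : S → S → ℝ) (m : ℝ) (N : ℕ) (ξ : S →₀ ℕ) : Option (S × S) → ℝ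
  | none => 1 - (∑' z, jumpRate p m ξ z) / rateBound m N
  | some z => jumpRate p m ξ z / rateBound m N

theorem stepWeight_nonneg (hm : 0 < m) (hp : IsSymmetricWalk p) {ξ : S →₀ ℕ} {N : ℕ}
    (hN : ξ.degree ≤ N) (o : Option (S × S)) : 0 ≤ stepWeight p m N ξ o := by
  have h := rateBound_pos hm N
  cases o with
  | none => exact sub_nonneg.2 ((div_le_one h).2 (tsum_jumpRate_le hm hp ξ hN))
  | some z => exact div_nonneg (jumpRate_nonneg hm hp ξ z) h.le

theorem hasSum_stepWeight_mul (hm : 0 < m) (hp : IsSymmetricWalk p) (ξ : S →₀ ℕ) (N : ℕ)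
    {c : Option (S × S) → ℝ} {C : ℝ} (hc : ∀ z, |c z| ≤ C) :
    HasSum (fun o => stepWeight p m N ξ o * c o)
      (c none + (∑' z, jumpRate p m ξ z * (c (some z) - c none)) / rateBound m N) := by
  have h1 := (summable_jumpRate_mul hm hp ξ (c := fun z => c (some z)) fun z => hc _).hasSum
  have h0 := (summable_jumpRate hm hp ξ).hasSum
  have h2 := hasSum_option (f := fun o => stepWeight p m N ξ o * c o)
    ((h1.div_const (rateBound m N)).congr_fun fun z => by simp only [stepWeight]; ring)
  have h3 : ∑' z, jumpRate p m ξ z * (c (some z) - c none)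
      = ∑' z, jumpRate p m ξ z * c (some z) - (∑' z, jumpRate p m ξ z) * c none :=
    ((h1.sub (h0.mul_right (c none))).congr_fun fun z => by ring).tsum_eq
  rw [h3]
  convert h2 using 1
  simp only [stepWeight]
  ring

theorem hasSum_ofReal_stepWeight (hm : 0 < m) (hp : IsSymmetricWalk p) {ξ : S →₀ ℕ} {N : ℕ}
    (hN : ξ.degree ≤ N) : HasSum (fun o => ENNReal.ofReal (stepWeight p m N ξ o)) 1 := by
  have h := hasSum_stepWeight_mul hm hp ξ N (c := fun _ => 1) (C := 1) (by simp)
  simp only [mul_one, sub_self, mul_zero, tsum_zero, zero_div, add_zero] at h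
  have h' := ENNReal.ofReal_tsum_of_nonneg (stepWeight_nonneg hm hp hN) h.summable
  rw [h.tsum_eq, ENNReal.ofReal_one] at h'
  rw [h']
  exact ENNReal.summable.hasSum

/-- The probability mass function with given weights. -/
def pmfOfHasSum {α : Type*} (w : α → ℝ≥0∞) (h : HasSum w 1) : PMF α := ⟨w, h⟩

theorem pmfOfHasSum_apply {α : Type*} (w : α → ℝ≥0∞) (h : HasSum w 1) (a : α) :
    pmfOfHasSum w h a = w a := rfl

open Classical in
/-- The jump made in one step of the uniformized chain. -/
def stepJump (p : S → S → ℝ) (m : ℝ) (N : ℕ) (ξ : S →₀ ℕ) : PMF (Option (S × S)) :=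
  if h : ξ.degree ≤ N ∧ HasSum (fun o => ENNReal.ofReal (stepWeight p m N ξ o)) 1 then
    pmfOfHasSum _ h.2
  else PMF.pure none

/-- The configuration after a jump. -/
def afterJump (ξ : S →₀ ℕ) : Option (S × S) → (S →₀ ℕ)
  | none => ξ
  | some z => move ξ z.1 z.2

/-- One step of the uniformized chain, which does not move if there are more than `N`
particles. -/
def stepKernel (p : S → S → ℝ) (m : ℝ) (N : ℕ) (ξ : S →₀ ℕ) : PMF (S →₀ ℕ) :=
  (stepJump p m N ξ).map (afterJump ξ)

theorem stepJump_apply (hm : 0 < m) (hp : IsSymmetricWalk p) {ξ : S →₀ ℕ} {N : ℕ}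
    (hN : ξ.degree ≤ N) (o : Option (S × S)) :
    stepJump p m N ξ o = ENNReal.ofReal (stepWeight p m N ξ o) := by
  have h : ξ.degree ≤ N ∧ HasSum (fun o => ENNReal.ofReal (stepWeight p m N ξ o)) 1 :=
    ⟨hN, hasSum_ofReal_stepWeight hm hp hN⟩
  unfold stepJump
  rw [dif_pos h, pmfOfHasSum_apply]

theorem stepKernel_of_lt {ξ : S →₀ ℕ} {N : ℕ} (hN : N < ξ.degree) :
    stepKernel p m N ξ = PMF.pure ξ := by
  unfold stepKernel stepJump
  rw [dif_neg fun h => hN.not_ge h.1, PMF.pure_map]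
  rfl

theorem mean_stepKernel (hm : 0 < m) (hp : IsSymmetricWalk p) {ξ : S →₀ ℕ} {N : ℕ}
    (hN : ξ.degree ≤ N) {F : (S →₀ ℕ) → ℝ} {C : ℝ} (hF : ∀ ζ, |F ζ| ≤ C) :
    rateBound m N * (mean (stepKernel p m N ξ) F - F ξ) = generator p m F ξ := by
  have h := (hasSum_stepWeight_mul hm hp ξ N (c := fun o => F (afterJump ξ o)) fun _ => hF _)
  rw [stepKernel, mean_map _ _ hF, generator_eq_tsum hm hp ξ hF]
  have h2 : mean (stepJump p m N ξ) (fun o => F (afterJump ξ o))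
      = F ξ + (∑' z, jumpRate p m ξ z * (F (move ξ z.1 z.2) - F ξ)) / rateBound m N := by
    refine Eq.trans (tsum_congr fun o => ?_) h.tsum_eq
    rw [stepJump_apply hm hp hN, ENNReal.toReal_ofReal (stepWeight_nonneg hm hp hN o)]
  rw [h2]
  have := (rateBound_pos hm N).ne'
  field_simp
  ring

theorem move_degree {ξ : S →₀ ℕ} {x : S} (hx : ξ x ≠ 0) (y : S) :
    (move ξ x y).degree = ξ.degree := by
  have h : Finsupp.single x 1 ≤ ξ := Finsupp.single_le_iff.2 (Nat.one_le_iff_ne_zero.2 hx)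
  have h2 : ξ.degree = (ξ - Finsupp.single x 1).degree + 1 := by
    conv_lhs => rw [← tsub_add_cancel_of_le h]
    rw [map_add, Finsupp.degree_single]
  rw [move, map_add, Finsupp.degree_single, h2]

theorem degree_of_mem_support_stepKernel (hm : 0 < m) (hp : IsSymmetricWalk p) {N : ℕ}
    {ξ ζ : S →₀ ℕ} (h : ζ ∈ (stepKernel p m N ξ).support) : ζ.degree = ξ.degree := by
  rcases le_or_gt ξ.degree N with hN | hN
  · rw [stepKernel, PMF.mem_support_map_iff] at h
    obtain ⟨o, ho, rfl⟩ := h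
    cases o with
    | none => rfl
    | some z =>
      refine move_degree (fun h0 => ?_) _
      rw [PMF.mem_support_iff, stepJump_apply hm hp hN] at ho
      exact ho (by simp [stepWeight, jumpRate, h0])
  · rw [stepKernel_of_lt hN, PMF.mem_support_pure_iff] at h
    rw [h]

theorem generator_congr {ξ : S →₀ ℕ} {F G : (S →₀ ℕ) → ℝ}
    (h : ∀ ζ : S →₀ ℕ, ζ.degree = ξ.degree → F ζ = G ζ) :
    generator p m F ξ = generator p m G ξ := by
  unfold generator
  refine Finset.sum_congr rfl fun x hx => tsum_congr fun y => ?_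
  rw [h ξ rfl, h _ (move_degree (Finsupp.mem_support_iff.1 hx) y)]

/-- The generator of the inclusion process, stopped on configurations with more than `N`
particles, as an operator on bounded functions. -/
def genOp (p : S → S → ℝ) (m : ℝ) (N : ℕ) : Bdd (S →₀ ℕ) →L[ℝ] Bdd (S →₀ ℕ) :=
  rateOp (rateBound m N) (stepKernel p m N)

theorem genOp_apply (hm : 0 < m) (hp : IsSymmetricWalk p) {N : ℕ} {ξ : S →₀ ℕ}
    (hN : ξ.degree ≤ N) (F : Bdd (S →₀ ℕ)) : genOp p m N F ξ = generator p m F ξ := by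
  rw [genOp, rateOp_apply, mean_stepKernel hm hp hN F.abs_apply_le]

theorem generator_iterate (hm : 0 < m) (hp : IsSymmetricWalk p) {N : ℕ} {ξ : S →₀ ℕ}
    (hN : ξ.degree ≤ N) (F : Bdd (S →₀ ℕ)) (k : ℕ) :
    ((generator p m)^[k] F) ξ = (genOp p m N ^ k) F ξ := by
  induction k generalizing ξ with
  | zero =>
    rw [pow_zero]
    rfl
  | succ k ih =>
    rw [Function.iterate_succ', Function.comp_apply, pow_succ', mul_apply_eq_comp,
      genOp_apply hm hp hN]
    exact generator_congr fun ζ hζ => ih (hζ ▸ hN)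

theorem finSemigroup_eq_exp (hm : 0 < m) (hp : IsSymmetricWalk p) {N : ℕ} {ξ : S →₀ ℕ}
    (hN : ξ.degree ≤ N) (F : Bdd (S →₀ ℕ)) (t : ℝ) :
    finSemigroup p m t F ξ = NormedSpace.exp (t • genOp p m N) F ξ := by
  rw [exp_apply_eq_tsum]
  unfold finSemigroup
  exact tsum_congr fun k => by rw [generator_iterate hm hp hN]

/-- The law at time `t` of the inclusion process with finitely many particles started
from `ξ`. -/
def law (p : S → S → ℝ) (m t : ℝ) (ξ : S →₀ ℕ) : PMF (S →₀ ℕ) :=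
  poissonChain (stepKernel p m ξ.degree) (rateBound m ξ.degree * t).toNNReal ξ

theorem exp_genOp_apply (hm : 0 < m) {N : ℕ} {t : ℝ} (ht : 0 ≤ t) (F : Bdd (S →₀ ℕ))
    (ξ : S →₀ ℕ) : NormedSpace.exp (t • genOp p m N) F ξ
      = mean (poissonChain (stepKernel p m N) (rateBound m N * t).toNNReal ξ) F :=
  exp_rateOp_apply (rateBound_pos hm N).le _ ht F ξ

theorem finSemigroup_eq_mean (hm : 0 < m) (hp : IsSymmetricWalk p) {t : ℝ} (ht : 0 ≤ t)
    {F : (S →₀ ℕ) → ℝ} {C : ℝ} (hF : ∀ ζ, |F ζ| ≤ C) (ξ : S →₀ ℕ) :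
    finSemigroup p m t F ξ = mean (law p m t ξ) F :=
  (finSemigroup_eq_exp hm hp le_rfl (Bdd.mk F C hF) t).trans (exp_genOp_apply hm ht _ ξ)

theorem law_eq_poissonChain (hm : 0 < m) (hp : IsSymmetricWalk p) {t : ℝ} (ht : 0 ≤ t) {N : ℕ}
    {ξ : S →₀ ℕ} (hN : ξ.degree ≤ N) :
    law p m t ξ = poissonChain (stepKernel p m N) (rateBound m N * t).toNNReal ξ :=
  pmf_ext_mean fun F _ hF => by
    rw [← finSemigroup_eq_mean hm hp ht hF]
    exact (finSemigroup_eq_exp hm hp hN (Bdd.mk F 1 hF) t).trans (exp_genOp_apply hm ht _ ξ)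

theorem exp_genOp_apply_law (hm : 0 < m) (hp : IsSymmetricWalk p) {N : ℕ} {t : ℝ} (ht : 0 ≤ t)
    (F : Bdd (S →₀ ℕ)) {ξ : S →₀ ℕ} (hN : ξ.degree ≤ N) :
    NormedSpace.exp (t • genOp p m N) F ξ = mean (law p m t ξ) F := by
  rw [exp_genOp_apply hm ht, law_eq_poissonChain hm hp ht hN]

theorem degree_of_mem_support_law (hm : 0 < m) (hp : IsSymmetricWalk p) {t : ℝ} {ξ ζ : S →₀ ℕ}
    (h : ζ ∈ (law p m t ξ).support) : ζ.degree = ξ.degree :=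
  poissonChain_support (P := fun ζ => ζ.degree = ξ.degree)
    (fun _ ha _ hb => (degree_of_mem_support_stepKernel hm hp hb).trans ha) _ rfl h

theorem law_add (hm : 0 < m) (hp : IsSymmetricWalk p) {s t : ℝ} (hs : 0 ≤ s) (ht : 0 ≤ t)
    (ξ : S →₀ ℕ) : law p m (s + t) ξ = (law p m s ξ).bind (law p m t) :=
  pmf_ext_mean fun F _ hF => by
    have h1 := exp_genOp_apply_law hm hp (add_nonneg hs ht) (Bdd.mk F 1 hF) (le_refl ξ.degree)
    have h2 := congrArg (fun A : Bdd (S →₀ ℕ) →L[ℝ] Bdd (S →₀ ℕ) => A (Bdd.mk F 1 hF) ξ)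
      (exp_add_smul (genOp p m ξ.degree) s t)
    replace h1 := h2.symm.trans h1
    rw [mul_apply_eq_comp, exp_genOp_apply_law hm hp hs _ le_rfl] at h1
    rw [mean_bind _ _ hF]
    refine h1.symm.trans (mean_congr fun ζ hζ => ?_)
    exact exp_genOp_apply_law hm hp ht _ (degree_of_mem_support_law hm hp hζ).le

theorem tendsto_mean_law_sub (hm : 0 < m) {F : (S →₀ ℕ) → ℝ} {C : ℝ} (hF : ∀ ζ, |F ζ| ≤ C)
    (ξ : S →₀ ℕ) {s : ℝ} (hs : 0 ≤ s) :
    Tendsto (fun t : ℝ => mean (law p m (t + s) ξ) F - mean (law p m t ξ) F) atTop (𝓝 0) :=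
  tendsto_mean_poissonChain_sub _ hF ξ (rateBound_pos hm _) hs

end Rates

/-! ### Products over the sites of a configuration -/

open Classical in
/-- The part of a product over the sites of a configuration that avoids two sites. -/
def restProd (ξ : S →₀ ℕ) (x y : S) (h : S → ℕ → ℝ) : ℝ :=
  ∏ z ∈ (ξ.support.erase x).erase y, h z (ξ z)

theorem prod_eq_mul_restProd (ξ : S →₀ ℕ) {x y : S} (hxy : x ≠ y) {h : S → ℕ → ℝ}
    (h0 : ∀ z, h z 0 = 1) : ∏ z ∈ ξ.support, h z (ξ z)
      = h x (ξ x) * h y (ξ y) * restProd ξ x y h := by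
  classical
  unfold restProd
  have h1 : ∀ (s : Finset S) (w : S), (w ∉ s → ξ w = 0) →
      ∏ z ∈ s, h z (ξ z) = h w (ξ w) * ∏ z ∈ s.erase w, h z (ξ z) := fun s w hw => by
    by_cases hs : w ∈ s
    · exact (Finset.mul_prod_erase s (fun z => h z (ξ z)) hs).symm
    · rw [Finset.erase_eq_of_notMem hs, hw hs, h0, one_mul]
  rw [h1 ξ.support x (fun hx => Finsupp.notMem_support_iff.1 hx), h1 (ξ.support.erase x) y,
    mul_assoc]
  intro hy
  by_contra hne
  exact hy (Finset.mem_erase.2 ⟨hxy.symm, Finsupp.mem_support_iff.2 hne⟩)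

theorem restProd_congr {ξ ζ : S →₀ ℕ} {x y : S} {h h' : S → ℕ → ℝ}
    (hz : ∀ z, z ≠ x → z ≠ y → ξ z = ζ z ∧ h z (ξ z) = h' z (ξ z)) :
    restProd ξ x y h = restProd ζ x y h' := by
  classical
  unfold restProd
  refine Finset.prod_congr ?_ fun z hz' => ?_
  · ext z
    simp only [Finset.mem_erase, Finsupp.mem_support_iff]
    refine and_congr_right fun hy => and_congr_right fun hx => ?_
    rw [(hz z hx hy).1]
  · have hx := (Finset.mem_erase.1 (Finset.mem_erase.1 hz').2).1
    have hy := (Finset.mem_erase.1 hz').1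
    rw [Finset.mem_erase, Finset.mem_erase, Finsupp.mem_support_iff] at hz'
    rw [(hz z hx hy).2, (hz z hx hy).1]

theorem move_apply_of_ne {ξ : S →₀ ℕ} {x y z : S} (hx : z ≠ x) (hy : z ≠ y) :
    move ξ x y z = ξ z := by
  simp [move, hx.symm, hy.symm]

theorem move_apply_left {ξ : S →₀ ℕ} {x y : S} (hxy : x ≠ y) : move ξ x y x = ξ x - 1 := by
  simp [move, hxy.symm]

theorem move_apply_right {ξ : S →₀ ℕ} {x y : S} (hxy : x ≠ y) : move ξ x y y = ξ y + 1 := by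
  simp [move, hxy]

theorem prod_move (ξ : S →₀ ℕ) {x y : S} (hxy : x ≠ y) {h : S → ℕ → ℝ} (h0 : ∀ z, h z 0 = 1) :
    ∏ z ∈ (move ξ x y).support, h z (move ξ x y z)
      = h x (ξ x - 1) * h y (ξ y + 1) * restProd ξ x y h := by
  rw [prod_eq_mul_restProd _ hxy h0, move_apply_left hxy, move_apply_right hxy]
  congr 1
  exact restProd_congr fun z hx hy => ⟨move_apply_of_ne hx hy, rfl⟩

theorem restProd_comm (ξ : S →₀ ℕ) (x y : S) (h : S → ℕ → ℝ) :
    restProd ξ x y h = restProd ξ y x h := by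
  classical
  unfold restProd
  rw [Finset.erase_right_comm]

theorem move_eq_iff {ξ ζ : S →₀ ℕ} {x y : S} (hxy : x ≠ y) (h : ξ x ≠ 0 ∧ ζ = move ξ x y) :
    ζ y ≠ 0 ∧ ξ = move ζ y x := by
  obtain ⟨hx, rfl⟩ := h
  refine ⟨by rw [move_apply_right hxy]; omega, ?_⟩
  ext z
  by_cases hzx : z = x
  · subst hzx
    rw [move_apply_right hxy.symm, move_apply_left hxy]
    omega
  · by_cases hzy : z = y
    · subst hzy
      rw [move_apply_left hxy.symm, move_apply_right hxy]
      omega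
    · rw [move_apply_of_ne hzy hzx, move_apply_of_ne hzx hzy]

/-! ### The single-site duality function -/

section DualSite

variable {m : ℝ}

theorem gamma_add_nat_pos (hm : 0 < m) (k : ℕ) : 0 < Real.Gamma (m / 2 + k) :=
  Real.Gamma_pos_of_pos (by positivity)

theorem gamma_add_nat_succ (hm : 0 < m) (k : ℕ) :
    Real.Gamma (m / 2 + (k + 1 : ℕ)) = (m / 2 + k) * Real.Gamma (m / 2 + k) := by
  rw [Nat.cast_add, Nat.cast_one, ← add_assoc, Real.Gamma_add_one (by positivity)]

theorem dualSite_nonneg (hm : 0 < m) (k l : ℕ) : 0 ≤ dualSite m k l := by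
  have h1 := gamma_add_nat_pos hm k
  have h2 := gamma_add_nat_pos hm 0
  rw [Nat.cast_zero, add_zero] at h2
  unfold dualSite
  positivity

theorem dualSite_zero (hm : 0 < m) (l : ℕ) : dualSite m 0 l = 1 := by
  have h2 := gamma_add_nat_pos hm 0
  rw [Nat.cast_zero, add_zero] at h2
  simp [dualSite, h2.ne']

theorem dualSite_of_lt {k l : ℕ} (h : l < k) : dualSite m k l = 0 := by
  simp [dualSite, Nat.descFactorial_of_lt h]

theorem dualSite_succ (hm : 0 < m) (k l : ℕ) :
    (m / 2 + k) * dualSite m (k + 1) l = (l - k) * dualSite m k l := by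
  rcases lt_or_ge l k with h | h
  · rw [dualSite_of_lt h, dualSite_of_lt (by omega), mul_zero, mul_zero]
  · have h1 := gamma_add_nat_pos hm k
    have h3 : m / 2 + k ≠ 0 := by positivity
    unfold dualSite
    rw [gamma_add_nat_succ hm, Nat.descFactorial_succ, Nat.cast_mul, Nat.cast_sub h]
    field_simp

theorem dualSite_pred (k l : ℕ) : (l : ℝ) * dualSite m k (l - 1) = (l - k) * dualSite m k l := by
  cases l with
  | zero =>
    rcases Nat.eq_zero_or_pos k with rfl | hk
    · simp
    · rw [dualSite_of_lt hk]
      simp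
  | succ l =>
    rw [Nat.add_sub_cancel]
    unfold dualSite
    rcases lt_or_ge (l + 1) k with h | h
    · rw [Nat.descFactorial_of_lt h, Nat.descFactorial_of_lt (by omega)]
      simp
    · have h1 := Nat.succ_descFactorial l k
      have h2 : ((l + 1 : ℕ) - k : ℝ) * ((l + 1).descFactorial k : ℝ)
          = ((l + 1 : ℕ) : ℝ) * (l.descFactorial k : ℝ) := by
        rw [← Nat.cast_sub h]
        exact_mod_cast h1
      rw [← mul_assoc, ← mul_assoc, h2]

theorem dualSite_add_one (hm : 0 < m) (k l : ℕ) : (m / 2 + l) * dualSite m k (l + 1)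
    = (m / 2 + l + k) * dualSite m k l + k * dualSite m (k - 1) l := by
  cases k with
  | zero => simp [dualSite_zero hm]
  | succ j =>
    rw [Nat.add_sub_cancel]
    have h1 := gamma_add_nat_pos hm j
    have h3 : m / 2 + j ≠ 0 := by positivity
    have h4 := dualSite_succ hm j l
    have h5 : (m / 2 + j) * dualSite m (j + 1) (l + 1) = (l + 1) * dualSite m j l := by
      unfold dualSite
      rw [gamma_add_nat_succ hm, Nat.succ_descFactorial_succ, Nat.cast_mul]
      field_simp
      push_cast
      ring
    have h6 : (m / 2 + j) * ((m / 2 + l) * dualSite m (j + 1) (l + 1))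
        = (m / 2 + j) * ((m / 2 + l + (j + 1 : ℕ)) * dualSite m (j + 1) l
          + (j + 1 : ℕ) * dualSite m j l) := by
      push_cast
      linear_combination (m / 2 + l) * h5 - (m / 2 + l + (j + 1)) * h4
    exact mul_left_cancel₀ h3 h6

theorem two_site_duality (hm : 0 < m) (k₁ k₂ l₁ l₂ : ℕ) :
    (k₁ : ℝ) * (m + 2 * k₂) * (dualSite m (k₁ - 1) l₁ * dualSite m (k₂ + 1) l₂
        - dualSite m k₁ l₁ * dualSite m k₂ l₂)
      + k₂ * (m + 2 * k₁) * (dualSite m (k₁ + 1) l₁ * dualSite m (k₂ - 1) l₂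
        - dualSite m k₁ l₁ * dualSite m k₂ l₂)
    = l₁ * (m + 2 * l₂) * (dualSite m k₁ (l₁ - 1) * dualSite m k₂ (l₂ + 1)
        - dualSite m k₁ l₁ * dualSite m k₂ l₂)
      + l₂ * (m + 2 * l₁) * (dualSite m k₁ (l₁ + 1) * dualSite m k₂ (l₂ - 1)
        - dualSite m k₁ l₁ * dualSite m k₂ l₂) := by
  have a1 := dualSite_succ hm k₁ l₁
  have a2 := dualSite_succ hm k₂ l₂
  have b1 := dualSite_pred (m := m) k₁ l₁
  have b2 := dualSite_pred (m := m) k₂ l₂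
  have c1 := dualSite_add_one hm k₁ l₁
  have c2 := dualSite_add_one hm k₂ l₂
  linear_combination 2 * k₁ * dualSite m (k₁ - 1) l₁ * a2 + 2 * k₂ * dualSite m (k₂ - 1) l₂ * a1
    - 2 * (l₁ : ℝ) * dualSite m k₁ (l₁ - 1) * c2 - 2 * (l₂ : ℝ) * dualSite m k₂ (l₂ - 1) * c1
    - 2 * ((m / 2 + l₂ + k₂) * dualSite m k₂ l₂ + k₂ * dualSite m (k₂ - 1) l₂) * b1
    - 2 * ((m / 2 + l₁ + k₁) * dualSite m k₁ l₁ + k₁ * dualSite m (k₁ - 1) l₁) * b2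

end DualSite

/-! ### Self-duality -/

section Duality

variable {p : S → S → ℝ} {m : ℝ}

theorem dual_nonneg (hm : 0 < m) (ξ : S →₀ ℕ) (η : S → ℕ) : 0 ≤ dual m ξ η :=
  Finset.prod_nonneg fun _ _ => dualSite_nonneg hm _ _

theorem dual_eq_mul_restProd (hm : 0 < m) (ξ : S →₀ ℕ) (η : S → ℕ) {x y : S} (hxy : x ≠ y) :
    dual m ξ η = dualSite m (ξ x) (η x) * dualSite m (ξ y) (η y)
      * restProd ξ x y fun z k => dualSite m k (η z) :=
  prod_eq_mul_restProd (h := fun z k => dualSite m k (η z)) ξ hxy fun _ => dualSite_zero hm _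

theorem dual_move_left (hm : 0 < m) (ξ : S →₀ ℕ) (η : S → ℕ) {x y : S} (hxy : x ≠ y) :
    dual m (move ξ x y) η = dualSite m (ξ x - 1) (η x) * dualSite m (ξ y + 1) (η y)
      * restProd ξ x y fun z k => dualSite m k (η z) :=
  prod_move (h := fun z k => dualSite m k (η z)) ξ hxy fun _ => dualSite_zero hm _

theorem dual_move_right (hm : 0 < m) (ξ η : S →₀ ℕ) {x y : S} (hxy : x ≠ y) :
    dual m ξ (move η x y) = dualSite m (ξ x) (η x - 1) * dualSite m (ξ y) (η y + 1)
      * restProd ξ x y fun z k => dualSite m k (η z) := by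
  rw [dual_eq_mul_restProd hm ξ _ hxy, move_apply_left hxy, move_apply_right hxy]
  congr 1
  exact restProd_congr fun z hx hy => ⟨rfl, by rw [move_apply_of_ne hx hy]⟩

theorem bond_duality (hm : 0 < m) (ξ η : S →₀ ℕ) {x y : S} (hxy : x ≠ y) :
    (ξ x : ℝ) * (m + 2 * ξ y) * (dual m (move ξ x y) η - dual m ξ η)
      + ξ y * (m + 2 * ξ x) * (dual m (move ξ y x) η - dual m ξ η)
    = η x * (m + 2 * η y) * (dual m ξ (move η x y) - dual m ξ η)
      + η y * (m + 2 * η x) * (dual m ξ (move η y x) - dual m ξ η) := by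
  rw [dual_move_left hm ξ η hxy, dual_move_left hm ξ η hxy.symm, dual_move_right hm ξ η hxy,
    dual_move_right hm ξ η hxy.symm, dual_eq_mul_restProd hm ξ η hxy, restProd_comm ξ y x]
  have h := two_site_duality hm (ξ x) (ξ y) (η x) (η y)
  set R := restProd ξ x y fun z k => dualSite m k (η z)
  linear_combination R * h

theorem dual_le_of_degree_le (hm : 0 < m) (N : ℕ) :
    ∃ C : ℝ, ∀ ξ η : S →₀ ℕ, ξ.degree ≤ N → η.degree ≤ N → dual m ξ η ≤ C := by
  set B : ℝ := 1 + ∑ k ∈ Finset.range (N + 1), ∑ l ∈ Finset.range (N + 1), dualSite m k l with hB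
  have hnn : ∀ k, 0 ≤ ∑ l ∈ Finset.range (N + 1), dualSite m k l := fun k =>
    Finset.sum_nonneg fun l _ => dualSite_nonneg hm k l
  have hB1 : 1 ≤ B := by
    have := Finset.sum_nonneg fun k (_ : k ∈ Finset.range (N + 1)) => hnn k
    linarith
  have hle : ∀ k l, k ≤ N → l ≤ N → dualSite m k l ≤ B := fun k l hk hl => by
    have h1 := Finset.single_le_sum (f := fun l => dualSite m k l)
      (fun l _ => dualSite_nonneg hm k l) (Finset.mem_range.2 (Nat.lt_succ_of_le hl))
    have h2 := Finset.single_le_sum (f := fun k => ∑ l ∈ Finset.range (N + 1), dualSite m k l)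
      (fun k _ => hnn k) (Finset.mem_range.2 (Nat.lt_succ_of_le hk))
    linarith
  refine ⟨B ^ N, fun ξ η hξ hη => ?_⟩
  have hcard : ξ.support.card ≤ N := by
    refine le_trans ?_ hξ
    rw [Finsupp.degree_apply, Finset.card_eq_sum_ones]
    exact Finset.sum_le_sum fun x hx =>
      Nat.one_le_iff_ne_zero.2 (Finsupp.mem_support_iff.1 hx)
  calc dual m ξ η ≤ ∏ x ∈ ξ.support, B :=
        Finset.prod_le_prod (fun x _ => dualSite_nonneg hm _ _) fun x _ =>
          hle _ _ ((Finsupp.le_degree x ξ).trans hξ) ((Finsupp.le_degree x η).trans hη)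
    _ = B ^ ξ.support.card := Finset.prod_const B
    _ ≤ B ^ N := pow_le_pow_right₀ hB1 hcard

open Classical in
/-- The duality function cut off at `N` particles. -/
def dualCut (m : ℝ) (N : ℕ) (ξ η : S →₀ ℕ) : ℝ :=
  if ξ.degree ≤ N ∧ η.degree ≤ N then dual m ξ η else 0

theorem dualCut_nonneg (hm : 0 < m) (N : ℕ) (ξ η : S →₀ ℕ) : 0 ≤ dualCut m N ξ η := by
  unfold dualCut
  split_ifs
  exacts [dual_nonneg hm _ _, le_rfl]

theorem dualCut_of_le {N : ℕ} {ξ η : S →₀ ℕ} (hξ : ξ.degree ≤ N) (hη : η.degree ≤ N) :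
    dualCut m N ξ η = dual m ξ η := if_pos ⟨hξ, hη⟩

theorem exists_abs_dualCut_le (hm : 0 < m) (N : ℕ) :
    ∃ C : ℝ, ∀ ξ η : S →₀ ℕ, |dualCut m N ξ η| ≤ C := by
  obtain ⟨C, hC⟩ := dual_le_of_degree_le (S := S) hm N
  refine ⟨max C 0, fun ξ η => ?_⟩
  rw [abs_of_nonneg (dualCut_nonneg hm N ξ η)]
  unfold dualCut
  split_ifs with h
  exacts [(hC ξ η h.1 h.2).trans (le_max_left _ _), le_max_right _ _]

theorem tsum_symmetrize {α : Type*} {f g : α × α → ℝ} (hf : Summable f) (hg : Summable g)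
    (h : ∀ x y, f (x, y) + f (y, x) = g (x, y) + g (y, x)) : ∑' z, f z = ∑' z, g z := by
  have hswap : ∀ {f : α × α → ℝ}, Summable f → Summable (fun z : α × α => f z.swap) ∧
      ∑' z : α × α, f z.swap = ∑' z, f z := fun {f} hf =>
    ⟨(Equiv.prodComm α α).summable_iff.2 hf, (Equiv.prodComm α α).tsum_eq f⟩
  have h1 := hf.tsum_add (hswap hf).1
  have h2 := hg.tsum_add (hswap hg).1
  rw [(hswap hf).2] at h1
  rw [(hswap hg).2] at h2
  have h3 : ∑' z, (f z + f z.swap) = ∑' z, (g z + g z.swap) := tsum_congr fun z => h z.1 z.2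
  linarith

theorem generator_dualCut (hm : 0 < m) (hp : IsSymmetricWalk p) {N : ℕ} {ξ η : S →₀ ℕ}
    (hξ : ξ.degree ≤ N) (hη : η.degree ≤ N) :
    generator p m (fun ζ => dualCut m N ζ η) ξ = generator p m (fun ζ => dualCut m N ξ ζ) η := by
  obtain ⟨C, hC⟩ := exists_abs_dualCut_le (S := S) hm N
  have hb : ∀ a b : S →₀ ℕ, ∀ a' b' : S →₀ ℕ,
      |dualCut m N a b - dualCut m N a' b'| ≤ C + C := fun a b a' b' =>
    (abs_sub _ _).trans (add_le_add (hC _ _) (hC _ _))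
  rw [generator_eq_tsum hm hp ξ (fun ζ => hC ζ η), generator_eq_tsum hm hp η (fun ζ => hC ξ ζ)]
  refine tsum_symmetrize (summable_jumpRate_mul hm hp ξ fun z => hb _ _ _ _)
    (summable_jumpRate_mul hm hp η fun z => hb _ _ _ _) fun x y => ?_
  have h1 : ∀ x y, jumpRate p m ξ (x, y) * (dualCut m N (move ξ x y) η - dualCut m N ξ η)
      = 2 * p x y * (ξ x * (m + 2 * ξ y) * (dual m (move ξ x y) η - dual m ξ η)) :=
    fun x y => by
      unfold jumpRate
      by_cases h0 : ξ x = 0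
      · simp [h0]
      · rw [dualCut_of_le hξ hη, dualCut_of_le ((move_degree h0 y).le.trans hξ) hη]
        ring
  have h2 : ∀ x y, jumpRate p m η (x, y) * (dualCut m N ξ (move η x y) - dualCut m N ξ η)
      = 2 * p x y * (η x * (m + 2 * η y) * (dual m ξ (move η x y) - dual m ξ η)) :=
    fun x y => by
      unfold jumpRate
      by_cases h0 : η x = 0
      · simp [h0]
      · rw [dualCut_of_le hξ hη, dualCut_of_le hξ ((move_degree h0 y).le.trans hη)]
        ring
  simp only [h1, h2]
  by_cases hxy : x = y
  · simp [hxy, hp.loopless]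
  · rw [hp.symm y x]
    linear_combination 2 * p x y * bond_duality hm ξ η hxy

theorem lmean_stepKernel_dualCut (hm : 0 < m) (hp : IsSymmetricWalk p) (N : ℕ) (ξ η : S →₀ ℕ) :
    (lmean (stepKernel p m N ξ) fun ζ => ENNReal.ofReal (dualCut m N ζ η))
      = lmean (stepKernel p m N η) fun ζ => ENNReal.ofReal (dualCut m N ξ ζ) := by
  obtain ⟨C, hC⟩ := exists_abs_dualCut_le (S := S) hm N
  have hz1 : ∀ ζ ζ' : S →₀ ℕ, N < ζ.degree → dualCut m N ζ ζ' = 0 := fun ζ ζ' h =>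
    if_neg fun h' => h.not_ge h'.1
  have hz2 : ∀ ζ ζ' : S →₀ ℕ, N < ζ'.degree → dualCut m N ζ ζ' = 0 := fun ζ ζ' h =>
    if_neg fun h' => h.not_ge h'.2
  rcases lt_or_ge N ξ.degree with hξ | hξ
  · rw [stepKernel_of_lt hξ, lmean_pure]
    simp only [hz1 ξ _ hξ, lmean_const]
  rcases lt_or_ge N η.degree with hη | hη
  · rw [stepKernel_of_lt hη, lmean_pure]
    simp only [hz2 _ η hη, lmean_const]
  rw [← ofReal_mean _ (fun ζ => dualCut_nonneg hm N ζ η) (fun ζ => hC ζ η),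
    ← ofReal_mean _ (fun ζ => dualCut_nonneg hm N ξ ζ) (fun ζ => hC ξ ζ)]
  congr 1
  have h1 := mean_stepKernel hm hp hξ (fun ζ => hC ζ η)
  have h2 := mean_stepKernel hm hp hη (fun ζ => hC ξ ζ)
  rw [generator_dualCut hm hp hξ hη, ← h2] at h1
  have h3 := mul_left_cancel₀ (rateBound_pos hm N).ne' h1
  linarith

theorem chain_succ' {α : Type*} (κ : α → PMF α) (k : ℕ) (a : α) :
    chain κ (k + 1) a = (chain κ k a).bind κ := by
  induction k generalizing a with
  | zero => simp only [chain, PMF.pure_bind]; exact PMF.bind_pure _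
  | succ k ih =>
    calc chain κ (k + 1 + 1) a = (κ a).bind fun b => (chain κ k b).bind κ :=
          congrArg (κ a).bind (funext ih)
      _ = ((κ a).bind (chain κ k)).bind κ := (PMF.bind_bind _ _ _).symm

theorem lmean_chain_comm {α : Type*} {κ : α → PMF α} {G : α → α → ℝ≥0∞}
    (h : ∀ a b, (lmean (κ a) fun c => G c b) = lmean (κ b) fun c => G a c) (k : ℕ) (a b : α) :
    (lmean (chain κ k a) fun c => G c b) = lmean (chain κ k b) fun c => G a c := by
  induction k generalizing a with
  | zero => simp only [chain, lmean_pure]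
  | succ k ih =>
    rw [chain, lmean_bind, funext ih, lmean_comm, chain_succ', lmean_bind]
    exact congrArg _ (funext fun c => h a c)

theorem lmean_poissonChain_comm {α : Type*} {κ : α → PMF α} {G : α → α → ℝ≥0∞}
    (h : ∀ a b, (lmean (κ a) fun c => G c b) = lmean (κ b) fun c => G a c) (u : NNReal)
    (a b : α) :
    (lmean (poissonChain κ u a) fun c => G c b) = lmean (poissonChain κ u b) fun c => G a c := by
  unfold poissonChain
  rw [lmean_bind, lmean_bind]
  exact congrArg _ (funext fun k => lmean_chain_comm h k a b)

/-- Self-duality of the inclusion process with finitely many particles. -/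
theorem lmean_law_dual (hm : 0 < m) (hp : IsSymmetricWalk p) {t : ℝ} (ht : 0 ≤ t)
    (ξ η : S →₀ ℕ) : (lmean (law p m t ξ) fun ζ => ENNReal.ofReal (dual m ζ η))
      = lmean (law p m t η) fun ζ => ENNReal.ofReal (dual m ξ ζ) := by
  set N := max ξ.degree η.degree
  have hξ : ξ.degree ≤ N := le_max_left _ _
  have hη : η.degree ≤ N := le_max_right _ _
  have h := lmean_poissonChain_comm (lmean_stepKernel_dualCut hm hp N)
    (rateBound m N * t).toNNReal ξ η
  rw [← law_eq_poissonChain hm hp ht hξ, ← law_eq_poissonChain hm hp ht hη] at h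
  refine Eq.trans (lmean_congr fun ζ hζ => ?_) (h.trans (lmean_congr fun ζ hζ => ?_))
  · rw [dualCut_of_le ((degree_of_mem_support_law hm hp hζ).le.trans hξ) hη]
  · rw [dualCut_of_le hξ ((degree_of_mem_support_law hm hp hζ).le.trans hη)]

end Duality

/-! ### Reversibility -/

section Reversible

variable {p : S → S → ℝ} {m : ℝ}

theorem chain_reversible {α : Type*} {κ : α → PMF α} {w : α → ℝ≥0∞}
    (h : ∀ a b, w a * κ a b = w b * κ b a) (k : ℕ) (a b : α) :
    w a * chain κ k a b = w b * chain κ k b a := by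
  classical
  induction k generalizing a with
  | zero =>
    simp only [chain, PMF.pure_apply]
    by_cases hab : a = b
    · rw [hab]
    · simp [hab, Ne.symm hab]
  | succ k ih =>
    rw [chain_succ' κ k b, chain, PMF.bind_apply, PMF.bind_apply, ← ENNReal.tsum_mul_left,
      ← ENNReal.tsum_mul_left]
    refine tsum_congr fun c => ?_
    calc w a * (κ a c * chain κ k c b) = (w a * κ a c) * chain κ k c b := by ring
      _ = κ c a * (w c * chain κ k c b) := by rw [h a c]; ring
      _ = _ := by rw [ih c]; ring

theorem poissonChain_reversible {α : Type*} {κ : α → PMF α} {w : α → ℝ≥0∞}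
    (h : ∀ a b, w a * κ a b = w b * κ b a) (u : NNReal) (a b : α) :
    w a * poissonChain κ u a b = w b * poissonChain κ u b a := by
  unfold poissonChain
  rw [PMF.bind_apply, PMF.bind_apply, ← ENNReal.tsum_mul_left, ← ENNReal.tsum_mul_left]
  refine tsum_congr fun k => ?_
  rw [mul_left_comm, chain_reversible h k a b, mul_left_comm]

/-- The single-site weights of the reversible measure. -/
def siteWeight (m : ℝ) (k : ℕ) : ℝ :=
  Real.Gamma (m / 2 + k) / (Real.Gamma (m / 2) * (k.factorial : ℝ))

/-- The reversible measure of the inclusion process. -/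
def revWeight (m : ℝ) (ξ : S →₀ ℕ) : ℝ := ∏ x ∈ ξ.support, siteWeight m (ξ x)

theorem siteWeight_zero (hm : 0 < m) : siteWeight m 0 = 1 := by
  have h2 := gamma_add_nat_pos hm 0
  rw [Nat.cast_zero, add_zero] at h2
  simp [siteWeight, h2.ne']

theorem siteWeight_pos (hm : 0 < m) (k : ℕ) : 0 < siteWeight m k := by
  have h1 := gamma_add_nat_pos hm k
  have h2 := gamma_add_nat_pos hm 0
  rw [Nat.cast_zero, add_zero] at h2
  unfold siteWeight
  positivity

theorem siteWeight_succ (hm : 0 < m) (k : ℕ) :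
    (k + 1) * siteWeight m (k + 1) = (m / 2 + k) * siteWeight m k := by
  have h2 := gamma_add_nat_pos hm 0
  rw [Nat.cast_zero, add_zero] at h2
  unfold siteWeight
  rw [gamma_add_nat_succ hm, Nat.factorial_succ]
  push_cast
  field_simp

theorem revWeight_pos (hm : 0 < m) (ξ : S →₀ ℕ) : 0 < revWeight m ξ :=
  Finset.prod_pos fun _ _ => siteWeight_pos hm _

theorem revWeight_detailed_balance (hm : 0 < m) {ξ : S →₀ ℕ} {x y : S} (hxy : x ≠ y)
    (hx : ξ x ≠ 0) : revWeight m ξ * (ξ x * (m + 2 * ξ y))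
      = revWeight m (move ξ x y) * (move ξ x y y * (m + 2 * move ξ x y x)) := by
  have h1 := prod_eq_mul_restProd (h := fun _ k => siteWeight m k) ξ hxy
    fun _ => siteWeight_zero hm
  have h2 := prod_move (h := fun _ k => siteWeight m k) ξ hxy fun _ => siteWeight_zero hm
  rw [revWeight, revWeight, h1, h2, move_apply_left hxy, move_apply_right hxy]
  obtain ⟨k, hk⟩ := Nat.exists_eq_succ_of_ne_zero hx
  rw [hk, Nat.succ_eq_add_one, Nat.add_sub_cancel]
  have h3 := siteWeight_succ hm k
  have h4 := siteWeight_succ hm (ξ y)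
  set R := restProd ξ x y fun _ k => siteWeight m k
  push_cast
  linear_combination R * siteWeight m (ξ y) * (m + 2 * ξ y) * h3
    - R * siteWeight m k * (m + 2 * k) * h4

theorem revWeight_mul_jumpRate (hm : 0 < m) (hp : IsSymmetricWalk p) {ξ ζ : S →₀ ℕ} {x y : S}
    (h : ξ x ≠ 0 ∧ ζ = move ξ x y) :
    revWeight m ξ * jumpRate p m ξ (x, y) = revWeight m ζ * jumpRate p m ζ (y, x) := by
  by_cases hxy : x = y
  · subst hxy
    simp [jumpRate, hp.loopless]
  obtain ⟨h0, rfl⟩ := h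
  have := revWeight_detailed_balance hm hxy h0
  unfold jumpRate
  simp only
  rw [hp.symm y x]
  linear_combination 2 * p x y * this

open Classical in
/-- The contribution of a jump to the one-step transition probability from `ξ` to `ζ`. -/
def jumpTerm (p : S → S → ℝ) (m : ℝ) (N : ℕ) (ξ ζ : S →₀ ℕ) (z : S × S) : ℝ≥0∞ :=
  if ξ z.1 ≠ 0 ∧ ζ = move ξ z.1 z.2 then ENNReal.ofReal (jumpRate p m ξ z / rateBound m N) else 0

theorem stepKernel_apply_of_ne (hm : 0 < m) (hp : IsSymmetricWalk p) {N : ℕ} {ξ ζ : S →₀ ℕ}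
    (hN : ξ.degree ≤ N) (hne : ζ ≠ ξ) : stepKernel p m N ξ ζ
      = ∑' z : S × S, jumpTerm p m N ξ ζ z := by
  classical
  rw [stepKernel, PMF.map_apply]
  have h := hasSum_option (f := fun o => if ζ = afterJump ξ o then stepJump p m N ξ o else 0)
    ENNReal.summable.hasSum
  refine Eq.trans (tsum_congr fun o => ?_) (h.tsum_eq.trans ?_)
  · congr
  · rw [if_neg (show ¬ζ = afterJump ξ none from hne), zero_add]
    refine tsum_congr fun z => ?_
    rw [stepJump_apply hm hp hN, jumpTerm]
    by_cases h0 : ξ z.1 = 0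
    · simp [stepWeight, jumpRate, h0]
    · simp only [stepWeight, ne_eq, h0, not_false_eq_true, true_and, afterJump]
      congr

theorem stepKernel_reversible (hm : 0 < m) (hp : IsSymmetricWalk p) (N : ℕ) (ξ ζ : S →₀ ℕ) :
    ENNReal.ofReal (revWeight m ξ) * stepKernel p m N ξ ζ
      = ENNReal.ofReal (revWeight m ζ) * stepKernel p m N ζ ξ := by
  classical
  by_cases hne : ζ = ξ
  · rw [hne]
  by_cases hdeg : ζ.degree = ξ.degree
  · rcases lt_or_ge N ξ.degree with hN | hN
    · rw [stepKernel_of_lt hN, stepKernel_of_lt (hdeg ▸ hN), PMF.pure_apply, PMF.pure_apply,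
        if_neg hne, if_neg (Ne.symm hne), mul_zero, mul_zero]
    · rw [stepKernel_apply_of_ne hm hp hN hne,
        stepKernel_apply_of_ne hm hp (hdeg.le.trans hN) (Ne.symm hne),
        ← ENNReal.tsum_mul_left, ← ENNReal.tsum_mul_left,
        ← (Equiv.prodComm S S).tsum_eq fun z => ENNReal.ofReal (revWeight m ζ) * jumpTerm p m N ζ ξ z]
      refine tsum_congr fun z => ?_
      obtain ⟨x, y⟩ := z
      change _ = ENNReal.ofReal (revWeight m ζ) * jumpTerm p m N ζ ξ (y, x)
      unfold jumpTerm
      by_cases hxy : x = y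
      · subst hxy
        simp [jumpRate, hp.loopless]
      by_cases h : ξ x ≠ 0 ∧ ζ = move ξ x y
      · rw [if_pos h, if_pos (move_eq_iff hxy h), ← ENNReal.ofReal_mul (revWeight_pos hm _).le,
          ← ENNReal.ofReal_mul (revWeight_pos hm _).le, ← mul_div_assoc, ← mul_div_assoc,
          revWeight_mul_jumpRate hm hp h]
      · rw [if_neg h, if_neg fun h' => h (move_eq_iff (Ne.symm hxy) h'), mul_zero, mul_zero]
  · have h1 : stepKernel p m N ξ ζ = 0 := by
      by_contra h
      exact hdeg (degree_of_mem_support_stepKernel hm hp ((PMF.mem_support_iff _ _).2 h))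
    have h2 : stepKernel p m N ζ ξ = 0 := by
      by_contra h
      exact hdeg (degree_of_mem_support_stepKernel hm hp ((PMF.mem_support_iff _ _).2 h)).symm
    rw [h1, h2, mul_zero, mul_zero]

theorem law_reversible (hm : 0 < m) (hp : IsSymmetricWalk p) {t : ℝ} (ht : 0 ≤ t)
    (ξ ζ : S →₀ ℕ) : ENNReal.ofReal (revWeight m ξ) * law p m t ξ ζ
      = ENNReal.ofReal (revWeight m ζ) * law p m t ζ ξ := by
  rw [law_eq_poissonChain hm hp ht (le_max_left ξ.degree ζ.degree),
    law_eq_poissonChain hm hp ht (le_max_right ξ.degree ζ.degree)]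
  exact poissonChain_reversible (w := fun ξ : S →₀ ℕ => ENNReal.ofReal (revWeight m ξ))
    (stepKernel_reversible hm hp _) _ ξ ζ

end Reversible

/-! ### Collisions -/

section Collision

variable {p : S → S → ℝ} {m : ℝ}

/-- The configurations with at least two particles at the same site. -/
def collisionSet (S : Type*) : Set (S →₀ ℕ) := {ζ | ∃ z, 2 ≤ ζ z}

theorem abs_indicator_one_le {α : Type*} (s : Set α) (a : α) :
    |s.indicator (1 : α → ℝ) a| ≤ 1 := by
  by_cases h : a ∈ s <;> simp [h]

theorem indicator_one_nonneg {α : Type*} (s : Set α) (a : α) :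
    0 ≤ s.indicator (1 : α → ℝ) a :=
  Set.indicator_nonneg (fun _ _ => zero_le_one) a

theorem collisionProb_eq_mean (hm : 0 < m) (hp : IsSymmetricWalk p) {t : ℝ} (ht : 0 ≤ t)
    (ξ : S →₀ ℕ) :
    collisionProb p m t ξ = mean (law p m t ξ) ((collisionSet S).indicator 1) :=
  finSemigroup_eq_mean hm hp ht (abs_indicator_one_le _) ξ

theorem collisionProb_nonneg (hm : 0 < m) (hp : IsSymmetricWalk p) {t : ℝ} (ht : 0 ≤ t)
    (ξ : S →₀ ℕ) : 0 ≤ collisionProb p m t ξ := by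
  rw [collisionProb_eq_mean hm hp ht]
  exact mean_nonneg fun _ _ => indicator_one_nonneg _ _

theorem collisionProb_le_one (hm : 0 < m) (hp : IsSymmetricWalk p) {t : ℝ} (ht : 0 ≤ t)
    (ξ : S →₀ ℕ) : collisionProb p m t ξ ≤ 1 := by
  rw [collisionProb_eq_mean hm hp ht]
  exact (abs_le.1 (abs_mean_le _ (abs_indicator_one_le _))).2

theorem ofReal_collisionProb (hm : 0 < m) (hp : IsSymmetricWalk p) {t : ℝ} (ht : 0 ≤ t)
    (ξ : S →₀ ℕ) : ENNReal.ofReal (collisionProb p m t ξ)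
      = lmean (law p m t ξ) ((collisionSet S).indicator 1) := by
  rw [collisionProb_eq_mean hm hp ht,
    ofReal_mean _ (indicator_one_nonneg _) (abs_indicator_one_le _)]
  congr 1
  funext ζ
  by_cases h : ζ ∈ collisionSet S <;> simp [h]

theorem AssumptionA2.tendsto_pair (hm : 0 < m) (hp : IsSymmetricWalk p) (h : AssumptionA2 p m)
    (x y : S) : Tendsto (fun t : ℝ => collisionProb p m t (particles ![x, y])) atTop (𝓝 0) := by
  refine squeeze_zero' ?_ ?_ h
  · filter_upwards [eventually_ge_atTop 0] with t ht using collisionProb_nonneg hm hp ht _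
  · filter_upwards [eventually_ge_atTop 0] with t ht
    refine le_ciSup (f := fun z : S × S => collisionProb p m t (particles ![z.1, z.2]))
      ⟨1, ?_⟩ (x, y)
    rintro _ ⟨z, rfl⟩
    exact collisionProb_le_one hm hp ht _

theorem exists_particles_eq (ξ : S →₀ ℕ) {n : ℕ} (h : ξ.degree = n) :
    ∃ x : Fin n → S, particles x = ξ := by
  induction n generalizing ξ with
  | zero =>
    refine ⟨Fin.elim0, ?_⟩
    rw [(Finsupp.degree_eq_zero_iff ξ).1 h]
    simp [particles]
  | succ n ih =>
    have hne : ξ ≠ 0 := by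
      rintro rfl
      simp at h
    obtain ⟨z, hz⟩ := Finsupp.ne_iff.1 hne
    have hle : Finsupp.single z 1 ≤ ξ := Finsupp.single_le_iff.2 (Nat.one_le_iff_ne_zero.2 hz)
    have hsplit := tsub_add_cancel_of_le hle
    have hdeg : (ξ - Finsupp.single z 1).degree = n := by
      rw [← hsplit, map_add, Finsupp.degree_single] at h
      omega
    obtain ⟨x, hx⟩ := ih _ hdeg
    refine ⟨Fin.cons z x, ?_⟩
    rw [particles, Fin.sum_univ_succ]
    simp only [Fin.cons_zero, Fin.cons_succ]
    rw [particles] at hx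
    rw [hx, add_comm, hsplit]

theorem degree_particles {n : ℕ} (x : Fin n → S) : (particles x).degree = n := by
  simp [particles, map_sum]

theorem dual_eq_zero_of_not_le {ξ : S →₀ ℕ} {η : S → ℕ} (h : ¬∀ x, ξ x ≤ η x) :
    dual m ξ η = 0 := by
  push Not at h
  obtain ⟨x, hx⟩ := h
  refine Finset.prod_eq_zero (i := x) (Finsupp.mem_support_iff.2 (by omega)) ?_
  exact dualSite_of_lt hx

theorem dual_single {k : ℕ} (hk : k ≠ 0) (x : S) (η : S → ℕ) :
    dual m (Finsupp.single x k) η = dualSite m k (η x) := by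
  rw [dual, Finsupp.support_single _ hk, Finset.prod_singleton, Finsupp.single_eq_same]

theorem one_le_mul_dualSite_two (hm : 0 < m) :
    ∃ c : ℝ, 0 < c ∧ ∀ l : ℕ, 2 ≤ l → 1 ≤ c * dualSite m 2 l := by
  have h1 := gamma_add_nat_pos hm 2
  have h2 := gamma_add_nat_pos hm 0
  rw [Nat.cast_zero, add_zero] at h2
  set r := Real.Gamma (m / 2) / Real.Gamma (m / 2 + (2 : ℕ)) with hr
  have hr0 : 0 < r := by positivity
  refine ⟨r⁻¹, by positivity, fun l hl => ?_⟩
  have h3 : (1 : ℝ) ≤ (l.descFactorial 2 : ℝ) := by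
    exact_mod_cast Nat.one_le_iff_ne_zero.2 fun h => absurd (Nat.descFactorial_eq_zero_iff_lt.1 h)
      (by omega)
  rw [dualSite, ← hr]
  calc (1 : ℝ) ≤ l.descFactorial 2 := h3
    _ = _ := by field_simp

open Classical in
/-- The collision probability of many particles is controlled by those of pairs. -/
theorem exists_collision_bound (hm : 0 < m) (hp : IsSymmetricWalk p) (ξ : S →₀ ℕ) :
    ∃ c : (S →₀ ℕ) → ℝ≥0∞, (∀ σ, c σ ≠ ∞) ∧ ∀ t : ℝ, 0 ≤ t →
      ENNReal.ofReal (collisionProb p m t ξ) ≤ ∑ σ ∈ (Finset.Icc 0 ξ).filter (·.degree = 2),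
        c σ * ENNReal.ofReal (collisionProb p m t σ) := by
  obtain ⟨r, hr0, hr⟩ := one_le_mul_dualSite_two hm
  set w := siteWeight m 2 with hw
  have hw0 : 0 < w := siteWeight_pos hm 2
  have hw2 : ∀ z : S, revWeight m (Finsupp.single z 2) = w := fun z => by
    rw [revWeight, Finsupp.support_single _ two_ne_zero, Finset.prod_singleton,
      Finsupp.single_eq_same]
  have hwtop : ENNReal.ofReal w ≠ ∞ := ENNReal.ofReal_ne_top
  have hwne : ENNReal.ofReal w ≠ 0 := by simpa using hw0
  refine ⟨fun σ => ENNReal.ofReal r * ((ENNReal.ofReal w)⁻¹ * ENNReal.ofReal (revWeight m σ)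
    * ENNReal.ofReal (dual m σ ξ)), fun σ => ?_, fun t ht => ?_⟩
  · exact ENNReal.mul_ne_top ENNReal.ofReal_ne_top (ENNReal.mul_ne_top (ENNReal.mul_ne_top
      (ENNReal.inv_ne_top.2 hwne) ENNReal.ofReal_ne_top) ENNReal.ofReal_ne_top)
  have hpair : ∀ σ : S →₀ ℕ, ∑' z : S, law p m t σ (Finsupp.single z 2)
      ≤ if σ.degree = 2 then ENNReal.ofReal (collisionProb p m t σ) else 0 := fun σ => by
    split_ifs with h
    · rw [ofReal_collisionProb hm hp ht]
      have hinj : Function.Injective fun z : S => Finsupp.single z 2 :=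
        Finsupp.single_left_injective two_ne_zero
      refine le_trans (ENNReal.tsum_le_tsum fun z => ?_)
        (ENNReal.tsum_comp_le_tsum_of_injective hinj
          fun ζ => law p m t σ ζ * (collisionSet S).indicator 1 ζ)
      rw [Set.indicator_of_mem (show Finsupp.single z 2 ∈ collisionSet S from ⟨z, by simp⟩),
        Pi.one_apply, mul_one]
    · refine le_of_eq (ENNReal.tsum_eq_zero.2 fun z => ?_)
      by_contra h0
      have := degree_of_mem_support_law hm hp ((PMF.mem_support_iff _ _).2 h0)
      rw [Finsupp.degree_single] at this
      exact h this.symm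
  calc ENNReal.ofReal (collisionProb p m t ξ)
      = lmean (law p m t ξ) ((collisionSet S).indicator 1) := ofReal_collisionProb hm hp ht ξ
    _ ≤ lmean (law p m t ξ) fun ζ => ∑' z : S, ENNReal.ofReal r *
          ENNReal.ofReal (dual m (Finsupp.single z 2) ζ) := by
        refine lmean_mono fun ζ _ => ?_
        by_cases h : ζ ∈ collisionSet S
        · obtain ⟨z, hz⟩ := h
          rw [Set.indicator_of_mem (show ζ ∈ collisionSet S from ⟨z, hz⟩), Pi.one_apply]
          refine le_trans ?_ (ENNReal.le_tsum z)
          rw [← ENNReal.ofReal_mul hr0.le, dual_single two_ne_zero]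
          exact ENNReal.one_le_ofReal.2 (hr _ hz)
        · rw [Set.indicator_of_notMem h]
          exact zero_le
    _ = ∑' z : S, ENNReal.ofReal r * ∑' σ : S →₀ ℕ, law p m t (Finsupp.single z 2) σ *
          ENNReal.ofReal (dual m σ ξ) := by
        rw [lmean_tsum]
        refine tsum_congr fun z => ?_
        rw [lmean_const_mul, ← lmean_law_dual hm hp ht]
        rfl
    _ = ∑' z : S, ∑' σ : S →₀ ℕ, ENNReal.ofReal r * ((ENNReal.ofReal w)⁻¹ *
          ENNReal.ofReal (revWeight m σ) * ENNReal.ofReal (dual m σ ξ)) *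
          law p m t σ (Finsupp.single z 2) := by
        refine tsum_congr fun z => ?_
        rw [← ENNReal.tsum_mul_left]
        refine tsum_congr fun σ => ?_
        have h1 := law_reversible hm hp ht (Finsupp.single z 2) σ
        rw [hw2] at h1
        have h2 : law p m t (Finsupp.single z 2) σ = (ENNReal.ofReal w)⁻¹ *
            (ENNReal.ofReal (revWeight m σ) * law p m t σ (Finsupp.single z 2)) := by
          rw [← h1, ← mul_assoc, ENNReal.inv_mul_cancel hwne hwtop, one_mul]
        rw [h2]
        ring
    _ = ∑' σ : S →₀ ℕ, ENNReal.ofReal r * ((ENNReal.ofReal w)⁻¹ *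
          ENNReal.ofReal (revWeight m σ) * ENNReal.ofReal (dual m σ ξ)) *
          ∑' z : S, law p m t σ (Finsupp.single z 2) := by
        rw [ENNReal.tsum_comm]
        exact tsum_congr fun σ => ENNReal.tsum_mul_left
    _ ≤ ∑' σ : S →₀ ℕ, ENNReal.ofReal r * ((ENNReal.ofReal w)⁻¹ *
          ENNReal.ofReal (revWeight m σ) * ENNReal.ofReal (dual m σ ξ)) *
          if σ.degree = 2 then ENNReal.ofReal (collisionProb p m t σ) else 0 :=
        ENNReal.tsum_le_tsum fun σ => mul_le_mul_right (hpair σ) _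
    _ = _ := by
        rw [tsum_eq_sum (s := Finset.Icc 0 ξ)]
        · rw [Finset.sum_filter]
          refine Finset.sum_congr rfl fun σ _ => ?_
          split_ifs <;> simp
        · intro σ hσ
          rw [dual_eq_zero_of_not_le fun h => hσ (Finset.mem_Icc.2 ⟨zero_le, h⟩)]
          simp

/-- Finitely many particles eventually sit at distinct sites. -/
theorem AssumptionA2.tendsto_collisionProb (hm : 0 < m) (hp : IsSymmetricWalk p)
    (h : AssumptionA2 p m) (ξ : S →₀ ℕ) :
    Tendsto (fun t : ℝ => collisionProb p m t ξ) atTop (𝓝 0) := by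
  classical
  obtain ⟨c, hc, hb⟩ := exists_collision_bound hm hp ξ
  have h1 : Tendsto (fun t : ℝ => ∑ σ ∈ (Finset.Icc 0 ξ).filter (·.degree = 2),
      c σ * ENNReal.ofReal (collisionProb p m t σ)) atTop (𝓝 0) := by
    rw [← Finset.sum_const_zero (s := (Finset.Icc 0 ξ).filter (·.degree = 2)) (M := ℝ≥0∞)]
    refine tendsto_finsetSum _ fun σ hσ => ?_
    obtain ⟨x, hx⟩ := exists_particles_eq σ (Finset.mem_filter.1 hσ).2
    have hx2 : particles ![x 0, x 1] = σ := by
      rw [← hx]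
      congr 1
      ext i
      fin_cases i <;> rfl
    have h2 := h.tendsto_pair hm hp (x 0) (x 1)
    rw [hx2] at h2
    have h3 := ENNReal.Tendsto.const_mul (a := c σ)
      ((ENNReal.continuous_ofReal.tendsto 0).comp h2) (Or.inr (hc σ))
    rwa [ENNReal.ofReal_zero, mul_zero] at h3
  have h4 : Tendsto (fun t : ℝ => ENNReal.ofReal (collisionProb p m t ξ)) atTop (𝓝 0) :=
    tendsto_of_tendsto_of_tendsto_of_le_of_le' tendsto_const_nhds h1
      (Eventually.of_forall fun _ => zero_le)
      ((eventually_ge_atTop 0).mono fun t ht => hb t ht)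
  have h5 := (ENNReal.tendsto_toReal ENNReal.zero_ne_top).comp h4
  rw [ENNReal.toReal_zero] at h5
  refine h5.congr' ?_
  filter_upwards [eventually_ge_atTop 0] with t ht
  exact ENNReal.toReal_ofReal (collisionProb_nonneg hm hp ht ξ)

end Collision

/-! ### Comparison with independent particles -/

section Comparison

variable {p : S → S → ℝ} {m : ℝ}

/-- The product of a function over the particles of a configuration. -/
def prodOver (g : S → ℝ) (ξ : S →₀ ℕ) : ℝ := ∏ z ∈ ξ.support, g z ^ ξ z

theorem prodOver_particles (g : S → ℝ) {n : ℕ} (x : Fin n → S) :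
    prodOver g (particles x) = ∏ i, g (x i) := by
  have h : prodOver g (particles x) = (particles x).prod fun z k => g z ^ k := rfl
  rw [h, particles,
    ← Finsupp.prod_finsetSum_index (fun _ => pow_zero _) (fun _ _ _ => pow_add _ _ _)]
  refine Finset.prod_congr rfl fun i _ => ?_
  exact (Finsupp.prod_single_index (h := fun z k => g z ^ k) (pow_zero _)).trans (pow_one _)

theorem sum_apply_particles (ψ : S → ℝ) {n : ℕ} (x : Fin n → S) :
    ∑ i, ψ (x i) = ∑ z ∈ (particles x).support, (particles x z : ℝ) * ψ z := by
  have h : ∑ z ∈ (particles x).support, (particles x z : ℝ) * ψ z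
      = (particles x).sum fun z k => (k : ℝ) * ψ z := rfl
  rw [h, particles, ← Finsupp.sum_finsetSum_index (fun _ => by simp)
    (fun _ _ _ => by push_cast; ring)]
  refine Finset.sum_congr rfl fun i _ => ?_
  rw [Finsupp.sum_single_index (by simp), Nat.cast_one, one_mul]

theorem move_particles {n : ℕ} (x : Fin n → S) (i : Fin n) (y : S) :
    move (particles x) (x i) y = particles (Function.update x i y) := by
  have h1 : particles x
      = Finsupp.single (x i) 1 + ∑ j ∈ Finset.univ.erase i, Finsupp.single (x j) 1 :=
    (Finset.add_sum_erase Finset.univ (fun j => Finsupp.single (x j) 1) (Finset.mem_univ i)).symm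
  have h2 : particles (Function.update x i y)
      = Finsupp.single y 1 + ∑ j ∈ Finset.univ.erase i, Finsupp.single (x j) 1 := by
    rw [particles, ← Finset.add_sum_erase Finset.univ _ (Finset.mem_univ i),
      Function.update_self]
    congr 1
    refine Finset.sum_congr rfl fun j hj => ?_
    rw [Function.update_of_ne (Finset.ne_of_mem_erase hj)]
  rw [move, h2, h1, add_tsub_cancel_left, add_comm]

theorem prodOver_move_add_le (g : S → ℝ) (hg : ∀ z, 0 ≤ g z) (ζ : S →₀ ℕ) {x y : S}
    (hxy : x ≠ y) (hx : ζ x ≠ 0) (hy : ζ y ≠ 0) :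
    2 * prodOver g ζ ≤ prodOver g (move ζ x y) + prodOver g (move ζ y x) := by
  have h0 : ∀ z, (fun z k => g z ^ k : S → ℕ → ℝ) z 0 = 1 := fun z => pow_zero _
  have h1 := prod_eq_mul_restProd (h := fun z k => g z ^ k) ζ hxy h0
  have h2 := prod_move (h := fun z k => g z ^ k) ζ hxy h0
  have h3 := prod_move (h := fun z k => g z ^ k) ζ hxy.symm h0
  rw [restProd_comm ζ y x] at h3
  have hR : 0 ≤ restProd ζ x y fun z k => g z ^ k :=
    Finset.prod_nonneg fun z _ => pow_nonneg (hg z) _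
  set R := restProd ζ x y fun z k => g z ^ k
  rw [prodOver, prodOver, prodOver, h1, h2, h3]
  obtain ⟨a, ha⟩ := Nat.exists_eq_succ_of_ne_zero hx
  obtain ⟨b, hb⟩ := Nat.exists_eq_succ_of_ne_zero hy
  rw [ha, hb]
  simp only [Nat.succ_eq_add_one, Nat.add_sub_cancel]
  have h4 : 0 ≤ g x ^ a * g y ^ b * R * (g x - g y) ^ 2 :=
    mul_nonneg (mul_nonneg (mul_nonneg (pow_nonneg (hg x) _) (pow_nonneg (hg y) _)) hR)
      (sq_nonneg _)
  have h5 : g x ^ a * g y ^ (b + 1 + 1) * R + g y ^ b * g x ^ (a + 1 + 1) * R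
      - 2 * (g x ^ (a + 1) * g y ^ (b + 1) * R) = g x ^ a * g y ^ b * R * (g x - g y) ^ 2 := by
    ring
  linarith

open Classical in
/-- The configuration consisting of the `i`-th particle of a configuration with `n` particles, in
some enumeration of its particles. -/
def nthParticle (n : ℕ) (i : Fin n) (ζ : S →₀ ℕ) : S →₀ ℕ :=
  if h : ζ.degree = n then Finsupp.single ((exists_particles_eq ζ h).choose i) 1 else 0

/-- The product over `n` particles of a function of one-particle configurations. -/
def prodParticles (n : ℕ) (G : Bdd (S →₀ ℕ)) : Bdd (S →₀ ℕ) :=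
  ∏ i : Fin n, Bdd.comp (nthParticle n i) G

theorem bdd_prod_apply {α ι : Type*} (s : Finset ι) (F : ι → Bdd α) (a : α) :
    (∏ i ∈ s, F i) a = ∏ i ∈ s, F i a := by
  classical
  induction s using Finset.induction_on with
  | empty => rfl
  | insert i s hi ih => rw [Finset.prod_insert hi, Finset.prod_insert hi, Bdd.mul_apply, ih]

theorem bdd_sum_apply {α ι : Type*} (s : Finset ι) (F : ι → Bdd α) (a : α) :
    (∑ i ∈ s, F i) a = ∑ i ∈ s, F i a :=
  map_sum (Bdd.eval a) F s

theorem prodParticles_apply {n : ℕ} (G : Bdd (S →₀ ℕ)) {ζ : S →₀ ℕ} (h : ζ.degree = n) :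
    prodParticles n G ζ = prodOver (fun z => G (Finsupp.single z 1)) ζ := by
  rw [prodParticles, bdd_prod_apply]
  simp only [Bdd.comp_apply, nthParticle, dif_pos h]
  rw [← prodOver_particles (fun z => G (Finsupp.single z 1)), (exists_particles_eq ζ h).choose_spec]

/-- The derivative of `prodParticles` in a direction. -/
def prodParticlesDeriv (n : ℕ) (G G' : Bdd (S →₀ ℕ)) : Bdd (S →₀ ℕ) :=
  ∑ i : Fin n, (∏ j ∈ Finset.univ.erase i, Bdd.comp (nthParticle n j) G)
    • Bdd.comp (nthParticle n i) G'

theorem hasDerivAt_prodParticles (n : ℕ) {G : ℝ → Bdd (S →₀ ℕ)} {G' : Bdd (S →₀ ℕ)} {s : ℝ}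
    (h : HasDerivAt G G' s) : HasDerivAt (fun s => prodParticles n (G s))
      (prodParticlesDeriv n (G s) G') s :=
  HasDerivAt.fun_finsetProd fun i _ =>
    (Bdd.comp (nthParticle n i)).hasFDerivAt.comp_hasDerivAt s h

theorem generator_single (hp : IsSymmetricWalk p) (G : (S →₀ ℕ) → ℝ) (x : S) :
    generator p m G (Finsupp.single x 1)
      = ∑' y, p x y * (2 * m * (G (Finsupp.single y 1) - G (Finsupp.single x 1))) := by
  rw [generator, Finsupp.support_single _ one_ne_zero, Finset.sum_singleton]
  refine tsum_congr fun y => ?_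
  by_cases hxy : x = y
  · subst hxy
    simp [hp.loopless]
  · rw [move, tsub_self, zero_add, Finsupp.single_eq_same, Finsupp.single_eq_of_ne (Ne.symm hxy)]
    push_cast
    ring

theorem prodParticlesDeriv_apply (hm : 0 < m) (hp : IsSymmetricWalk p) {n N : ℕ} (hN : 1 ≤ N)
    (G : Bdd (S →₀ ℕ)) {ζ : S →₀ ℕ} (h : ζ.degree = n) :
    prodParticlesDeriv n G (genOp p m N G) ζ
      = ∑ x ∈ ζ.support, ∑' y, p x y * (ζ x : ℝ)
          * (2 * m * (prodParticles n G (move ζ x y) - prodParticles n G ζ)) := by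
  obtain ⟨x, hx⟩ : ∃ x, x = (exists_particles_eq ζ h).choose := ⟨_, rfl⟩
  have hζ : particles x = ζ := by rw [hx, (exists_particles_eq ζ h).choose_spec]
  have hnth : ∀ i, nthParticle n i ζ = Finsupp.single (x i) 1 := fun i => by
    rw [nthParticle, dif_pos h, hx]
  set g : S → ℝ := fun z => G (Finsupp.single z 1) with hg
  have hmove : ∀ i y, prodParticles n G (move ζ (x i) y)
      = (∏ j ∈ Finset.univ.erase i, g (x j)) * g y := fun i y => by
    rw [← hζ, move_particles, prodParticles_apply G (degree_particles _), prodOver_particles,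
      ← Finset.mul_prod_erase Finset.univ _ (Finset.mem_univ i), Function.update_self, mul_comm]
    congr 1
    refine Finset.prod_congr rfl fun j hj => ?_
    rw [Function.update_of_ne (Finset.ne_of_mem_erase hj)]
  have hself : ∀ i, prodParticles n G ζ
      = (∏ j ∈ Finset.univ.erase i, g (x j)) * g (x i) := fun i => by
    rw [prodParticles_apply G h, ← hζ, prodOver_particles,
      ← Finset.mul_prod_erase Finset.univ _ (Finset.mem_univ i), mul_comm]
  have hterm : ∀ i, ((∏ j ∈ Finset.univ.erase i, Bdd.comp (nthParticle n j) G)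
      • Bdd.comp (nthParticle n i) (genOp p m N G)) ζ
      = ∑' y, p (x i) y * (2 * m * (prodParticles n G (move ζ (x i) y)
          - prodParticles n G ζ)) := fun i => by
    rw [smul_eq_mul, Bdd.mul_apply, bdd_prod_apply, Bdd.comp_apply, hnth, genOp_apply hm hp
      (by rwa [Finsupp.degree_single]), generator_single hp, ← tsum_mul_left]
    refine tsum_congr fun y => ?_
    rw [hmove, hself i]
    simp only [Bdd.comp_apply, hnth]
    ring
  rw [prodParticlesDeriv, bdd_sum_apply, Finset.sum_congr rfl fun i _ => hterm i,
    sum_apply_particles (fun z => ∑' y, p z y * (2 * m * (prodParticles n G (move ζ z y)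
          - prodParticles n G ζ))), hζ]
  refine Finset.sum_congr rfl fun z _ => ?_
  rw [← tsum_mul_left]
  exact tsum_congr fun y => by ring

theorem prodParticlesDeriv_le (hm : 0 < m) (hp : IsSymmetricWalk p) {n N : ℕ} (hN : 1 ≤ N)
    (G : Bdd (S →₀ ℕ)) (hG : ∀ z, 0 ≤ G (Finsupp.single z 1)) {ζ : S →₀ ℕ} (h : ζ.degree = n)
    (hn : n ≤ N) :
    prodParticlesDeriv n G (genOp p m N G) ζ ≤ genOp p m N (prodParticles n G) ζ := by
  set U := prodParticles n G with hU
  have hb : ∀ z : S × S, |U (move ζ z.1 z.2) - U ζ| ≤ ‖U‖ + ‖U‖ := fun z =>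
    (abs_sub _ _).trans (add_le_add (U.abs_apply_le _) (U.abs_apply_le _))
  have hb1 : ∀ z : S × S, |2 * m * (U (move ζ z.1 z.2) - U ζ)| ≤ 2 * m * (‖U‖ + ‖U‖) :=
    fun z => by
      rw [abs_mul, abs_of_pos (by positivity : 0 < 2 * m)]
      exact mul_le_mul_of_nonneg_left (hb z) (by positivity)
  rw [prodParticlesDeriv_apply hm hp hN G h, genOp_apply hm hp (h.le.trans hn),
    generator_eq_tsum hm hp ζ U.abs_apply_le,
    ← hp.tsum_pair ζ (c := fun z => 2 * m * (U (move ζ z.1 z.2) - U ζ)) hb1]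
  have hs1 := hp.summable_pair ζ (c := fun z => 2 * m * (U (move ζ z.1 z.2) - U ζ)) hb1
  have hs2 := summable_jumpRate_mul hm hp ζ hb
  rw [← sub_nonneg, ← hs2.tsum_sub hs1]
  have hs := hs2.sub hs1
  set f : S × S → ℝ := fun z => jumpRate p m ζ z * (U (move ζ z.1 z.2) - U ζ)
    - p z.1 z.2 * (ζ z.1 : ℝ) * (2 * m * (U (move ζ z.1 z.2) - U ζ)) with hf
  have hswap : ∑' z : S × S, f z.swap = ∑' z, f z := (Equiv.prodComm S S).tsum_eq f
  have hsum := hs.tsum_add ((Equiv.prodComm S S).summable_iff.2 hs)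
  have hnn : 0 ≤ ∑' z : S × S, (f z + f z.swap) := by
    refine tsum_nonneg fun z => ?_
    obtain ⟨x, y⟩ := z
    have hfz : ∀ x y, f (x, y) = 4 * p x y * ζ x * ζ y * (U (move ζ x y) - U ζ) := fun x y => by
      simp only [hf, jumpRate]
      ring
    rw [Prod.swap_prod_mk, hfz, hfz]
    by_cases hxy : x = y
    · simp [hxy, hp.loopless]
    by_cases hx : ζ x = 0
    · simp [hx]
    by_cases hy : ζ y = 0
    · simp [hy]
    have hcomp := prodOver_move_add_le (fun z => G (Finsupp.single z 1)) hG ζ hxy hx hy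
    rw [hU, prodParticles_apply G h, prodParticles_apply G ((move_degree hx y).trans h),
      prodParticles_apply G ((move_degree hy x).trans h), hp.symm y x]
    have hpn := hp.nonneg x y
    have h1 : 0 ≤ 4 * p x y * ζ x * ζ y := by positivity
    nlinarith [mul_nonneg h1 (sub_nonneg.2 hcomp)]
  have hsum' : ∑' z : S × S, (f z + f z.swap) = ∑' z, f z + ∑' z : S × S, f z.swap := hsum
  rw [hswap] at hsum'
  linarith

/-- Inclusion particles dominate independent particles on products. -/
theorem prod_mean_law_le (hm : 0 < m) (hp : IsSymmetricWalk p) {t : ℝ} (ht : 0 ≤ t)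
    {G : (S →₀ ℕ) → ℝ} (hG0 : ∀ ζ, 0 ≤ G ζ) {C : ℝ} (hG : ∀ ζ, |G ζ| ≤ C) {n : ℕ}
    (x : Fin n → S) : ∏ i, mean (law p m t (Finsupp.single (x i) 1)) G
      ≤ mean (law p m t (particles x)) (prodOver fun z => G (Finsupp.single z 1)) := by
  set N := n + 1 with hNdef
  have hN : 1 ≤ N := by omega
  have hnN : n ≤ N := by omega
  set G₀ : Bdd (S →₀ ℕ) := Bdd.mk G C hG
  set A := genOp p m N with hA
  set Gs : ℝ → Bdd (S →₀ ℕ) := fun s => NormedSpace.exp (s • A) G₀ with hGs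
  have hGsd : ∀ s, HasDerivAt Gs (A (Gs s)) s := fun s =>
    (ContinuousLinearMap.apply ℝ (Bdd (S →₀ ℕ)) G₀).hasFDerivAt.comp_hasDerivAt s
      (hasDerivAt_exp_smul_const' A s)
  have hU : ∀ s, HasDerivAt (fun s => prodParticles n (Gs s))
      (prodParticlesDeriv n (Gs s) (A (Gs s))) s := fun s => hasDerivAt_prodParticles n (hGsd s)
  have hexp0 : NormedSpace.exp ((0 : ℝ) • A) = 1 := exp_zero_smul A
  set φ : ℝ → ℝ := fun s =>
    NormedSpace.exp ((t - s) • A) (prodParticles n (Gs s)) (particles x) with hφ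
  have hsub : ∀ s : ℝ, HasDerivAt (fun s : ℝ => t - s) (-1) s := fun s => by
    simpa using (hasDerivAt_id s).const_sub t
  have hE : ∀ s, HasDerivAt (fun s : ℝ => NormedSpace.exp ((t - s) • A))
      ((-1 : ℝ) • (NormedSpace.exp ((t - s) • A) * A)) s := fun s =>
    HasDerivAt.scomp s (hasDerivAt_exp_smul_const A (t - s)) (hsub s)
  have hd : ∀ s, HasDerivAt φ (NormedSpace.exp ((t - s) • A)
      (prodParticlesDeriv n (Gs s) (A (Gs s)) - A (prodParticles n (Gs s))) (particles x)) s :=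
    fun s => by
      have h1 := (Bdd.eval (particles x)).hasFDerivAt.comp_hasDerivAt s
        ((hE s).clm_apply (hU s))
      refine h1.congr_deriv ?_
      rw [map_sub, Bdd.eval_apply, Bdd.add_apply, Bdd.sub_apply]
      change -1 * NormedSpace.exp ((t - s) • A) (A (prodParticles n (Gs s))) (particles x) + _ = _
      ring
  have hGs0 : ∀ s, 0 ≤ s → ∀ z, Gs s (Finsupp.single z 1)
      = mean (law p m s (Finsupp.single z 1)) G := fun s hs z =>
    exp_genOp_apply_law hm hp hs _ (by rwa [Finsupp.degree_single])
  have hdeg : (particles x).degree ≤ N := (degree_particles x).le.trans hnN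
  have hanti : AntitoneOn φ (Set.Icc 0 t) := by
    refine antitoneOn_of_deriv_nonpos (convex_Icc 0 t)
      (fun s _ => (hd s).continuousAt.continuousWithinAt)
      (fun s _ => (hd s).differentiableAt.differentiableWithinAt) fun s hs => ?_
    rw [interior_Icc] at hs
    rw [(hd s).deriv, exp_genOp_apply_law hm hp (sub_nonneg.2 hs.2.le) _ hdeg, ← neg_nonneg,
      ← neg_one_mul, ← mean_const_mul]
    refine mean_nonneg fun ζ hζ => ?_
    have hζ' : ζ.degree = n := (degree_of_mem_support_law hm hp hζ).trans (degree_particles x)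
    have h1 := prodParticlesDeriv_le hm hp hN (Gs s) (fun z => by
      rw [hGs0 s hs.1.le]
      exact mean_nonneg fun _ _ => hG0 _) hζ' hnN
    rw [Bdd.sub_apply]
    linarith
  have hle := hanti (Set.left_mem_Icc.2 ht) (Set.right_mem_Icc.2 ht) ht
  have h0 : φ 0 = mean (law p m t (particles x)) (prodOver fun z => G (Finsupp.single z 1)) := by
    simp only [hφ, sub_zero]
    rw [exp_genOp_apply_law hm hp ht _ hdeg]
    refine mean_congr fun ζ hζ => ?_
    rw [prodParticles_apply _ ((degree_of_mem_support_law hm hp hζ).trans (degree_particles x))]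
    simp only [hGs, hexp0]
    rfl
  have h1 : φ t = ∏ i, mean (law p m t (Finsupp.single (x i) 1)) G := by
    simp only [hφ, sub_self, hexp0]
    change prodParticles n (Gs t) (particles x) = _
    rw [prodParticles_apply _ (degree_particles x), prodOver_particles]
    exact Finset.prod_congr rfl fun i _ => hGs0 t ht _
  rw [← h0, ← h1]
  exact hle

end Comparison

/-! ### Moment bounds for the duality function -/

section SquareBound

variable {m : ℝ}

theorem descFactorial_sq_le (k l : ℕ) :
    l.descFactorial k ^ 2 ≤ (4 * k) ^ (2 * k) + 2 ^ k * l.descFactorial (2 * k) := by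
  rcases le_or_gt (4 * k) l with h | h
  · refine le_add_left ?_
    have h1 := Nat.descFactorial_mul_descFactorial (n := l) (show k ≤ 2 * k by omega)
    rw [show 2 * k - k = k by omega] at h1
    have h2 : l.descFactorial k ≤ 2 ^ k * (l - k).descFactorial k :=
      calc l.descFactorial k ≤ l ^ k := Nat.descFactorial_le_pow l k
        _ ≤ (2 * (l - k + 1 - k)) ^ k := Nat.pow_le_pow_left (by omega) k
        _ = 2 ^ k * (l - k + 1 - k) ^ k := mul_pow _ _ _
        _ ≤ _ := Nat.mul_le_mul_left _ (Nat.pow_sub_le_descFactorial _ _)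
    calc l.descFactorial k ^ 2 = l.descFactorial k * l.descFactorial k := pow_two _
      _ ≤ 2 ^ k * (l - k).descFactorial k * l.descFactorial k := Nat.mul_le_mul_right _ h2
      _ = _ := by rw [mul_assoc, h1]
  · refine le_add_right ?_
    calc l.descFactorial k ^ 2 ≤ (l ^ k) ^ 2 :=
          Nat.pow_le_pow_left (Nat.descFactorial_le_pow l k) 2
      _ = l ^ (2 * k) := by rw [← pow_mul, mul_comm]
      _ ≤ _ := Nat.pow_le_pow_left h.le _

theorem dualSite_sq_le (hm : 0 < m) (k : ℕ) :
    ∃ C : ℝ, 0 ≤ C ∧ ∀ l, dualSite m k l ^ 2 ≤ C * (1 + dualSite m (2 * k) l) := by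
  have h0 := gamma_add_nat_pos hm 0
  rw [Nat.cast_zero, add_zero] at h0
  have h1 := gamma_add_nat_pos hm k
  have h2 := gamma_add_nat_pos hm (2 * k)
  set c := Real.Gamma (m / 2) / Real.Gamma (m / 2 + k) with hc
  set c' := Real.Gamma (m / 2) / Real.Gamma (m / 2 + (2 * k : ℕ)) with hc'
  have hc0 : 0 < c := by positivity
  have hc0' : 0 < c' := by positivity
  refine ⟨c ^ 2 * ((4 * k : ℝ) ^ (2 * k) + 2 ^ k / c'), by positivity, fun l => ?_⟩
  have h3 : (l.descFactorial k : ℝ) ^ 2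
      ≤ (4 * k : ℝ) ^ (2 * k) + 2 ^ k * (l.descFactorial (2 * k) : ℝ) := by
    exact_mod_cast descFactorial_sq_le k l
  have h4 : dualSite m (2 * k) l = (l.descFactorial (2 * k) : ℝ) * c' := rfl
  have h5 : dualSite m k l = (l.descFactorial k : ℝ) * c := rfl
  have h6 : (2 : ℝ) ^ k * (l.descFactorial (2 * k) : ℝ) = 2 ^ k / c' * dualSite m (2 * k) l := by
    rw [h4]
    field_simp
  have h7 := dualSite_nonneg hm (2 * k) l
  rw [h5, mul_pow, mul_comm, mul_assoc]
  refine mul_le_mul_of_nonneg_left ?_ (by positivity)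
  have h8 : 0 ≤ (4 * k : ℝ) ^ (2 * k) * dualSite m (2 * k) l := by positivity
  have h9 : 0 ≤ (2 : ℝ) ^ k / c' := by positivity
  nlinarith

/-- The square of the duality function is dominated by duality functions. -/
theorem exists_dual_sq_le (hm : 0 < m) (ξ : S →₀ ℕ) :
    ∃ (C : ℝ) (I : Finset (S →₀ ℕ)), 0 ≤ C ∧
      ∀ η : S → ℕ, dual m ξ η ^ 2 ≤ C * ∑ σ ∈ I, dual m σ η := by
  classical
  choose c hc0 hc using fun k => dualSite_sq_le hm k
  set e : Finset S → (S →₀ ℕ) := fun T => Finsupp.indicator T fun x _ => 2 * ξ x with he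
  refine ⟨(∏ x ∈ ξ.support, c (ξ x)), ξ.support.powerset.image e,
    Finset.prod_nonneg fun x _ => hc0 _, fun η => ?_⟩
  have he1 : ∀ T ∈ ξ.support.powerset, ∏ x ∈ T, dualSite m (2 * ξ x) (η x) = dual m (e T) η := by
    intro T hT
    have hval : ∀ x ∈ T, e T x = 2 * ξ x := fun x hx => Finsupp.indicator_of_mem hx _
    have hsupp : (e T).support = T := by
      ext x
      rw [Finsupp.mem_support_iff]
      constructor
      · intro h
        by_contra hx
        exact h (Finsupp.indicator_of_notMem hx _)
      · intro hx
        rw [hval x hx]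
        have := Finsupp.mem_support_iff.1 (Finset.mem_powerset.1 hT hx)
        omega
    rw [dual, hsupp]
    exact Finset.prod_congr rfl fun x hx => by rw [hval x hx]
  have hinj : Set.InjOn e ξ.support.powerset := by
    intro T hT T' hT' h
    have hmem : ∀ U ∈ ξ.support.powerset, ∀ x, x ∈ U ↔ e U x ≠ 0 := by
      intro U hU x
      by_cases hx : x ∈ U
      · have h1 : e U x = 2 * ξ x := Finsupp.indicator_of_mem hx _
        have := Finsupp.mem_support_iff.1 (Finset.mem_powerset.1 hU hx)
        simp only [hx, true_iff, h1]
        omega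
      · have h1 : e U x = 0 := Finsupp.indicator_of_notMem hx _
        simp [hx, h1]
    ext x
    rw [hmem T hT, hmem T' hT', h]
  rw [Finset.sum_image hinj, ← Finset.sum_congr rfl he1, ← Finset.prod_one_add, dual,
    ← Finset.prod_pow, ← Finset.prod_mul_distrib]
  exact Finset.prod_le_prod (fun x _ => sq_nonneg _) fun x _ => hc (ξ x) (η x)

theorem exists_dual_le_add (hm : 0 < m) (ξ : S →₀ ℕ) :
    ∃ (C : NNReal) (I : Finset (S →₀ ℕ)), ∀ (M : NNReal), M ≠ 0 → ∀ η : S → ℕ,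
      ENNReal.ofReal (dual m ξ η) ≤ ENNReal.ofReal (min (dual m ξ η) M)
        + C / M * ∑ σ ∈ I, ENNReal.ofReal (dual m σ η) := by
  obtain ⟨C, I, hC, h⟩ := exists_dual_sq_le hm ξ
  refine ⟨C.toNNReal, I, fun M hM η => ?_⟩
  have hM0 : (0 : ℝ) < M := by positivity
  have hnn := dual_nonneg hm ξ η
  have h1 : dual m ξ η ≤ min (dual m ξ η) M + C / M * ∑ σ ∈ I, dual m σ η := by
    have h2 : dual m ξ η ^ 2 / M ≤ C / M * ∑ σ ∈ I, dual m σ η := by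
      rw [div_mul_eq_mul_div]
      exact div_le_div_of_nonneg_right (h η) hM0.le
    rcases le_total (dual m ξ η) M with h3 | h3
    · rw [min_eq_left h3]
      have : 0 ≤ dual m ξ η ^ 2 / M := by positivity
      linarith
    · rw [min_eq_right h3]
      have : dual m ξ η ≤ dual m ξ η ^ 2 / M := by
        rw [le_div_iff₀ hM0, pow_two]
        exact mul_le_mul_of_nonneg_left h3 hnn
      linarith
  refine (ENNReal.ofReal_le_ofReal h1).trans (ENNReal.ofReal_add_le.trans (le_of_eq ?_))
  have hCM : ENNReal.ofReal (C / M) = (C.toNNReal : ℝ≥0∞) / (M : ℝ≥0∞) := by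
    rw [ENNReal.ofReal_div_of_pos hM0, ENNReal.ofReal_coe_nnreal]
    rfl
  rw [ENNReal.ofReal_mul (by positivity), ENNReal.ofReal_sum_of_nonneg
    fun σ _ => dual_nonneg hm σ η, hCM]

end SquareBound

/-! ### The dual process in a fixed configuration -/

section DualFlow

variable {p : S → S → ℝ} {m : ℝ}

/-- The expectation of the duality function of the process started from `ξ`, in a fixed
configuration `η`. -/
def dualFlow (p : S → S → ℝ) (m t : ℝ) (ξ : S →₀ ℕ) (η : S → ℕ) : ℝ≥0∞ :=
  lmean (law p m t ξ) fun ζ => ENNReal.ofReal (dual m ζ η)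

theorem measurable_dual (ξ : S →₀ ℕ) : Measurable (dual m ξ) :=
  Finset.measurable_prod _ fun x _ => (Measurable.of_discrete (f := dualSite m (ξ x))).comp
    (measurable_pi_apply x)

theorem continuous_dual (ξ : S →₀ ℕ) : Continuous (dual m ξ) :=
  continuous_finsetProd _ fun x _ => (continuous_of_discreteTopology (f := dualSite m (ξ x))).comp
    (continuous_apply x)

theorem measurable_ofReal_dual (ξ : S →₀ ℕ) :
    Measurable fun η : S → ℕ => ENNReal.ofReal (dual m ξ η) :=
  (measurable_dual ξ).ennreal_ofReal

theorem measurable_dualFlow [Countable S] (t : ℝ) (ξ : S →₀ ℕ) :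
    Measurable (dualFlow p m t ξ) :=
  Measurable.tsum fun ζ => (measurable_ofReal_dual ζ).const_mul _

theorem lintegral_dualFlow [Countable S] (t : ℝ) (ξ : S →₀ ℕ) (ν : Measure (S → ℕ)) :
    ∫⁻ η, dualFlow p m t ξ η ∂ν = lmean (law p m t ξ) (dualMoment m ν) := by
  unfold dualFlow lmean
  rw [lintegral_tsum fun ζ => ((measurable_ofReal_dual ζ).const_mul _).aemeasurable]
  exact tsum_congr fun ζ => lintegral_const_mul _ (measurable_ofReal_dual ζ)

theorem restrict_apply_of_mem {Λ : Finset S} {x : S} (hx : x ∈ Λ) (η : S → ℕ) :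
    restrict Λ η x = η x := Finsupp.indicator_of_mem hx _

theorem restrict_apply_le (Λ : Finset S) (η : S → ℕ) (x : S) : restrict Λ η x ≤ η x := by
  by_cases hx : x ∈ Λ
  · exact (restrict_apply_of_mem hx η).le
  · have : restrict Λ η x = 0 := Finsupp.indicator_of_notMem hx _
    omega

theorem dual_mono (hm : 0 < m) (ξ : S →₀ ℕ) {η η' : S → ℕ} (h : ∀ x, η x ≤ η' x) :
    dual m ξ η ≤ dual m ξ η' := by
  refine Finset.prod_le_prod (fun x _ => dualSite_nonneg hm _ _) fun x _ => ?_
  have h1 := gamma_add_nat_pos hm (ξ x)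
  have h0 := gamma_add_nat_pos hm 0
  rw [Nat.cast_zero, add_zero] at h0
  refine mul_le_mul_of_nonneg_right ?_ (by positivity)
  exact_mod_cast Nat.descFactorial_le _ (h x)

theorem dual_restrict {ξ : S →₀ ℕ} {Λ : Finset S} (h : ξ.support ⊆ Λ) (η : S → ℕ) :
    dual m ξ (restrict Λ η) = dual m ξ η :=
  Finset.prod_congr rfl fun x hx => by rw [restrict_apply_of_mem (h hx)]

theorem dualFlow_restrict_le (hm : 0 < m) (t : ℝ) (ξ : S →₀ ℕ) (Λ : Finset S) (η : S → ℕ) :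
    dualFlow p m t ξ (restrict Λ η) ≤ dualFlow p m t ξ η :=
  lmean_mono fun ζ _ => ENNReal.ofReal_le_ofReal (dual_mono hm ζ (restrict_apply_le Λ η))

theorem tendsto_dualFlow_restrict (hm : 0 < m) (t : ℝ) (ξ : S →₀ ℕ) (η : S → ℕ) :
    Tendsto (fun Λ : Finset S => dualFlow p m t ξ (restrict Λ η)) atTop
      (𝓝 (dualFlow p m t ξ η)) := by
  classical
  refine tendsto_order.2 ⟨fun a ha => ?_, fun a ha => Eventually.of_forall fun Λ =>
    (dualFlow_restrict_le hm t ξ Λ η).trans_lt ha⟩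
  have h1 : dualFlow p m t ξ η = ⨆ T : Finset (S →₀ ℕ),
      ∑ ζ ∈ T, law p m t ξ ζ * ENNReal.ofReal (dual m ζ η) := ENNReal.tsum_eq_iSup_sum
  rw [h1, lt_iSup_iff] at ha
  obtain ⟨T, hT⟩ := ha
  filter_upwards [eventually_ge_atTop (T.biUnion Finsupp.support)] with Λ hΛ
  refine hT.trans_le (le_trans (le_of_eq ?_) (ENNReal.sum_le_tsum T))
  refine Finset.sum_congr rfl fun ζ hζ => ?_
  simp only [dual_restrict ((Finset.subset_biUnion_of_mem Finsupp.support hζ).trans hΛ)]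

theorem lmean_law_restrict_dual (hm : 0 < m) (hp : IsSymmetricWalk p) {t : ℝ} (ht : 0 ≤ t)
    (ξ : S →₀ ℕ) (Λ : Finset S) (η : S → ℕ) :
    (lmean (law p m t (restrict Λ η)) fun ζ => ENNReal.ofReal (dual m ξ ζ))
      = dualFlow p m t ξ (restrict Λ η) :=
  (lmean_law_dual hm hp ht ξ (restrict Λ η)).symm

/-- The truncated duality function. -/
def truncDual (m : ℝ) (hm : 0 < m) (ξ : S →₀ ℕ) (M : NNReal) : (S → ℕ) →ᵇ ℝ :=
  BoundedContinuousFunction.ofNormedAddCommGroup (fun η => min (dual m ξ η) M)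
    ((continuous_dual ξ).min continuous_const) M fun η => by
      rw [Real.norm_eq_abs, abs_of_nonneg (le_min (dual_nonneg hm ξ η) M.coe_nonneg)]
      exact min_le_right _ _

theorem truncDual_nonneg (hm : 0 < m) (ξ : S →₀ ℕ) (M : NNReal) (η : S → ℕ) :
    0 ≤ truncDual m hm ξ M η := le_min (dual_nonneg hm ξ η) M.coe_nonneg

theorem bcf_abs_le {X : Type*} [TopologicalSpace X] (f : X →ᵇ ℝ) (x : X) : |f x| ≤ ‖f‖ :=
  f.norm_coe_le_norm x

theorem finSemigroup_bcf (hm : 0 < m) (hp : IsSymmetricWalk p) {t : ℝ} (ht : 0 ≤ t)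
    (f : (S → ℕ) →ᵇ ℝ) (ξ : S →₀ ℕ) :
    finSemigroup p m t (fun ζ => f ζ) ξ = mean (law p m t ξ) fun ζ => f ζ :=
  finSemigroup_eq_mean hm hp ht (fun _ => bcf_abs_le f _) ξ

theorem ofReal_finSemigroup_truncDual (hm : 0 < m) (hp : IsSymmetricWalk p) {t : ℝ}
    (ht : 0 ≤ t) (ξ : S →₀ ℕ) (M : NNReal) (ζ₀ : S →₀ ℕ) :
    ENNReal.ofReal (finSemigroup p m t (fun ζ => truncDual m hm ξ M ζ) ζ₀)
      = lmean (law p m t ζ₀) fun ζ => ENNReal.ofReal (min (dual m ξ ζ) M) := by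
  rw [finSemigroup_bcf hm hp ht]
  exact ofReal_mean _ (F := fun ζ : S →₀ ℕ => truncDual m hm ξ M ζ)
    (fun ζ => truncDual_nonneg hm ξ M ζ) fun ζ => bcf_abs_le _ _

/-- Weak convergence of the laws of the process started from finite parts of `η`, along some
filter. -/
def IsLimitLaw (p : S → S → ℝ) (m t : ℝ) (η : S → ℕ) (l : Filter (Finset S))
    (ρ : Measure (S → ℕ)) : Prop :=
  ∀ f : (S → ℕ) →ᵇ ℝ,
    Tendsto (fun Λ : Finset S => finSemigroup p m t (fun ξ => f ξ) (restrict Λ η)) l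
      (𝓝 (∫ ζ, f ζ ∂ρ))

theorem dualMoment_eq_iSup (m : ℝ) (ρ : Measure (S → ℕ)) (ξ : S →₀ ℕ) :
    dualMoment m ρ ξ = ⨆ n : ℕ, ∫⁻ ζ, ENNReal.ofReal (min (dual m ξ ζ) (n : NNReal)) ∂ρ := by
  rw [← lintegral_iSup]
  · refine lintegral_congr fun ζ => le_antisymm ?_ (iSup_le fun n =>
      ENNReal.ofReal_le_ofReal (min_le_left _ _))
    obtain ⟨n, hn⟩ := exists_nat_ge (dual m ξ ζ)
    refine le_iSup_of_le n (ENNReal.ofReal_le_ofReal (le_min le_rfl ?_))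
    exact_mod_cast hn
  · exact fun n => ((measurable_dual ξ).min measurable_const).ennreal_ofReal
  · intro a b hab ζ
    refine ENNReal.ofReal_le_ofReal (min_le_min le_rfl ?_)
    exact_mod_cast hab

variable [Countable S] {t : ℝ} {η : S → ℕ} {l : Filter (Finset S)} {ρ : Measure (S → ℕ)}
  [IsProbabilityMeasure ρ]

theorem IsLimitLaw.tendsto_truncDual (hm : 0 < m) (hp : IsSymmetricWalk p) (ht : 0 ≤ t)
    (h : IsLimitLaw p m t η l ρ) (ξ : S →₀ ℕ) (M : NNReal) :
    Tendsto (fun Λ : Finset S => lmean (law p m t (restrict Λ η))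
      fun ζ => ENNReal.ofReal (min (dual m ξ ζ) M)) l
      (𝓝 (∫⁻ ζ, ENNReal.ofReal (min (dual m ξ ζ) M) ∂ρ)) := by
  have h1 := (ENNReal.continuous_ofReal.tendsto _).comp (h (truncDual m hm ξ M))
  rw [ofReal_integral_eq_lintegral_ofReal ((truncDual m hm ξ M).integrable ρ)
    (Eventually.of_forall fun ζ => truncDual_nonneg hm ξ M ζ)] at h1
  refine Tendsto.congr (fun Λ => ?_) h1
  exact ofReal_finSemigroup_truncDual hm hp ht ξ M _

theorem IsLimitLaw.dualMoment_le [l.NeBot] (hm : 0 < m) (hp : IsSymmetricWalk p) (ht : 0 ≤ t)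
    (h : IsLimitLaw p m t η l ρ) (ξ : S →₀ ℕ) :
    dualMoment m ρ ξ ≤ dualFlow p m t ξ η := by
  rw [dualMoment_eq_iSup]
  refine iSup_le fun n => le_of_tendsto (h.tendsto_truncDual hm hp ht ξ n) ?_
  refine Eventually.of_forall fun Λ => ?_
  calc _ ≤ lmean (law p m t (restrict Λ η)) fun ζ => ENNReal.ofReal (dual m ξ ζ) :=
        lmean_mono fun ζ _ => ENNReal.ofReal_le_ofReal (min_le_left _ _)
    _ = dualFlow p m t ξ (restrict Λ η) := lmean_law_restrict_dual hm hp ht ξ Λ η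
    _ ≤ _ := dualFlow_restrict_le hm t ξ Λ η

theorem IsLimitLaw.dualFlow_le [l.NeBot] (hl : l ≤ atTop) (hm : 0 < m)
    (hp : IsSymmetricWalk p) (ht : 0 ≤ t) (h : IsLimitLaw p m t η l ρ) {ξ : S →₀ ℕ} {C M : NNReal}
    {I : Finset (S →₀ ℕ)} (hb : ∀ η : S → ℕ,
      ENNReal.ofReal (dual m ξ η) ≤ ENNReal.ofReal (min (dual m ξ η) M)
        + C / M * ∑ σ ∈ I, ENNReal.ofReal (dual m σ η)) :
    dualFlow p m t ξ η ≤ dualMoment m ρ ξ + C / M * ∑ σ ∈ I, dualFlow p m t σ η := by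
  have h1 := (tendsto_dualFlow_restrict (p := p) hm t ξ η).mono_left hl
  have h2 := (h.tendsto_truncDual hm hp ht ξ M).add_const (C / M * ∑ σ ∈ I, dualFlow p m t σ η)
  refine (le_of_tendsto_of_tendsto' h1 h2 fun Λ => ?_).trans ?_
  · rw [← lmean_law_restrict_dual hm hp ht]
    refine (lmean_mono (G := fun ζ : S →₀ ℕ => ENNReal.ofReal (dual m ξ ζ))
      fun ζ _ => hb ζ).trans ?_
    rw [lmean_add, lmean_const_mul, lmean_sum]
    gcongr with σ
    rw [lmean_law_restrict_dual hm hp ht]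
    exact dualFlow_restrict_le hm t σ Λ η
  · gcongr
    exact lintegral_mono fun ζ => ENNReal.ofReal_le_ofReal (min_le_left _ _)

theorem le_of_forall_le_add_div {a b K : ℝ≥0∞} (C : NNReal) (hK : K ≠ ∞)
    (h : ∀ M : NNReal, M ≠ 0 → a ≤ b + C / M * K) : a ≤ b := by
  lift K to NNReal using hK
  refine ENNReal.le_of_forall_pos_le_add fun ε hε _ => ?_
  have hM : C * K / ε + 1 ≠ 0 := by positivity
  refine (h _ hM).trans (add_le_add_right ?_ b)
  rw [← ENNReal.coe_div hM, ← ENNReal.coe_mul, ENNReal.coe_le_coe, div_mul_eq_mul_div,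
    div_le_iff₀ (by positivity), mul_add, mul_one, mul_div_cancel₀ _ hε.ne']
  exact le_self_add

theorem IsLimitLaw.dualMoment_eq [l.NeBot] (hl : l ≤ atTop) (hm : 0 < m)
    (hp : IsSymmetricWalk p) (ht : 0 ≤ t) (h : IsLimitLaw p m t η l ρ)
    (hfin : ∀ σ, dualFlow p m t σ η ≠ ∞) (ξ : S →₀ ℕ) :
    dualMoment m ρ ξ = dualFlow p m t ξ η := by
  refine le_antisymm (h.dualMoment_le hm hp ht ξ) ?_
  obtain ⟨C, I, hb⟩ := exists_dual_le_add hm ξ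
  exact le_of_forall_le_add_div C (ENNReal.sum_ne_top.2 fun σ _ => hfin σ) fun M hM =>
    h.dualFlow_le hl hm hp ht (hb M hM)

end DualFlow

/-! ### Evolution of measures and duality -/

section Evolve

variable {p : S → S → ℝ} {m t : ℝ}

theorem isLawAt_kernel {η : S → ℕ} (h : ∃ ρ, IsLawAt p m t η ρ) :
    IsLawAt p m t η (kernel p m t η) := by
  unfold kernel
  rw [dif_pos h]
  exact h.choose_spec

theorem kernel_of_not {η : S → ℕ} (h : ¬∃ ρ, IsLawAt p m t η ρ) : kernel p m t η = 0 := by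
  unfold kernel
  rw [dif_neg h]

theorem dualMoment_zero_measure (ξ : S →₀ ℕ) :
    dualMoment m (0 : Measure (S → ℕ)) ξ = 0 := by
  simp [dualMoment]

theorem dualMoment_zero (ρ : Measure (S → ℕ)) : dualMoment m ρ 0 = ρ Set.univ := by
  simp [dualMoment, dual]

theorem evolve_of_not_aemeasurable {ν : Measure (S → ℕ)}
    (h : ¬AEMeasurable (kernel p m t) ν) : evolve p m t ν = 0 := by
  rw [evolve, Measure.bind, Measure.map_of_not_aemeasurable h, Measure.join_zero]

theorem dualMoment_evolve {ν : Measure (S → ℕ)} (h : AEMeasurable (kernel p m t) ν)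
    (ξ : S →₀ ℕ) :
    dualMoment m (evolve p m t ν) ξ = ∫⁻ η, dualMoment m (kernel p m t η) ξ ∂ν :=
  Measure.lintegral_bind h (measurable_ofReal_dual ξ).aemeasurable

variable [Countable S]

theorem dualMoment_kernel_le (hm : 0 < m) (hp : IsSymmetricWalk p) (ht : 0 ≤ t) (η : S → ℕ)
    (ξ : S →₀ ℕ) : dualMoment m (kernel p m t η) ξ ≤ dualFlow p m t ξ η := by
  by_cases h : ∃ ρ, IsLawAt p m t η ρ
  · have h' := isLawAt_kernel h
    have := h'.1
    exact IsLimitLaw.dualMoment_le (l := atTop) hm hp ht h'.2 ξ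
  · rw [kernel_of_not h, dualMoment_zero_measure]
    exact zero_le

theorem dualFlow_add_le (hm : 0 < m) (hp : IsSymmetricWalk p) (ht : 0 ≤ t) {ξ : S →₀ ℕ}
    {C M : NNReal} {I : Finset (S →₀ ℕ)} (hb : ∀ η : S → ℕ,
      ENNReal.ofReal (dual m ξ η) ≤ ENNReal.ofReal (min (dual m ξ η) M)
        + C / M * ∑ σ ∈ I, ENNReal.ofReal (dual m σ η)) (η : S → ℕ) :
    dualFlow p m t ξ η + M * kernel p m t η Set.univ ≤
      dualMoment m (kernel p m t η) ξ + C / M * ∑ σ ∈ I, dualFlow p m t σ η + M := by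
  by_cases h : ∃ ρ, IsLawAt p m t η ρ
  · have h' := isLawAt_kernel h
    have := h'.1
    rw [measure_univ, mul_one]
    gcongr
    exact IsLimitLaw.dualFlow_le (l := atTop) le_rfl hm hp ht h'.2 hb
  · rw [kernel_of_not h, dualMoment_zero_measure, zero_add]
    simp only [Measure.coe_zero, Pi.zero_apply, mul_zero, add_zero]
    refine le_of_tendsto' (tendsto_dualFlow_restrict hm t ξ η) fun Λ => ?_
    rw [← lmean_law_restrict_dual hm hp ht]
    refine (lmean_mono (G := fun ζ : S →₀ ℕ => ENNReal.ofReal (dual m ξ ζ))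
      (H := fun ζ : S →₀ ℕ => C / M * ∑ σ ∈ I, ENNReal.ofReal (dual m σ ζ) + M)
      fun ζ _ => (hb ζ).trans ?_).trans ?_
    · rw [add_comm]
      gcongr
      exact (ENNReal.ofReal_le_ofReal (min_le_right _ _)).trans_eq ENNReal.ofReal_coe_nnreal
    · rw [lmean_add, lmean_const, lmean_const_mul, lmean_sum]
      gcongr with σ
      rw [lmean_law_restrict_dual hm hp ht]
      exact dualFlow_restrict_le hm t σ Λ η

theorem dualMoment_evolve_le (hm : 0 < m) (hp : IsSymmetricWalk p) (ht : 0 ≤ t)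
    (ν : Measure (S → ℕ)) (ξ : S →₀ ℕ) :
    dualMoment m (evolve p m t ν) ξ ≤ lmean (law p m t ξ) (dualMoment m ν) := by
  by_cases h : AEMeasurable (kernel p m t) ν
  · rw [dualMoment_evolve h, ← lintegral_dualFlow]
    exact lintegral_mono fun η => dualMoment_kernel_le hm hp ht η ξ
  · rw [evolve_of_not_aemeasurable h, dualMoment_zero_measure]
    exact zero_le

theorem lmean_dualMoment_add_le (hm : 0 < m) (hp : IsSymmetricWalk p) (ht : 0 ≤ t)
    {ν : Measure (S → ℕ)} [IsProbabilityMeasure ν] (hν : AEMeasurable (kernel p m t) ν)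
    {ξ : S →₀ ℕ} {C M : NNReal} {I : Finset (S →₀ ℕ)} (hb : ∀ η : S → ℕ,
      ENNReal.ofReal (dual m ξ η) ≤ ENNReal.ofReal (min (dual m ξ η) M)
        + C / M * ∑ σ ∈ I, ENNReal.ofReal (dual m σ η)) :
    lmean (law p m t ξ) (dualMoment m ν) + M * dualMoment m (evolve p m t ν) 0 ≤
      dualMoment m (evolve p m t ν) ξ
        + ((C / M * ∑ σ ∈ I, lmean (law p m t σ) (dualMoment m ν)) + M) := by
  have h1 := lintegral_mono (μ := ν) fun η => dualFlow_add_le hm hp ht hb η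
  have h2 : Measurable fun η => (C / M * ∑ σ ∈ I, dualFlow p m t σ η : ℝ≥0∞) :=
    (Finset.measurable_fun_sum _ fun σ _ => measurable_dualFlow t σ).const_mul _
  simp only [add_assoc] at h1
  rw [lintegral_add_left (measurable_dualFlow t ξ), lintegral_const_mul' _ _ ENNReal.coe_ne_top,
    lintegral_add_right _ (h2.add_const _), lintegral_add_left h2, lintegral_const, measure_univ,
    mul_one, lintegral_const_mul _ (Finset.measurable_fun_sum _ fun σ _ => measurable_dualFlow t σ),
    lintegral_finsetSum _ fun σ _ => measurable_dualFlow t σ] at h1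
  simp only [lintegral_dualFlow] at h1
  simpa only [dualMoment_evolve hν, dualMoment_zero] using h1

end Evolve

/-! ### Limits of the evolved duality moments -/

section Limit

variable {p : S → S → ℝ} {m : ℝ} {ν μ : Measure (S → ℕ)}

/-- The duality moments as real numbers. -/
def realMoment (m : ℝ) (ν : Measure (S → ℕ)) (ξ : S →₀ ℕ) : ℝ := (dualMoment m ν ξ).toReal

theorem realMoment_nonneg (ν : Measure (S → ℕ)) (ξ : S →₀ ℕ) : 0 ≤ realMoment m ν ξ :=
  ENNReal.toReal_nonneg

theorem UniformlyFiniteMoments.exists_bound (h : UniformlyFiniteMoments m ν) (n : ℕ) :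
    ∃ c : NNReal, ∀ ξ : S →₀ ℕ, ξ.degree = n → dualMoment m ν ξ ≤ c := by
  refine ⟨(⨆ (ξ : S →₀ ℕ) (_ : ξ.degree = n), dualMoment m ν ξ).toNNReal, fun ξ hξ => ?_⟩
  rw [ENNReal.coe_toNNReal (h.2 n).ne]
  exact le_iSup₂ (f := fun (ξ : S →₀ ℕ) (_ : ξ.degree = n) => dualMoment m ν ξ) ξ hξ

theorem UniformlyFiniteMoments.ne_top (h : UniformlyFiniteMoments m ν) (ξ : S →₀ ℕ) :
    dualMoment m ν ξ ≠ ∞ := by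
  obtain ⟨c, hc⟩ := h.exists_bound ξ.degree
  exact ((hc ξ rfl).trans_lt ENNReal.coe_lt_top).ne

theorem UniformlyFiniteMoments.ofReal_realMoment (h : UniformlyFiniteMoments m ν)
    (ξ : S →₀ ℕ) : ENNReal.ofReal (realMoment m ν ξ) = dualMoment m ν ξ :=
  ENNReal.ofReal_toReal (h.ne_top ξ)

theorem UniformlyFiniteMoments.exists_realMoment_le (h : UniformlyFiniteMoments m ν) (n : ℕ) :
    ∃ c : ℝ, 0 ≤ c ∧ ∀ ξ : S →₀ ℕ, ξ.degree = n → realMoment m ν ξ ≤ c := by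
  obtain ⟨c, hc⟩ := h.exists_bound n
  exact ⟨c, c.coe_nonneg, fun ξ hξ => ENNReal.toReal_le_coe_of_le_coe (hc ξ hξ)⟩

/-- The part of a function that lives on configurations with `n` particles. -/
def sector (n : ℕ) (F : (S →₀ ℕ) → ℝ) (ζ : S →₀ ℕ) : ℝ := if ζ.degree = n then F ζ else 0

theorem sector_of_degree {n : ℕ} (F : (S →₀ ℕ) → ℝ) {ζ : S →₀ ℕ} (h : ζ.degree = n) :
    sector n F ζ = F ζ := if_pos h

theorem sector_nonneg (n : ℕ) {F : (S →₀ ℕ) → ℝ} (hF : ∀ ζ, 0 ≤ F ζ) (ζ : S →₀ ℕ) :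
    0 ≤ sector n F ζ := by
  unfold sector
  split_ifs
  · exact hF ζ
  · exact le_rfl

theorem abs_sector_le {n : ℕ} {F : (S →₀ ℕ) → ℝ} (hF : ∀ ζ, 0 ≤ F ζ) {c : ℝ} (hc : 0 ≤ c)
    (h : ∀ ζ, ζ.degree = n → F ζ ≤ c) (ζ : S →₀ ℕ) : |sector n F ζ| ≤ c := by
  rw [abs_of_nonneg (sector_nonneg n hF ζ)]
  unfold sector
  split_ifs with hζ
  · exact h ζ hζ
  · exact hc

theorem mean_sector (hm : 0 < m) (hp : IsSymmetricWalk p) (t : ℝ) (F : (S →₀ ℕ) → ℝ)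
    {ξ : S →₀ ℕ} {n : ℕ} (hξ : ξ.degree = n) :
    mean (law p m t ξ) (sector n F) = mean (law p m t ξ) F :=
  mean_congr fun _ hζ => sector_of_degree F ((degree_of_mem_support_law hm hp hζ).trans hξ)

theorem lmean_dualMoment_le (hm : 0 < m) (hp : IsSymmetricWalk p) {c : ℝ≥0∞} {n : ℕ}
    (hc : ∀ ξ : S →₀ ℕ, ξ.degree = n → dualMoment m ν ξ ≤ c) (t : ℝ) {ξ : S →₀ ℕ}
    (hξ : ξ.degree = n) : lmean (law p m t ξ) (dualMoment m ν) ≤ c := by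
  refine (lmean_mono (H := fun _ => c) fun ζ hζ =>
    hc ζ ((degree_of_mem_support_law hm hp hζ).trans hξ)).trans ?_
  rw [lmean_const]

theorem mean_realMoment (hm : 0 < m) (hp : IsSymmetricWalk p) (h : UniformlyFiniteMoments m ν)
    (t : ℝ) (ξ : S →₀ ℕ) :
    mean (law p m t ξ) (realMoment m ν) = (lmean (law p m t ξ) (dualMoment m ν)).toReal := by
  obtain ⟨c, hc0, hc⟩ := h.exists_realMoment_le ξ.degree
  rw [← mean_sector hm hp t _ rfl, mean_eq_toReal_lmean _ (sector_nonneg _ (realMoment_nonneg ν))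
    (abs_sector_le (realMoment_nonneg ν) hc0 hc)]
  congr 1
  refine lmean_congr fun ζ hζ => ?_
  rw [sector_of_degree _ (degree_of_mem_support_law hm hp hζ), h.ofReal_realMoment]

variable {t : ℕ → ℝ}

theorem tendsto_lmean_dualMoment [Countable S] (hm : 0 < m) (hp : IsSymmetricWalk p)
    (hν : UniformlyFiniteMoments m ν) (ht : Tendsto t atTop atTop) [IsProbabilityMeasure μ]
    (hlim : ∀ ξ : S →₀ ℕ, Tendsto (fun k => dualMoment m (evolve p m (t k) ν) ξ) atTop
      (𝓝 (dualMoment m μ ξ))) (ξ : S →₀ ℕ) :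
    Tendsto (fun k => lmean (law p m (t k) ξ) (dualMoment m ν)) atTop (𝓝 (dualMoment m μ ξ)) := by
  have := hν.1
  have hmass : Tendsto (fun k => dualMoment m (evolve p m (t k) ν) 0) atTop (𝓝 1) := by
    have := hlim 0
    rwa [dualMoment_zero, measure_univ] at this
  choose c hc using hν.exists_bound
  obtain ⟨C, I, hb⟩ := exists_dual_le_add hm ξ
  have hup : limsup (fun k => lmean (law p m (t k) ξ) (dualMoment m ν)) atTop
      ≤ dualMoment m μ ξ := by
    refine le_of_forall_le_add_div (K := ∑ σ ∈ I, (c σ.degree : ℝ≥0∞)) C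
      (ENNReal.sum_ne_top.2 fun σ _ => ENNReal.coe_ne_top) fun M hM => ?_
    have h1 : Tendsto (fun k => dualMoment m (evolve p m (t k) ν) ξ
        + C / M * (∑ σ ∈ I, (c σ.degree : ℝ≥0∞))
        + (M - M * dualMoment m (evolve p m (t k) ν) 0)) atTop
        (𝓝 (dualMoment m μ ξ + C / M * (∑ σ ∈ I, (c σ.degree : ℝ≥0∞)) + (M - M * 1))) :=
      ((hlim ξ).add_const _).add (ENNReal.Tendsto.sub tendsto_const_nhds
        (ENNReal.Tendsto.const_mul hmass (Or.inr ENNReal.coe_ne_top))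
        (Or.inl ENNReal.coe_ne_top))
    rw [mul_one, tsub_self, add_zero] at h1
    rw [← h1.limsup_eq]
    refine limsup_le_limsup ?_
    filter_upwards [ht.eventually_ge_atTop 0, hmass.eventually_ne one_ne_zero] with k hk hk1
    have hmeas : AEMeasurable (kernel p m (t k)) ν := by
      by_contra h
      rw [evolve_of_not_aemeasurable h, dualMoment_zero_measure] at hk1
      exact hk1 rfl
    have h2 := lmean_dualMoment_add_le hm hp hk hmeas (hb M hM)
    rw [← add_assoc] at h2
    have h3 := ENNReal.le_sub_of_add_le_right ?_ h2
    · refine h3.trans (add_tsub_le_assoc.trans ?_)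
      gcongr with σ
      exact lmean_dualMoment_le hm hp (hc σ.degree) _ rfl
    · have h4 := dualMoment_evolve_le hm hp hk ν 0
      exact ENNReal.mul_ne_top ENNReal.coe_ne_top ((h4.trans (lmean_dualMoment_le hm hp
        (hc (0 : S →₀ ℕ).degree) _ rfl)).trans_lt ENNReal.coe_lt_top).ne
  refine tendsto_of_le_liminf_of_limsup_le ?_ hup
  rw [← (hlim ξ).liminf_eq]
  refine liminf_le_liminf ?_
  filter_upwards [ht.eventually_ge_atTop 0] with k hk
  exact dualMoment_evolve_le hm hp hk ν ξ

theorem UniformlyFiniteMoments.of_tendsto (hm : 0 < m) (hp : IsSymmetricWalk p)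
    (hν : UniformlyFiniteMoments m ν) [IsProbabilityMeasure μ]
    (hlim : ∀ ξ : S →₀ ℕ, Tendsto (fun k => lmean (law p m (t k) ξ) (dualMoment m ν)) atTop
      (𝓝 (dualMoment m μ ξ))) : UniformlyFiniteMoments m μ := by
  refine ⟨inferInstance, fun n => ?_⟩
  obtain ⟨c, hc⟩ := hν.exists_bound n
  refine lt_of_le_of_lt (iSup₂_le fun ξ hξ => ?_) (ENNReal.coe_lt_top (r := c))
  exact le_of_tendsto' (hlim ξ) fun k => lmean_dualMoment_le hm hp hc _ hξ

theorem tendsto_mean_realMoment (hm : 0 < m) (hp : IsSymmetricWalk p)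
    (hν : UniformlyFiniteMoments m ν) (hμ : UniformlyFiniteMoments m μ)
    (hlim : ∀ ξ : S →₀ ℕ, Tendsto (fun k => lmean (law p m (t k) ξ) (dualMoment m ν)) atTop
      (𝓝 (dualMoment m μ ξ))) (ξ : S →₀ ℕ) :
    Tendsto (fun k => mean (law p m (t k) ξ) (realMoment m ν)) atTop
      (𝓝 (realMoment m μ ξ)) := by
  simp only [mean_realMoment hm hp hν]
  exact (ENNReal.tendsto_toReal (hμ.ne_top ξ)).comp (hlim ξ)

/-- The limiting duality moments are harmonic for the process of dual particles. -/
theorem mean_law_realMoment (hm : 0 < m) (hp : IsSymmetricWalk p)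
    (hν : UniformlyFiniteMoments m ν) (ht : Tendsto t atTop atTop)
    (hlim : ∀ ξ : S →₀ ℕ, Tendsto (fun k => mean (law p m (t k) ξ) (realMoment m ν)) atTop
      (𝓝 (realMoment m μ ξ))) {s : ℝ} (hs : 0 ≤ s) (ξ : S →₀ ℕ) :
    mean (law p m s ξ) (realMoment m μ) = realMoment m μ ξ := by
  obtain ⟨c, hc0, hc⟩ := hν.exists_realMoment_le ξ.degree
  set F : (S →₀ ℕ) → ℝ := sector ξ.degree (realMoment m ν) with hF
  have hFb : ∀ ζ, |F ζ| ≤ c := abs_sector_le (realMoment_nonneg ν) hc0 hc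
  have h1 : Tendsto (fun k => mean (law p m s ξ) fun ζ => mean (law p m (t k) ζ) F) atTop
      (𝓝 (mean (law p m s ξ) (realMoment m μ))) := by
    refine tendsto_tsum_of_dominated_convergence ((pmf_summable (law p m s ξ)).mul_right c)
      (fun ζ => ?_) (Eventually.of_forall fun k ζ => ?_)
    · by_cases hζ : ζ ∈ (law p m s ξ).support
      · simp only [hF, mean_sector hm hp _ _ (degree_of_mem_support_law hm hp hζ)]
        exact (hlim ζ).const_mul _
      · rw [PMF.mem_support_iff, not_not] at hζ
        simp [hζ]
    · rw [Real.norm_eq_abs, abs_mul, abs_of_nonneg ENNReal.toReal_nonneg]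
      exact mul_le_mul_of_nonneg_left (abs_mean_le _ hFb) ENNReal.toReal_nonneg
  have h2 := (tendsto_mean_law_sub (p := p) hm hFb ξ hs).comp ht
  have h3 : Tendsto (fun k => mean (law p m (t k) ξ) F) atTop (𝓝 (realMoment m μ ξ)) := by
    simp only [hF, mean_sector hm hp _ _ (rfl : ξ.degree = ξ.degree)]
    exact hlim ξ
  have h4 := h2.add h3
  rw [zero_add] at h4
  refine tendsto_nhds_unique h1 (h4.congr' ?_)
  filter_upwards [ht.eventually_ge_atTop 0] with k hk
  simp only [Function.comp_apply, sub_add_cancel]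
  rw [add_comm, law_add hm hp hs hk, mean_bind _ _ hFb]

theorem lmean_law_dualMoment (hm : 0 < m) (hp : IsSymmetricWalk p)
    (hν : UniformlyFiniteMoments m ν) (hμ : UniformlyFiniteMoments m μ)
    (ht : Tendsto t atTop atTop)
    (hlim : ∀ ξ : S →₀ ℕ, Tendsto (fun k => mean (law p m (t k) ξ) (realMoment m ν)) atTop
      (𝓝 (realMoment m μ ξ))) {s : ℝ} (hs : 0 ≤ s) (ξ : S →₀ ℕ) :
    lmean (law p m s ξ) (dualMoment m μ) = dualMoment m μ ξ := by
  have h := mean_law_realMoment hm hp hν ht hlim hs ξ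
  rw [mean_realMoment hm hp hμ] at h
  obtain ⟨c, hc⟩ := hμ.exists_bound ξ.degree
  exact (ENNReal.toReal_eq_toReal_iff' ((lmean_dualMoment_le hm hp hc s rfl).trans_lt
    ENNReal.coe_lt_top).ne (hμ.ne_top ξ)).1 h

end Limit

/-! ### Product measures -/

section Product

variable {p : S → S → ℝ} {m : ℝ}

theorem dualMoment_infinitePi (hm : 0 < m) (θ : S → Measure ℕ)
    [∀ x, IsProbabilityMeasure (θ x)] (ξ : S →₀ ℕ) :
    dualMoment m (Measure.infinitePi θ) ξ
      = ∏ x ∈ ξ.support, ∫⁻ l, ENNReal.ofReal (dualSite m (ξ x) l) ∂(θ x) := by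
  set f : S → ℕ → ℝ≥0∞ := fun x l => ENNReal.ofReal (dualSite m (ξ x) l) with hf
  have hmeas : ∀ x, Measurable (f x) := fun x => Measurable.of_discrete
  have h1 : dualMoment m (Measure.infinitePi θ) ξ
      = ∫⁻ η : S → ℕ, ∏ x ∈ ξ.support, f x (η x) ∂Measure.infinitePi θ := by
    unfold dualMoment
    refine lintegral_congr fun η => ?_
    rw [dual, ENNReal.ofReal_prod_of_nonneg fun x _ => dualSite_nonneg hm _ _]
  have h2 : ∀ x, ∫⁻ η : S → ℕ, f x (η x) ∂Measure.infinitePi θ = ∫⁻ l, f x l ∂(θ x) := fun x =>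
    (measurePreserving_eval_infinitePi θ x).lintegral_comp (hmeas x)
  have h3 := ProbabilityTheory.lintegral_prod_eq_prod_lintegral_of_indepFun ξ.support
    (fun x (η : S → ℕ) => f x (η x)) (ProbabilityTheory.iIndepFun_infinitePi (P := θ) hmeas)
    fun x => (hmeas x).comp (measurable_pi_apply x)
  simp only [h1, h3, h2]
  rfl

theorem realMoment_infinitePi_of_not_collision (hm : 0 < m) (θ : S → Measure ℕ)
    [∀ x, IsProbabilityMeasure (θ x)] {ξ : S →₀ ℕ} (hξ : ξ ∉ collisionSet S) :
    realMoment m (Measure.infinitePi θ) ξ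
      = prodOver (fun x => realMoment m (Measure.infinitePi θ) (Finsupp.single x 1)) ξ := by
  have h1 : ∀ x ∈ ξ.support, ξ x = 1 := fun x hx => by
    have := Finsupp.mem_support_iff.1 hx
    have h2 : ¬2 ≤ ξ x := fun h => hξ ⟨x, h⟩
    omega
  rw [realMoment, dualMoment_infinitePi hm, ENNReal.toReal_prod, prodOver]
  refine Finset.prod_congr rfl fun x hx => ?_
  rw [h1 x hx, pow_one, realMoment, dualMoment_infinitePi hm,
    Finsupp.support_single _ one_ne_zero, Finset.prod_singleton, Finsupp.single_eq_same]

theorem prodOver_nonneg {g : S → ℝ} (hg : ∀ x, 0 ≤ g x) (ξ : S →₀ ℕ) : 0 ≤ prodOver g ξ :=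
  Finset.prod_nonneg fun x _ => pow_nonneg (hg x) _

theorem prodOver_le_pow {g : S → ℝ} (hg : ∀ x, 0 ≤ g x) {C : ℝ} (hC : ∀ x, g x ≤ C)
    (ξ : S →₀ ℕ) : prodOver g ξ ≤ C ^ ξ.degree := by
  rw [Finsupp.degree_apply, ← Finset.prod_pow_eq_pow_sum]
  exact Finset.prod_le_prod (fun x _ => pow_nonneg (hg x) _) fun x _ =>
    pow_le_pow_left₀ (hg x) (hC x) _

/-- If particles separate, the moments of a product measure factorise asymptotically. -/
theorem tendsto_mean_realMoment_sub_prodOver (hm : 0 < m) (hp : IsSymmetricWalk p)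
    (hA2 : AssumptionA2 p m) (θ : S → Measure ℕ) [∀ x, IsProbabilityMeasure (θ x)]
    (hν : UniformlyFiniteMoments m (Measure.infinitePi θ)) (ξ : S →₀ ℕ) :
    Tendsto (fun t => mean (law p m t ξ) (realMoment m (Measure.infinitePi θ))
      - mean (law p m t ξ) (prodOver fun x =>
          realMoment m (Measure.infinitePi θ) (Finsupp.single x 1))) atTop (𝓝 0) := by
  set ν := Measure.infinitePi θ
  set g : S → ℝ := fun x => realMoment m ν (Finsupp.single x 1)
  have hg : ∀ x, 0 ≤ g x := fun x => realMoment_nonneg _ _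
  obtain ⟨c, hc0, hc⟩ := hν.exists_realMoment_le ξ.degree
  obtain ⟨C, hC0, hC⟩ := hν.exists_realMoment_le 1
  have hgC : ∀ x, g x ≤ C := fun x => hC _ (Finsupp.degree_single _ _)
  set F := sector ξ.degree (realMoment m ν) with hF
  set G := sector ξ.degree (prodOver g) with hG
  have hFb : ∀ ζ, |F ζ| ≤ c := abs_sector_le (realMoment_nonneg ν) hc0 hc
  have hGb : ∀ ζ, |G ζ| ≤ C ^ ξ.degree := abs_sector_le (prodOver_nonneg hg) (by positivity)
    fun ζ hζ => hζ ▸ prodOver_le_pow hg hgC ζ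
  set B := c + C ^ ξ.degree with hB
  have hB0 : 0 ≤ B := by positivity
  have hdiff : ∀ ζ, |F ζ - G ζ| ≤ B * (collisionSet S).indicator 1 ζ := by
    intro ζ
    by_cases hζ : ζ ∈ collisionSet S
    · rw [Set.indicator_of_mem hζ, Pi.one_apply, mul_one]
      exact (abs_sub _ _).trans (add_le_add (hFb ζ) (hGb ζ))
    · rw [Set.indicator_of_notMem hζ, mul_zero, hF, hG, sector, sector,
        realMoment_infinitePi_of_not_collision hm θ hζ, sub_self, abs_zero]
  have hFG : ∀ ζ, |F ζ - G ζ| ≤ B := fun ζ =>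
    (abs_sub _ _).trans (add_le_add (hFb ζ) (hGb ζ))
  have hI : ∀ ζ : S →₀ ℕ, |B * (collisionSet S).indicator 1 ζ| ≤ B := fun ζ => by
    rw [abs_mul, abs_of_nonneg hB0]
    exact mul_le_of_le_one_right hB0 (abs_indicator_one_le _ _)
  have hI' : ∀ ζ : S →₀ ℕ, |-B * (collisionSet S).indicator 1 ζ| ≤ B := fun ζ => by
    rw [neg_mul, abs_neg]
    exact hI ζ
  refine squeeze_zero_norm' (a := fun t => B * collisionProb p m t ξ) ?_ ?_
  · filter_upwards [eventually_ge_atTop 0] with t ht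
    rw [← mean_sector hm hp t (realMoment m ν) (rfl : ξ.degree = ξ.degree),
      ← mean_sector hm hp t (prodOver g) (rfl : ξ.degree = ξ.degree), ← mean_sub _ hFb hGb,
      Real.norm_eq_abs, collisionProb_eq_mean hm hp ht, abs_le, ← neg_mul, ← mean_const_mul,
      ← mean_const_mul]
    exact ⟨mean_mono hI' hFG fun ζ _ => by
      rw [neg_mul]
      exact (abs_le.1 (hdiff ζ)).1, mean_mono hFG hI fun ζ _ => (abs_le.1 (hdiff ζ)).2⟩
  · simpa using (hA2.tendsto_collisionProb hm hp ξ).const_mul B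

variable {θ : S → Measure ℕ} [∀ x, IsProbabilityMeasure (θ x)] {t : ℕ → ℝ} {μ : Measure (S → ℕ)}

theorem tendsto_mean_prodOver (hm : 0 < m) (hp : IsSymmetricWalk p)
    (hA2 : AssumptionA2 p m) (hν : UniformlyFiniteMoments m (Measure.infinitePi θ))
    (ht : Tendsto t atTop atTop) (hlim : ∀ ξ : S →₀ ℕ,
      Tendsto (fun k => mean (law p m (t k) ξ) (realMoment m (Measure.infinitePi θ))) atTop
      (𝓝 (realMoment m μ ξ))) (ξ : S →₀ ℕ) :
    Tendsto (fun k => mean (law p m (t k) ξ) (prodOver fun x =>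
      realMoment m (Measure.infinitePi θ) (Finsupp.single x 1))) atTop
      (𝓝 (realMoment m μ ξ)) := by
  have h := (hlim ξ).sub ((tendsto_mean_realMoment_sub_prodOver hm hp hA2 θ hν ξ).comp ht)
  simpa using h

theorem exists_realMoment_le_pow (hm : 0 < m) (hp : IsSymmetricWalk p)
    (hA2 : AssumptionA2 p m) (hν : UniformlyFiniteMoments m (Measure.infinitePi θ))
    (ht : Tendsto t atTop atTop) (hlim : ∀ ξ : S →₀ ℕ,
      Tendsto (fun k => mean (law p m (t k) ξ) (realMoment m (Measure.infinitePi θ))) atTop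
      (𝓝 (realMoment m μ ξ))) :
    ∃ C : ℝ, 0 < C ∧ ∀ ξ, realMoment m μ ξ ≤ C ^ ξ.degree := by
  obtain ⟨C, hC0, hC⟩ := hν.exists_realMoment_le 1
  refine ⟨C + 1, by positivity, fun ξ => ?_⟩
  refine le_of_tendsto' (tendsto_mean_prodOver hm hp hA2 hν ht hlim ξ) fun k => ?_
  have hg : ∀ x : S, 0 ≤ realMoment m (Measure.infinitePi θ) (Finsupp.single x 1) :=
    fun x => realMoment_nonneg _ _
  have hle : ∀ ζ : S →₀ ℕ, ζ.degree = ξ.degree → prodOver (fun x =>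
      realMoment m (Measure.infinitePi θ) (Finsupp.single x 1)) ζ ≤ (C + 1) ^ ξ.degree :=
    fun ζ hζ => hζ ▸ prodOver_le_pow hg
      (fun x => (hC _ (Finsupp.degree_single _ _)).trans (by linarith)) ζ
  rw [← mean_sector hm hp _ _ (rfl : ξ.degree = ξ.degree)]
  exact (le_abs_self _).trans
    (abs_mean_le _ (abs_sector_le (prodOver_nonneg hg) (by positivity) hle))

theorem prod_realMoment_le (hm : 0 < m) (hp : IsSymmetricWalk p)
    (hA2 : AssumptionA2 p m) (hν : UniformlyFiniteMoments m (Measure.infinitePi θ))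
    (ht : Tendsto t atTop atTop) (hlim : ∀ ξ : S →₀ ℕ,
      Tendsto (fun k => mean (law p m (t k) ξ) (realMoment m (Measure.infinitePi θ))) atTop
      (𝓝 (realMoment m μ ξ))) {n : ℕ} (x : Fin n → S) :
    ∏ i, realMoment m μ (Finsupp.single (x i) 1) ≤ realMoment m μ (particles x) := by
  obtain ⟨C, hC0, hC⟩ := hν.exists_realMoment_le 1
  refine le_of_tendsto_of_tendsto
    (tendsto_finsetProd _ fun i _ => hlim (Finsupp.single (x i) 1))
    (tendsto_mean_prodOver hm hp hA2 hν ht hlim (particles x)) ?_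
  filter_upwards [ht.eventually_ge_atTop 0] with k hk
  have h := prod_mean_law_le hm hp hk (sector_nonneg 1 (realMoment_nonneg (Measure.infinitePi θ)))
    (abs_sector_le (realMoment_nonneg _) hC0 hC) x
  simp only [mean_sector hm hp _ _ (Finsupp.degree_single _ 1),
    sector_of_degree _ (Finsupp.degree_single _ 1)] at h
  exact h

end Product

/-! ### The moment problem for duality moments -/

section OneVariable

open ProbabilityTheory

variable {Ω : Type*} [MeasurableSpace Ω] {ρ ρ' : Measure Ω} {X : Ω → ℝ} {δ : ℝ}

theorem Iio_subset_interior_integrableExpSet [IsFiniteMeasure ρ] (hX : Measurable X)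
    (h0 : ∀ ω, 0 ≤ X ω)
    (hfin : ∀ s ∈ Set.Ioo 0 δ, ∫⁻ ω, ENNReal.ofReal (Real.exp (s * X ω)) ∂ρ ≠ ∞) :
    Set.Iio δ ⊆ interior (integrableExpSet X ρ) := by
  refine interior_maximal (fun s hs => ?_) isOpen_Iio
  have hmeas : Measurable fun ω => Real.exp (s * X ω) := (hX.const_mul s).exp
  rcases le_or_gt s 0 with h | h
  · refine Integrable.of_bound hmeas.aestronglyMeasurable 1 (Eventually.of_forall fun ω => ?_)
    rw [Real.norm_eq_abs, Real.abs_exp, Real.exp_le_one_iff]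
    exact mul_nonpos_of_nonpos_of_nonneg h (h0 ω)
  · refine ⟨hmeas.aestronglyMeasurable, ?_⟩
    rw [hasFiniteIntegral_iff_ofReal (Eventually.of_forall fun ω => (Real.exp_pos _).le)]
    exact (hfin s ⟨h, hs⟩).lt_top

/-- A nonnegative random variable with an exponential moment is determined in law by its moment
generating function near the origin. -/
theorem map_eq_of_lintegral_exp_eq [IsFiniteMeasure ρ] [IsFiniteMeasure ρ'] (hX : Measurable X)
    (h0 : ∀ ω, 0 ≤ X ω) (hδ : 0 < δ)
    (hfin : ∀ s ∈ Set.Ioo 0 δ, ∫⁻ ω, ENNReal.ofReal (Real.exp (s * X ω)) ∂ρ ≠ ∞)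
    (heq : ∀ s ∈ Set.Ioo 0 δ, ∫⁻ ω, ENNReal.ofReal (Real.exp (s * X ω)) ∂ρ
      = ∫⁻ ω, ENNReal.ofReal (Real.exp (s * X ω)) ∂ρ') :
    ρ.map X = ρ'.map X := by
  set U : Set ℂ := {z | z.re < δ} with hU
  have h1 : AnalyticOnNhd ℂ (complexMGF X ρ) U := analyticOnNhd_complexMGF.mono fun z hz =>
    Iio_subset_interior_integrableExpSet hX h0 hfin hz
  have h2 : AnalyticOnNhd ℂ (complexMGF X ρ') U := analyticOnNhd_complexMGF.mono fun z hz =>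
    Iio_subset_interior_integrableExpSet hX h0 (fun s hs => heq s hs ▸ hfin s hs) hz
  have hmgf : ∀ s ∈ Set.Ioo 0 δ, complexMGF X ρ (s : ℂ) = complexMGF X ρ' (s : ℂ) := by
    intro s hs
    have hmeas : Measurable fun ω => Real.exp (s * X ω) := (hX.const_mul s).exp
    rw [complexMGF_ofReal, complexMGF_ofReal, mgf, mgf,
      integral_eq_lintegral_of_nonneg_ae (Eventually.of_forall fun ω => (Real.exp_pos _).le)
        hmeas.aestronglyMeasurable,
      integral_eq_lintegral_of_nonneg_ae (Eventually.of_forall fun ω => (Real.exp_pos _).le)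
        hmeas.aestronglyMeasurable, heq s hs]
  have hpre : IsPreconnected U :=
    ((convex_Iio δ).linear_preimage Complex.reLm).isPreconnected
  have hmid : δ / 2 ∈ Set.Ioo 0 δ := ⟨by positivity, by linarith⟩
  have hfreq : ∃ᶠ z in 𝓝[≠] ((δ / 2 : ℝ) : ℂ), complexMGF X ρ z = complexMGF X ρ' z := by
    have hT : Tendsto (fun s : ℝ => (s : ℂ)) (𝓝[≠] (δ / 2)) (𝓝[≠] ((δ / 2 : ℝ) : ℂ)) := by
      refine tendsto_nhdsWithin_iff.2 ⟨(Complex.continuous_ofReal.tendsto _).mono_left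
        nhdsWithin_le_nhds, ?_⟩
      filter_upwards [self_mem_nhdsWithin] with s hs h
      exact hs (Complex.ofReal_injective h)
    refine hT.frequently (Eventually.frequently ?_)
    filter_upwards [mem_nhdsWithin_of_mem_nhds (Ioo_mem_nhds hmid.1 hmid.2)] with s hs
    exact hmgf s hs
  have hon := h1.eqOn_of_preconnected_of_frequently_eq h2 hpre (z₀ := ((δ / 2 : ℝ) : ℂ))
    (by simpa [hU] using hδ) hfreq
  refine Measure.ext_of_charFun (funext fun y => ?_)
  rw [← complexMGF_mul_I hX.aemeasurable, ← complexMGF_mul_I hX.aemeasurable]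
  exact hon (by simpa [hU] using hδ)

end OneVariable

section Expansion

variable {m : ℝ}

theorem siteWeight_mul_dualSite (hm : 0 < m) (k l : ℕ) :
    siteWeight m k * dualSite m k l = l.choose k := by
  have h1 := (gamma_add_nat_pos hm k).ne'
  have h2 := (gamma_add_nat_pos hm 0).ne'
  rw [Nat.cast_zero, add_zero] at h2
  have h3 : (k.factorial : ℝ) ≠ 0 := by positivity
  rw [siteWeight, dualSite, Nat.descFactorial_eq_factorial_mul_choose]
  push_cast
  field_simp

theorem siteWeight_le_pow (hm : 0 < m) (k : ℕ) : siteWeight m k ≤ (1 + m / 2) ^ k := by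
  induction k with
  | zero => rw [siteWeight_zero hm, pow_zero]
  | succ k ih =>
    have h := siteWeight_succ hm k
    have hpos := (siteWeight_pos hm k).le
    have hk : (0 : ℝ) ≤ k := k.cast_nonneg
    have h1 : siteWeight m (k + 1) ≤ (1 + m / 2) * siteWeight m k := by
      refine le_of_mul_le_mul_left ?_ (show (0 : ℝ) < k + 1 by positivity)
      rw [h]
      nlinarith [mul_nonneg (mul_nonneg hk hm.le) hpos]
    rw [pow_succ']
    exact h1.trans (mul_le_mul_of_nonneg_left ih (by positivity))

theorem one_add_pow_eq_tsum (hm : 0 < m) (u : ℝ≥0∞) (l : ℕ) :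
    (1 + u) ^ l = ∑' k, ENNReal.ofReal (siteWeight m k) * u ^ k
      * ENNReal.ofReal (dualSite m k l) := by
  have h1 : ∀ k, ENNReal.ofReal (siteWeight m k) * u ^ k * ENNReal.ofReal (dualSite m k l)
      = u ^ k * (l.choose k : ℝ≥0∞) := fun k => by
    rw [mul_right_comm, ← ENNReal.ofReal_mul (siteWeight_pos hm k).le,
      siteWeight_mul_dualSite hm, ENNReal.ofReal_natCast, mul_comm]
  simp_rw [h1]
  rw [add_comm, add_pow, tsum_eq_sum (s := Finset.range (l + 1))]
  · simp
  · intro k hk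
    rw [Finset.mem_range, not_lt] at hk
    rw [Nat.choose_eq_zero_of_lt (by omega), Nat.cast_zero, mul_zero]

theorem dual_add_single (hm : 0 < m) {ξ : S →₀ ℕ} {x : S} (hx : x ∉ ξ.support) (k : ℕ)
    (η : S → ℕ) : dual m (ξ + Finsupp.single x k) η = dual m ξ η * dualSite m k (η x) := by
  classical
  rcases eq_or_ne k 0 with rfl | hk
  · rw [Finsupp.single_zero, add_zero, dualSite_zero hm, mul_one]
  have hdisj : Disjoint ξ.support (Finsupp.single x k).support := by
    rw [Finsupp.support_single _ hk]
    exact Finset.disjoint_singleton_right.2 hx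
  rw [dual, Finsupp.support_add_eq hdisj, Finset.prod_union hdisj,
    Finsupp.support_single _ hk, Finset.prod_singleton, Finsupp.add_apply,
    Finsupp.notMem_support_iff.1 hx, Finsupp.single_eq_same, zero_add, dual]
  congr 1
  refine Finset.prod_congr rfl fun y hy => ?_
  have hyx : y ≠ x := fun h => hx (h ▸ hy)
  rw [Finsupp.add_apply, Finsupp.single_eq_of_ne hyx, add_zero]

/-- Geometric weights are series of duality functions. -/
theorem exists_prod_one_add_pow_eq_tsum (hm : 0 < m) (Λ : Finset S) (u : S → ℝ≥0∞) :
    ∃ (ι : Type) (_ : Countable ι) (e : ι → S →₀ ℕ) (a : ι → ℝ≥0∞),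
      (∀ i, (e i).support ⊆ Λ) ∧
      (∀ η : S → ℕ, ∏ x ∈ Λ, (1 + u x) ^ η x = ∑' i, a i * ENNReal.ofReal (dual m (e i) η)) ∧
      ∀ C : ℝ≥0∞, ∑' i, a i * C ^ (e i).degree
        = ∏ x ∈ Λ, ∑' k, ENNReal.ofReal (siteWeight m k) * (u x * C) ^ k := by
  classical
  induction Λ using Finset.induction_on with
  | empty =>
    refine ⟨Unit, inferInstance, fun _ => 0, fun _ => 1, fun _ => by simp, fun η => ?_,
      fun C => ?_⟩
    · simp [dual]
    · simp
  | insert x Λ hx ih =>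
    obtain ⟨ι, hι, e, a, hsupp, hprod, hsum⟩ := ih
    refine ⟨ℕ × ι, inferInstance, fun i => e i.2 + Finsupp.single x i.1,
      fun i => ENNReal.ofReal (siteWeight m i.1) * u x ^ i.1 * a i.2, fun i => ?_, fun η => ?_,
      fun C => ?_⟩
    · refine Finsupp.support_add.trans (Finset.union_subset
        ((hsupp i.2).trans (Finset.subset_insert x Λ)) ?_)
      exact Finsupp.support_single_subset.trans (by simp)
    · rw [Finset.prod_insert hx, hprod, one_add_pow_eq_tsum hm, ← ENNReal.tsum_mul_right,
        ENNReal.tsum_prod']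
      refine tsum_congr fun k => ?_
      rw [← ENNReal.tsum_mul_left]
      refine tsum_congr fun i => ?_
      dsimp only
      rw [dual_add_single hm fun h => hx (hsupp i h), ENNReal.ofReal_mul (dual_nonneg hm _ _)]
      ring
    · rw [Finset.prod_insert hx, ← hsum, ← ENNReal.tsum_mul_right, ENNReal.tsum_prod']
      refine tsum_congr fun k => ?_
      rw [← ENNReal.tsum_mul_left]
      refine tsum_congr fun i => ?_
      dsimp only
      rw [map_add, Finsupp.degree_single, pow_add, mul_pow]
      ring

theorem exists_tsum_siteWeight_ne_top (hm : 0 < m) (C : NNReal) :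
    ∃ u : NNReal, 0 < u ∧ ∑' k, ENNReal.ofReal (siteWeight m k) * ((u : ℝ≥0∞) * C) ^ k ≠ ∞ := by
  set B : NNReal := (1 + m / 2).toNNReal with hB
  have hB0 : 0 < B := Real.toNNReal_pos.2 (by positivity)
  refine ⟨2⁻¹ / (B * (C + 1)), by positivity, ?_⟩
  refine ne_top_of_le_ne_top (b := ∑' k : ℕ, (2⁻¹ : ℝ≥0∞) ^ k) ?_ (ENNReal.tsum_le_tsum fun k => ?_)
  · rw [ENNReal.tsum_geometric]
    simp
  · have h1 : ENNReal.ofReal (siteWeight m k) ≤ (B : ℝ≥0∞) ^ k := by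
      rw [hB, ← ENNReal.coe_pow, ← Real.toNNReal_pow (by positivity)]
      exact ENNReal.ofReal_le_ofReal (siteWeight_le_pow hm k)
    calc _ ≤ (B : ℝ≥0∞) ^ k * (((2⁻¹ / (B * (C + 1)) : NNReal) : ℝ≥0∞) * C) ^ k := by gcongr
      _ = ((B * (2⁻¹ / (B * (C + 1)) * C) : NNReal) : ℝ≥0∞) ^ k := by
          rw [← mul_pow, ENNReal.coe_mul, ENNReal.coe_mul]
      _ ≤ ((2⁻¹ : NNReal) : ℝ≥0∞) ^ k := by
          gcongr
          rw [show B * (2⁻¹ / (B * (C + 1)) * C) = 2⁻¹ * (C / (C + 1)) by field_simp]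
          exact mul_le_of_le_one_right zero_le
            (div_le_one_of_le₀ (le_add_of_nonneg_right zero_le) zero_le)
      _ = _ := by norm_num

theorem lintegral_prod_one_add_pow {ι : Type} [Countable ι] {e : ι → S →₀ ℕ} {a : ι → ℝ≥0∞}
    {Λ : Finset S} {u : S → ℝ≥0∞}
    (h : ∀ η : S → ℕ, ∏ x ∈ Λ, (1 + u x) ^ η x = ∑' i, a i * ENNReal.ofReal (dual m (e i) η))
    (ρ : Measure (S → ℕ)) :
    ∫⁻ η, ∏ x ∈ Λ, (1 + u x) ^ η x ∂ρ = ∑' i, a i * dualMoment m ρ (e i) := by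
  simp_rw [h]
  rw [lintegral_tsum fun i => ((measurable_ofReal_dual _).const_mul _).aemeasurable]
  exact tsum_congr fun i => lintegral_const_mul _ (measurable_ofReal_dual _)

end Expansion

section Determinacy

variable {m : ℝ}

/-- A prime number attached to every site. -/
def sitePrime [Countable S] (x : S) : ℕ :=
  Nat.nth Nat.Prime (Classical.choose (Countable.exists_injective_nat S) x)

theorem prime_sitePrime [Countable S] (x : S) : (sitePrime x).Prime := Nat.prime_nth_prime _

theorem sitePrime_injective [Countable S] : Function.Injective (sitePrime (S := S)) :=
  (Nat.nth_injective Nat.infinite_setOfPred_prime).comp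
    (Classical.choose_spec (Countable.exists_injective_nat S))

/-- The logarithm of the Gödel number of the configuration in `Λ`. -/
def logCode [Countable S] (Λ : Finset S) (η : S → ℕ) : ℝ :=
  ∑ x ∈ Λ, η x * Real.log (sitePrime x)

variable [Countable S]

theorem measurable_logCode (Λ : Finset S) : Measurable (logCode Λ) :=
  Finset.measurable_fun_sum _ fun x _ =>
    ((Measurable.of_discrete (f := fun k : ℕ => (k : ℝ))).comp (measurable_pi_apply x)).mul_const _

theorem logCode_nonneg (Λ : Finset S) (η : S → ℕ) : 0 ≤ logCode Λ η :=
  Finset.sum_nonneg fun _ _ => mul_nonneg (Nat.cast_nonneg _) (Real.log_natCast_nonneg _)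

theorem exp_mul_logCode (Λ : Finset S) (s : ℝ) (η : S → ℕ) :
    Real.exp (s * logCode Λ η) = ∏ x ∈ Λ, Real.exp (s * Real.log (sitePrime x)) ^ η x := by
  rw [logCode, Finset.mul_sum, Real.exp_sum]
  refine Finset.prod_congr rfl fun x _ => ?_
  rw [← Real.exp_nat_mul]
  ring_nf

theorem eq_of_logCode_eq {Λ : Finset S} {η ζ : S → ℕ} (h : logCode Λ η = logCode Λ ζ) {x : S}
    (hx : x ∈ Λ) : η x = ζ x := by
  have h1 : ∀ η : S → ℕ, Real.exp (1 * logCode Λ η) = ((∏ x ∈ Λ, sitePrime x ^ η x : ℕ) : ℝ) := by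
    intro η
    rw [exp_mul_logCode]
    push_cast
    refine Finset.prod_congr rfl fun x _ => ?_
    rw [one_mul, Real.exp_log (by exact_mod_cast (prime_sitePrime x).pos)]
  have h2 : ∏ x ∈ Λ, sitePrime x ^ η x = ∏ x ∈ Λ, sitePrime x ^ ζ x := by
    have := h1 η
    rw [h, h1 ζ] at this
    exact_mod_cast this.symm
  have h3 : ∀ η : S → ℕ, (∏ y ∈ Λ, sitePrime y ^ η y).factorization (sitePrime x) = η x := by
    intro η
    rw [Nat.factorization_prod fun y _ => pow_ne_zero _ (prime_sitePrime y).ne_zero,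
      Finsupp.finsetSum_apply, Finset.sum_eq_single_of_mem x hx]
    · rw [(prime_sitePrime x).factorization_pow, Finsupp.single_eq_same]
    · intro y _ hyx
      rw [(prime_sitePrime y).factorization_pow,
        Finsupp.single_eq_of_ne fun h => hyx (sitePrime_injective h).symm]
  rw [← h3 η, ← h3 ζ, h2]

/-- Exponential integrability of the number of particles in finite sets. -/
def HasExpMoments (ρ : Measure (S → ℕ)) : Prop :=
  ∀ Λ : Finset S, ∃ u : NNReal, 0 < u ∧ ∫⁻ η, ∏ x ∈ Λ, (1 + (u : ℝ≥0∞)) ^ η x ∂ρ ≠ ∞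

theorem eq_of_dualMoment_eq (hm : 0 < m) {ρ ρ' : Measure (S → ℕ)} [IsProbabilityMeasure ρ]
    [IsProbabilityMeasure ρ'] (hexp : HasExpMoments ρ)
    (h : ∀ ξ, dualMoment m ρ ξ = dualMoment m ρ' ξ) : ρ = ρ' := by
  have hmap : ∀ Λ : Finset S, ρ.map (logCode Λ) = ρ'.map (logCode Λ) := by
    intro Λ
    obtain ⟨u, hu, hfin⟩ := hexp Λ
    have hδ : ∃ δ > 0, ∀ s ∈ Set.Ioo 0 δ, ∀ x ∈ Λ, Real.exp (s * Real.log (sitePrime x))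
        ≤ 1 + u := by
      have hev : ∀ᶠ s in 𝓝 (0 : ℝ), ∀ x ∈ Λ, Real.exp (s * Real.log (sitePrime x)) < 1 + u := by
        refine (Finset.eventually_all Λ).2 fun x _ => ?_
        have hc : ContinuousAt (fun s : ℝ => Real.exp (s * Real.log (sitePrime x))) 0 := by
          fun_prop
        refine hc.eventually_lt_const ?_
        simpa using hu
      obtain ⟨δ, hδ, hball⟩ := Metric.eventually_nhds_iff.1 hev
      refine ⟨δ, hδ, fun s hs x hx => (hball ?_ x hx).le⟩
      rw [Real.dist_eq, sub_zero, abs_of_pos hs.1]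
      exact hs.2
    obtain ⟨δ, hδ0, hδ⟩ := hδ
    have hform : ∀ s ∈ Set.Ioo 0 δ, ∀ η : S → ℕ, ENNReal.ofReal (Real.exp (s * logCode Λ η))
        = ∏ x ∈ Λ, (1 + ENNReal.ofReal (Real.exp (s * Real.log (sitePrime x)) - 1)) ^ η x := by
      intro s hs η
      rw [exp_mul_logCode, ENNReal.ofReal_prod_of_nonneg fun x _ => by positivity]
      refine Finset.prod_congr rfl fun x _ => ?_
      have h1 : 1 ≤ Real.exp (s * Real.log (sitePrime x)) :=
        Real.one_le_exp (mul_nonneg hs.1.le (Real.log_natCast_nonneg _))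
      rw [ENNReal.ofReal_pow (by positivity), ← ENNReal.ofReal_one,
        ← ENNReal.ofReal_add zero_le_one (by linarith), add_sub_cancel]
    refine map_eq_of_lintegral_exp_eq (measurable_logCode Λ) (logCode_nonneg Λ) hδ0
      (fun s hs => ?_) fun s hs => ?_
    · refine ne_top_of_le_ne_top hfin (lintegral_mono fun η => ?_)
      rw [exp_mul_logCode, ENNReal.ofReal_prod_of_nonneg fun x _ => by positivity]
      refine Finset.prod_le_prod' fun x hx => ?_
      rw [ENNReal.ofReal_pow (by positivity)]
      gcongr
      refine (ENNReal.ofReal_le_ofReal (hδ s hs x hx)).trans_eq ?_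
      rw [ENNReal.ofReal_add zero_le_one u.coe_nonneg, ENNReal.ofReal_one,
        ENNReal.ofReal_coe_nnreal]
    · obtain ⟨ι, hι, e, a, -, hprod, -⟩ := exists_prod_one_add_pow_eq_tsum hm Λ
        fun x => ENNReal.ofReal (Real.exp (s * Real.log (sitePrime x)) - 1)
      simp_rw [hform s hs]
      rw [lintegral_prod_one_add_pow hprod, lintegral_prod_one_add_pow hprod]
      simp_rw [h]
  have hproj : ∀ Λ : Finset S, ρ'.map Λ.restrict = ρ.map Λ.restrict := by
    intro Λ
    refine Measure.ext_of_singleton fun b => ?_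
    have hmr : Measurable (Λ.restrict (π := fun _ : S => ℕ)) := Finset.measurable_restrict Λ
    set b' : S → ℕ := Function.extend Subtype.val b 0 with hb'
    have hb : ∀ x : Λ, b' x = b x := fun x => Subtype.val_injective.extend_apply b 0 x
    have hset : Λ.restrict (π := fun _ : S => ℕ) ⁻¹' {b} = logCode Λ ⁻¹' {logCode Λ b'} := by
      ext η
      simp only [Set.mem_preimage, Set.mem_singleton_iff]
      constructor
      · intro hη
        refine Finset.sum_congr rfl fun x hx => ?_
        rw [hb ⟨x, hx⟩, ← hη]
        rfl
      · intro hη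
        ext x
        rw [← hb x]
        exact eq_of_logCode_eq hη x.2
    rw [Measure.map_apply hmr (measurableSet_singleton b),
      Measure.map_apply hmr (measurableSet_singleton b), hset,
      ← Measure.map_apply (measurable_logCode Λ) (measurableSet_singleton _),
      ← Measure.map_apply (measurable_logCode Λ) (measurableSet_singleton _), hmap Λ]
  have : ∀ Λ : Finset S, IsFiniteMeasure (ρ.map (Λ.restrict (π := fun _ : S => ℕ))) :=
    fun Λ => inferInstance
  exact IsProjectiveLimit.unique (P := fun Λ : Finset S => ρ.map Λ.restrict)
    (fun Λ => rfl) hproj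

end Determinacy

/-! ### Existence of the process -/

section Existence

variable {p : S → S → ℝ} {m t : ℝ}

/-- The law at time `t` of the process with finitely many particles, as a measure on all
configurations. -/
def configLaw (p : S → S → ℝ) (m t : ℝ) (ξ : S →₀ ℕ) : ProbabilityMeasure (S → ℕ) :=
  ⟨((law p m t ξ).map fun ζ : S →₀ ℕ => (ζ : S → ℕ)).toMeasure, inferInstance⟩

theorem configLaw_apply (ξ : S →₀ ℕ) {A : Set (S → ℕ)} (hA : MeasurableSet A) :
    (configLaw p m t ξ : Measure (S → ℕ)) A
      = lmean (law p m t ξ) fun ζ => A.indicator 1 (ζ : S → ℕ) := by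
  rw [← lmean_map]
  change ((law p m t ξ).map fun ζ : S →₀ ℕ => (ζ : S → ℕ)).toMeasure A = _
  rw [PMF.toMeasure_apply _ hA]
  refine tsum_congr fun ζ => ?_
  by_cases hζ : ζ ∈ A <;> simp [hζ]

variable [Countable S]

theorem integral_configLaw (hm : 0 < m) (hp : IsSymmetricWalk p) (ht : 0 ≤ t)
    (f : (S → ℕ) →ᵇ ℝ) (ξ : S →₀ ℕ) :
    ∫ ζ, f ζ ∂(configLaw p m t ξ : Measure (S → ℕ)) = finSemigroup p m t (fun ζ => f ζ) ξ := by
  rw [finSemigroup_bcf hm hp ht]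
  refine (PMF.integral_eq_tsum _ _ (f.integrable _)).trans ?_
  exact mean_map _ (fun ζ : S →₀ ℕ => (ζ : S → ℕ)) (bcf_abs_le f)

theorem exists_one_le_mul_dualSite (hm : 0 < m) {w : ℝ≥0∞} (hw : w ≠ 0) :
    ∃ N : ℕ, ∀ l, N < l → 1 ≤ w * ENNReal.ofReal (dualSite m 1 l) := by
  set c : ℝ≥0∞ := ENNReal.ofReal (Real.Gamma (m / 2) / Real.Gamma (m / 2 + (1 : ℕ))) with hc
  have hc0 : c ≠ 0 := by
    have h1 := gamma_add_nat_pos hm 1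
    have h0 := gamma_add_nat_pos hm 0
    rw [Nat.cast_zero, add_zero] at h0
    exact (ENNReal.ofReal_pos.2 (div_pos h0 h1)).ne'
  obtain ⟨N, hN⟩ := ENNReal.exists_nat_mul_gt (mul_ne_zero hw hc0) ENNReal.one_ne_top
  refine ⟨N, fun l hl => hN.le.trans ?_⟩
  rw [dualSite, ENNReal.ofReal_mul (Nat.cast_nonneg _), ENNReal.ofReal_natCast,
    Nat.descFactorial_one, mul_left_comm]
  gcongr

theorem isTightMeasureSet_configLaw (hm : 0 < m) (hp : IsSymmetricWalk p) (ht : 0 ≤ t)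
    {η : S → ℕ} (hfin : ∀ σ, dualFlow p m t σ η ≠ ∞) :
    IsTightMeasureSet {((ρ : ProbabilityMeasure (S → ℕ)) : Measure (S → ℕ)) |
      ρ ∈ Set.range fun Λ : Finset S => configLaw p m t (restrict Λ η)} := by
  refine isTightMeasureSet_iff_exists_isCompact_measure_compl_le.2 fun ε hε => ?_
  obtain ⟨δ, hδ0, hδ⟩ := ENNReal.exists_pos_sum_of_countable' hε.ne' S
  set B : S → ℝ≥0∞ := fun x => dualFlow p m t (Finsupp.single x 1) η with hB
  set w : S → ℝ≥0∞ := fun x => δ x / (B x + 1) with hw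
  have hw0 : ∀ x, w x ≠ 0 := fun x =>
    (ENNReal.div_pos (hδ0 x).ne' (ENNReal.add_ne_top.2 ⟨hfin _, ENNReal.one_ne_top⟩)).ne'
  choose N hN using fun x => exists_one_le_mul_dualSite hm (hw0 x)
  set K : Set (S → ℕ) := Set.univ.pi fun x => Set.Iic (N x) with hK
  have hKm : MeasurableSet K := MeasurableSet.univ_pi fun x => measurableSet_Iic
  refine ⟨K, isCompact_univ_pi fun x => (Set.finite_Iic (N x)).isCompact, ?_⟩
  rintro _ ⟨_, ⟨Λ, rfl⟩, rfl⟩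
  dsimp only
  rw [configLaw_apply _ hKm.compl]
  calc lmean (law p m t (restrict Λ η)) (fun ζ => Kᶜ.indicator 1 (ζ : S → ℕ))
      ≤ lmean (law p m t (restrict Λ η)) fun ζ => ∑' x, w x *
          ENNReal.ofReal (dual m (Finsupp.single x 1) ζ) := by
        refine lmean_mono fun ζ _ => ?_
        by_cases hζ : (ζ : S → ℕ) ∈ K
        · rw [Set.indicator_of_notMem (by simpa using hζ)]
          exact zero_le
        · rw [Set.indicator_of_mem (by simpa using hζ), Pi.one_apply]
          have : ∃ x, N x < ζ x := by
            by_contra! h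
            exact hζ fun x _ => h x
          obtain ⟨x, hx⟩ := this
          refine le_trans ?_ (ENNReal.le_tsum x)
          rw [dual_single one_ne_zero]
          exact hN x _ hx
    _ = ∑' x, w x * dualFlow p m t (Finsupp.single x 1) (restrict Λ η) := by
        rw [lmean_tsum]
        refine tsum_congr fun x => ?_
        rw [lmean_const_mul, lmean_law_restrict_dual hm hp ht]
    _ ≤ ∑' x, δ x := by
        refine ENNReal.tsum_le_tsum fun x => ?_
        calc _ ≤ δ x / (B x + 1) * (B x + 1) := by
              gcongr
              exact (dualFlow_restrict_le hm t _ Λ η).trans le_self_add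
          _ ≤ δ x := (ENNReal.div_mul_cancel (by simp)
              (ENNReal.add_ne_top.2 ⟨hfin _, ENNReal.one_ne_top⟩)).le
    _ ≤ ε := hδ.le

/-- The configurations from which the process can be started and whose law at time `t` is
determined by its duality moments. -/
structure IsRegular (p : S → S → ℝ) (m t : ℝ) (η : S → ℕ) : Prop where
  dualFlow_ne_top : ∀ σ, dualFlow p m t σ η ≠ ∞
  hasExpMoments : ∀ ρ : Measure (S → ℕ), (∀ ξ, dualMoment m ρ ξ = dualFlow p m t ξ η) →
    HasExpMoments ρ

theorem IsRegular.exists_isLawAt (hm : 0 < m) (hp : IsSymmetricWalk p) (ht : 0 ≤ t)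
    {η : S → ℕ} (h : IsRegular p m t η) : ∃ ρ, IsLawAt p m t η ρ := by
  have hcomp := isCompact_closure_of_isTightMeasureSet
    (isTightMeasureSet_configLaw hm hp ht h.dualFlow_ne_top)
  have hlim : ∀ U : Ultrafilter (Finset S), ∃ ρ : ProbabilityMeasure (S → ℕ),
      IsLimitLaw p m t η U ρ := by
    intro U
    obtain ⟨ρ, -, hρ⟩ := hcomp.ultrafilter_le_nhds
      (U.map fun Λ : Finset S => configLaw p m t (restrict Λ η))
      (le_principal_iff.2 (mem_map.2 (univ_mem' fun Λ => subset_closure ⟨Λ, rfl⟩)))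
    refine ⟨ρ, fun f => ?_⟩
    have h1 := ProbabilityMeasure.tendsto_iff_forall_integral_tendsto.1
      (show Tendsto (fun Λ : Finset S => configLaw p m t (restrict Λ η)) U (𝓝 ρ) from hρ) f
    simpa only [integral_configLaw hm hp ht] using h1
  choose ρ hρ using hlim
  have hdual : ∀ U : Ultrafilter (Finset S), (U : Filter (Finset S)) ≤ atTop → ∀ ξ,
      dualMoment m (ρ U : Measure (S → ℕ)) ξ = dualFlow p m t ξ η := fun U hU ξ =>
    (hρ U).dualMoment_eq hU hm hp ht h.dualFlow_ne_top ξ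
  set U₀ := Ultrafilter.of (atTop : Filter (Finset S))
  have hU₀ : (U₀ : Filter (Finset S)) ≤ atTop := Ultrafilter.of_le _
  refine ⟨ρ U₀, inferInstance, fun f => (tendsto_iff_ultrafilter _ _ _).2 fun U hU => ?_⟩
  have heq : (ρ U : Measure (S → ℕ)) = ρ U₀ :=
    eq_of_dualMoment_eq hm (h.hasExpMoments _ (hdual U hU)) fun ξ =>
      (hdual U hU ξ).trans (hdual U₀ hU₀ ξ).symm
  rw [← heq]
  exact hρ U f

theorem IsRegular.dualMoment_kernel (hm : 0 < m) (hp : IsSymmetricWalk p) (ht : 0 ≤ t)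
    {η : S → ℕ} (h : IsRegular p m t η) (ξ : S →₀ ℕ) :
    dualMoment m (kernel p m t η) ξ = dualFlow p m t ξ η := by
  have h' := isLawAt_kernel (h.exists_isLawAt hm hp ht)
  have := h'.1
  exact IsLimitLaw.dualMoment_eq (l := atTop) le_rfl hm hp ht h'.2 h.dualFlow_ne_top ξ

end Existence

/-! ### Measurability of the transition kernel -/

section Measurability

variable {p : S → S → ℝ} {m t : ℝ}

theorem measurable_comp_restrict (F : (S →₀ ℕ) → ℝ) (Λ : Finset S) :
    Measurable fun η : S → ℕ => F (restrict Λ η) := by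
  have h : (fun η : S → ℕ => F (restrict Λ η)) =
      (fun b : Λ → ℕ => F (Finsupp.indicator Λ fun x hx => b ⟨x, hx⟩)) ∘ Λ.restrict := rfl
  rw [h]
  exact Measurable.of_discrete.comp (Finset.measurable_restrict Λ)

theorem isClopen_of_mem_measurableCylinders {A : Set (S → ℕ)}
    (hA : A ∈ measurableCylinders fun _ : S => ℕ) : IsClopen A := by
  obtain ⟨Λ, T, -, rfl⟩ := (mem_measurableCylinders _).1 hA
  exact (isClopen_discrete T).preimage (Finset.continuous_restrict Λ)

variable [Countable S]

theorem aemeasurable_kernel {μ : Measure (S → ℕ)} (h : ∀ᵐ η ∂μ, ∃ ρ, IsLawAt p m t η ρ) :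
    AEMeasurable (kernel p m t) μ := by
  classical
  obtain ⟨H, hH, hHm, hlaw⟩ := h.exists_measurable_mem
  set κ : (S → ℕ) → Measure (S → ℕ) := fun η =>
    if η ∈ H then kernel p m t η else Measure.dirac 0 with hκ
  have hprob : ∀ η, IsProbabilityMeasure (κ η) := by
    intro η
    by_cases hη : η ∈ H
    · simp only [hκ, if_pos hη]
      exact (isLawAt_kernel (hlaw η hη)).1
    · simp only [hκ, if_neg hη]
      infer_instance
  refine ⟨κ, ?_, ?_⟩
  · refine Measurable.measure_of_isPiSystem_of_isProbabilityMeasure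
      generateFrom_measurableCylinders.symm isPiSystem_measurableCylinders fun A hA => ?_
    have hclopen := isClopen_of_mem_measurableCylinders hA
    have hAm : MeasurableSet A := hclopen.isOpen.measurableSet
    set f : (S → ℕ) →ᵇ ℝ := BoundedContinuousFunction.indicator A hclopen with hf
    obtain ⟨Λ, hΛ⟩ := exists_seq_tendsto (atTop : Filter (Finset S))
    refine measurable_of_tendsto_metrizable (f := fun n η => if η ∈ H then
      ENNReal.ofReal (finSemigroup p m t (fun ξ => f ξ) (restrict (Λ n) η))
      else Measure.dirac (0 : S → ℕ) A) (fun n => ?_) (tendsto_pi_nhds.2 fun η => ?_)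
    · exact Measurable.ite hHm (measurable_comp_restrict _ (Λ n)).ennreal_ofReal measurable_const
    · by_cases hη : η ∈ H
      · simp only [hκ, if_pos hη]
        have h' := isLawAt_kernel (hlaw η hη)
        have := h'.1
        have h1 := ((ENNReal.continuous_ofReal.tendsto _).comp ((h'.2 f).comp hΛ))
        have h2 : ∫ ζ, f ζ ∂(kernel p m t η) = (kernel p m t η).real A := integral_indicator_one hAm
        rw [h2, ofReal_measureReal] at h1
        exact h1
      · simp only [hκ, if_neg hη]
        exact tendsto_const_nhds
  · filter_upwards [hH] with η hη
    simp only [hκ, if_pos hη]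

end Measurability

/-! ### Invariance -/

section Invariance

variable {p : S → S → ℝ} {m t : ℝ} {μ : Measure (S → ℕ)}

theorem hasExpMoments_of_le_pow (hm : 0 < m) {C : NNReal}
    (hC : ∀ ξ : S →₀ ℕ, dualMoment m μ ξ ≤ (C : ℝ≥0∞) ^ ξ.degree) : HasExpMoments μ := by
  intro Λ
  obtain ⟨u, hu, hsum⟩ := exists_tsum_siteWeight_ne_top hm C
  obtain ⟨ι, hι, e, a, -, hprod, hbound⟩ := exists_prod_one_add_pow_eq_tsum hm Λ fun _ => u
  refine ⟨u, hu, ?_⟩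
  rw [lintegral_prod_one_add_pow hprod]
  refine ne_top_of_le_ne_top ?_ (ENNReal.tsum_le_tsum fun i => mul_le_mul_right (hC (e i)) (a i))
  rw [hbound]
  exact ENNReal.prod_ne_top fun x _ => hsum

variable [Countable S]

theorem ae_isRegular (hm : 0 < m) {C : NNReal}
    (hC : ∀ ξ : S →₀ ℕ, dualMoment m μ ξ ≤ (C : ℝ≥0∞) ^ ξ.degree)
    (hharm : ∀ ξ, lmean (law p m t ξ) (dualMoment m μ) = dualMoment m μ ξ) :
    ∀ᵐ η ∂μ, IsRegular p m t η := by
  have hfin : ∀ᵐ η ∂μ, ∀ σ, dualFlow p m t σ η ≠ ∞ := by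
    refine ae_all_iff.2 fun σ => ?_
    have h1 : ∫⁻ η, dualFlow p m t σ η ∂μ ≠ ∞ := by
      rw [lintegral_dualFlow, hharm]
      exact ne_top_of_le_ne_top (ENNReal.pow_ne_top ENNReal.coe_ne_top) (hC σ)
    exact (ae_lt_top (measurable_dualFlow t σ) h1).mono fun η h => h.ne
  obtain ⟨u, hu, hsum⟩ := exists_tsum_siteWeight_ne_top hm C
  have hexp : ∀ᵐ η ∂μ, ∀ Λ : Finset S, ∀ ρ : Measure (S → ℕ),
      (∀ ξ, dualMoment m ρ ξ = dualFlow p m t ξ η) →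
      ∫⁻ ζ, ∏ x ∈ Λ, (1 + (u : ℝ≥0∞)) ^ ζ x ∂ρ ≠ ∞ := by
    refine ae_all_iff.2 fun Λ => ?_
    obtain ⟨ι, hι, e, a, -, hprod, hbound⟩ := exists_prod_one_add_pow_eq_tsum hm Λ fun _ => u
    have hmeas : ∀ i, Measurable fun η => a i * dualFlow p m t (e i) η := fun i =>
      (measurable_dualFlow t (e i)).const_mul _
    have h1 : ∫⁻ η, ∑' i, a i * dualFlow p m t (e i) η ∂μ ≠ ∞ := by
      rw [lintegral_tsum fun i => (hmeas i).aemeasurable]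
      have h2 : ∀ i, ∫⁻ η, a i * dualFlow p m t (e i) η ∂μ ≤ a i * (C : ℝ≥0∞) ^ (e i).degree := by
        intro i
        rw [lintegral_const_mul _ (measurable_dualFlow t (e i)), lintegral_dualFlow, hharm]
        exact mul_le_mul_right (hC (e i)) (a i)
      refine ne_top_of_le_ne_top ?_ (ENNReal.tsum_le_tsum h2)
      rw [hbound]
      exact ENNReal.prod_ne_top fun x _ => hsum
    filter_upwards [ae_lt_top (Measurable.tsum hmeas) h1] with η hη ρ hρ
    rw [lintegral_prod_one_add_pow hprod]
    simp_rw [hρ]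
    exact hη.ne
  filter_upwards [hfin, hexp] with η h1 h2
  exact ⟨h1, fun ρ hρ Λ => ⟨u, hu, h2 Λ ρ hρ⟩⟩

theorem evolve_eq_of_harmonic (hm : 0 < m) (hp : IsSymmetricWalk p) (ht : 0 ≤ t)
    [IsProbabilityMeasure μ] {C : NNReal}
    (hC : ∀ ξ : S →₀ ℕ, dualMoment m μ ξ ≤ (C : ℝ≥0∞) ^ ξ.degree)
    (hharm : ∀ ξ, lmean (law p m t ξ) (dualMoment m μ) = dualMoment m μ ξ) :
    evolve p m t μ = μ := by
  have hreg := ae_isRegular hm hC hharm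
  have hmeas : AEMeasurable (kernel p m t) μ :=
    aemeasurable_kernel (hreg.mono fun η h => h.exists_isLawAt hm hp ht)
  have hmom : ∀ ξ, dualMoment m (evolve p m t μ) ξ = dualMoment m μ ξ := by
    intro ξ
    rw [dualMoment_evolve hmeas, ← hharm ξ, ← lintegral_dualFlow]
    exact lintegral_congr_ae (hreg.mono fun η h => h.dualMoment_kernel hm hp ht ξ)
  have hprob : IsProbabilityMeasure (evolve p m t μ) := by
    refine ⟨?_⟩
    rw [← dualMoment_zero (m := m), hmom, dualMoment_zero, measure_univ]
  exact (eq_of_dualMoment_eq hm (hasExpMoments_of_le_pow hm hC) fun ξ => (hmom ξ).symm).symm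

end Invariance

/-! ### Duality moment functions -/

section MomentFunction

variable {m : ℝ} {μ : Measure (S → ℕ)}

theorem dualityMomentFunction_eq (hm : 0 < m) {n : ℕ} (x : Fin n → S) :
    dualityMomentFunction m μ x = realMoment m μ (particles x) :=
  integral_eq_lintegral_of_nonneg_ae (Eventually.of_forall fun η => dual_nonneg hm _ η)
    (measurable_dual _).aestronglyMeasurable

theorem particles_singleton (x : S) : particles ![x] = Finsupp.single x 1 := by
  simp [particles]

theorem FiniteOrLattice.countable {p : S → S → ℝ} (h : FiniteOrLattice p) : Countable S := by
  rcases h with h | ⟨d, e, -⟩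
  · infer_instance
  · exact e.countable_iff.2 inferInstance

end MomentFunction

end

end SIP

theorem proposition5p2 {S : Type*} (p : S → S → ℝ) (m : ℝ) (hm : 0 < m)
    (hp : SIP.IsSymmetricWalk p) (hS : SIP.FiniteOrLattice p) (hA2 : SIP.AssumptionA2 p m) :
    -- finitely many particles eventually sit at distinct sites
    (∀ (n : ℕ) (x : Fin n → S),
      Tendsto (fun t : ℝ => SIP.collisionProb p m t (SIP.particles x)) atTop (𝓝 0)) ∧
    -- subsequential limits started from product measures
    (SIP.AssumptionA1 p m →
      ∀ (θ : S → Measure ℕ) [∀ x, IsProbabilityMeasure (θ x)],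
        SIP.UniformlyFiniteMoments m (Measure.infinitePi θ) →
      ∀ (t : ℕ → ℝ), Tendsto t atTop atTop →
      ∀ (μ : Measure (S → ℕ)) [IsProbabilityMeasure μ],
        (∀ ξ : S →₀ ℕ,
          Tendsto (fun k => SIP.dualMoment m (SIP.evolve p m (t k) (Measure.infinitePi θ)) ξ) atTop
            (𝓝 (SIP.dualMoment m μ ξ))) →
        SIP.UniformlyFiniteMoments m μ ∧
        SIP.IsInvariant p m μ ∧
        ∀ (n : ℕ) (x : Fin n → S),
          ∏ i, SIP.dualityMomentFunction m μ ![x i] ≤ SIP.dualityMomentFunction m μ x) := by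
  have := hS.countable
  refine ⟨fun n x => hA2.tendsto_collisionProb hm hp _, fun _ θ _ hν t ht μ _ hlim => ?_⟩
  have hlim' := SIP.tendsto_lmean_dualMoment hm hp hν ht hlim
  have hμ := SIP.UniformlyFiniteMoments.of_tendsto hm hp hν hlim'
  have hreal := SIP.tendsto_mean_realMoment hm hp hν hμ hlim'
  obtain ⟨C, hC0, hC⟩ := SIP.exists_realMoment_le_pow hm hp hA2 hν ht hreal
  refine ⟨hμ, fun s hs => ?_, fun n x => ?_⟩
  · refine SIP.evolve_eq_of_harmonic hm hp hs (C := C.toNNReal) (fun ξ => ?_)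
      (SIP.lmean_law_dualMoment hm hp hν hμ ht hreal hs)
    rw [← hμ.ofReal_realMoment]
    exact (ENNReal.ofReal_le_ofReal (hC ξ)).trans_eq (ENNReal.ofReal_pow hC0.le _)
  · simp only [SIP.dualityMomentFunction_eq hm, SIP.particles_singleton]
    exact SIP.prod_realMoment_le hm hp hA2 hν ht hreal x
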